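/- **Setting.** Let $d\ge 2$ be an integer and $r\in\mathbb{Z}$. Let $\hat{\mathfrak h}$ be the complex Lie algebra with basis $\{v^i(m)\mid 1\le i\le d,\ m\in\mathbb{Z}\}\cup\{\mathbf c\}$, $\mathbf c$ central, and $[v^i(m),v^j(n)]=\delta_{m+n,0}\,\delta_{i,j}\,m\,\mathbf c$. In $U(\hat{\mathfrak h})/\langle \mathbf c-1\rangle$ let $v^{ij}(m,n)$ be the image of $v^i(m)v^j(n)$, and put $$\mathcal B=\{v^{ii}(m,n)\mid 1\le i\le d,\ m\le n\}\cup\{v^{ij}(m,n)\mid 1\le i<j\le d,\ m,n\in\mathbb Z\},\qquad \mathcal L=\operatorname{Span}_{\mathbb C}\mathcal B\oplus\mathbb C .$$ Then $\mathcal L$ is closed under commutators. Let $\pi_1,\pi_2$ be the projections of $\mathcal L$ onto $\operatorname{Span}_{\mathbb C}\mathcal B$ and onto $\mathbb C$, and let $\mathcal L_r$ be the Lie algebra $\mathcal L$ with bracket $[x,y]_r=\pi_1(xy-yx)+r\,\pi_2(xy-yx)$. Let $\mathcal B_+$ be the set of those $v^{ij}(m,n)\in\mathcal B$ with $m\ge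 0$ or $n\ge 0$, let $\mathcal L_r^+=\operatorname{Span}_{\mathbb C}\mathcal B_+\oplus\mathbb C$ (a Lie subalgebra of $\mathcal L_r$), and let $M_r=U(\mathcal L_r)\otimes_{U(\mathcal L_r^+)}\mathbb C\mathbf 1$, where $\mathcal B_+$ acts on $\mathbf 1$ by $0$ and each $s\in\mathbb C\subset\mathcal L_r^+$ acts by the scalar $s$. Write $v(m,n)=v^{11}(m,n)$. Let $\mathcal L_r^{(1)}$ be the Lie subalgebra of $\mathcal L_r$ generated by all $v(m,n)$ with $m\le n$, and let $M_r^{(1)}=U(\mathcal L_r^{(1)})\mathbf 1\subset M_r$. For $1\le k\le d$ and $l\in\mathbb Z_{<0}$ put $h_{k,l}=-\tfrac1l\,v^{kk}(l,-l)$; these elements form a basis of an abelian subalgebra $\mathcal H$ of $\mathcal L_r$; let $\Lambda_{k,l}\in\mathcal H^*$ be the dual basis and $Q_+^{(1)}=\sum_{l<0}\mathbb Z_{\ge0}\Lambda_{1,l}$. A *singular vector* of $M_r^{(1)}$ is a nonzero $u\in M_r^{(1)}$ that is homogeneous of some weight $\lambda\in Q_+^{(1)}\setminus\{0\}$ (that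 is, $hu=\lambda(h)u$ for all $h\in\mathcal H$) and satisfies $v(m,n)u=0$ for all $m,n\in\mathbb Z$ with $m+n>0$. For $p\ge1$ let $\mathbf V_p=(v(-s,-t))_{1\le s,t\le p}$, a matrix with pairwise commuting entries, and $$\det\mathbf V_p=\sum_{\sigma\in\mathfrak S_p}\operatorname{sgn}(\sigma)\prod_{q=1}^p v(-q,-\sigma(q))\in U(\mathcal L_r).$$ Let $W_r^{(1)}$ be the $\mathcal L_r^{(1)}$-submodule of $M_r^{(1)}$ generated by all $(\det\mathbf V_p)^\nu\mathbf 1$ with $p,\nu\in\mathbb Z_{\ge1}$ and $r=1-2\nu+p$. **Proposition.** Every singular vector of $M_r^{(1)}$ is a scalar multiple of a singular vector of the form $(\det\mathbf V_p)^\nu\mathbf 1$ for some $p,\nu\in\mathbb Z_{\ge1}$ with $r=1-2\nu+p$. Moreover, $W_r^{(1)}$ is the maximal proper $\mathcal L_r^{(1)}$-submodule of $M_r^{(1)}$ (that is, it is proper and contains every proper $\mathcal L_r^{(1)}$-submodule), and the quotient $\mathcal L_r^{(1)}$-module $M_r^{(1)}/W_r^{(1)}$ is irreducible. -/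

import Mathlib

noncomputable section

namespace NiiboriSagaki

attribute [local instance 100] LieRing.ofAssociativeRing

/-! ### The Heisenberg Lie algebra -/

/-- The vector space with basis `v^i(m)` (`i : Fin d`, `m : ℤ`) together with one more basis
vector `c`: a pair `(f, a)` stands for `∑ f (i, m) v^i(m) + a c`. -/
def Heis (d : ℕ) : Type := (Fin d × ℤ →₀ ℂ) × ℂ

instance (d : ℕ) : AddCommGroup (Heis d) :=
  inferInstanceAs (AddCommGroup ((Fin d × ℤ →₀ ℂ) × ℂ))

instance (d : ℕ) : Module ℂ (Heis d) :=
  inferInstanceAs (Module ℂ ((Fin d × ℤ →₀ ℂ) × ℂ))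

/-- The bilinear form with `ω(v^i(m), v^j(n)) = δ_{m+n,0} δ_{i,j} m`. -/
def heisForm (d : ℕ) : (Fin d × ℤ →₀ ℂ) →ₗ[ℂ] (Fin d × ℤ →₀ ℂ) →ₗ[ℂ] ℂ :=
  Finsupp.lift ((Fin d × ℤ →₀ ℂ) →ₗ[ℂ] ℂ) ℂ (Fin d × ℤ)
    (fun p => (p.2 : ℂ) • Finsupp.lapply (p.1, -p.2))

theorem heisForm_single (d : ℕ) (p q : Fin d × ℤ) :
    heisForm d (Finsupp.single p 1) (Finsupp.single q 1)
      = if p.2 + q.2 = 0 ∧ p.1 = q.1 then (p.2 : ℂ) else 0 := by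
  obtain ⟨i, m⟩ := p
  obtain ⟨j, n⟩ := q
  simp only [heisForm, Finsupp.lift_apply, zero_smul, Finsupp.sum_single_index, one_smul,
    LinearMap.smul_apply, Finsupp.lapply_apply, Finsupp.single_apply, Prod.mk.injEq, smul_eq_mul,
    mul_ite, mul_one, mul_zero]
  refine if_congr ?_ rfl rfl
  constructor
  · rintro ⟨h1, h2⟩
    exact ⟨by omega, h1.symm⟩
  · rintro ⟨h1, h2⟩
    exact ⟨h2.symm, by omega⟩

theorem heisForm_swap (d : ℕ) (f g : Fin d × ℤ →₀ ℂ) :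
    heisForm d f g = - heisForm d g f := by
  have h : heisForm d = - (heisForm d).flip := by
    ext p q
    simp only [LinearMap.comp_apply, Finsupp.lsingle_apply, LinearMap.neg_apply,
      LinearMap.flip_apply, heisForm_single]
    by_cases hpq : p.2 + q.2 = 0 ∧ p.1 = q.1
    · have hqp : q.2 + p.2 = 0 ∧ q.1 = p.1 := ⟨by omega, hpq.2.symm⟩
      rw [if_pos hpq, if_pos hqp]
      have : p.2 = - q.2 := by omega
      rw [this]; push_cast; ring
    · have hqp : ¬ (q.2 + p.2 = 0 ∧ q.1 = p.1) := fun h => hpq ⟨by omega, h.2.symm⟩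
      rw [if_neg hpq, if_neg hqp]; simp
  conv_lhs => rw [h]
  simp

theorem heisForm_self (d : ℕ) (f : Fin d × ℤ →₀ ℂ) : heisForm d f f = 0 :=
  self_eq_neg.mp (heisForm_swap d f f)

/-- The Heisenberg bracket: `[v^i(m), v^j(n)] = δ_{m+n,0} δ_{i,j} m c`, with `c` central. -/
instance (d : ℕ) : LieRing (Heis d) where
  bracket x y := ((0, heisForm d x.1 y.1) : (Fin d × ℤ →₀ ℂ) × ℂ)
  add_lie x y z := Prod.ext (by exact (add_zero 0).symm) (by
    change heisForm d (x.1 + y.1) z.1 = heisForm d x.1 z.1 + heisForm d y.1 z.1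
    simp)
  lie_add x y z := Prod.ext (by exact (add_zero 0).symm) (by
    change heisForm d x.1 (y.1 + z.1) = heisForm d x.1 y.1 + heisForm d x.1 z.1
    simp)
  lie_self x := Prod.ext rfl (heisForm_self d x.1)
  leibniz_lie x y z := Prod.ext (by exact (add_zero 0).symm) (by
    change heisForm d x.1 0 = heisForm d 0 z.1 + heisForm d y.1 0
    simp)

instance (d : ℕ) : LieAlgebra ℂ (Heis d) where
  lie_smul t x y := Prod.ext (by exact (smul_zero t).symm) (by
    change heisForm d x.1 (t • y.1) = t • heisForm d x.1 y.1
    simp)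

/-- The basis vector `v^i(m)`. -/
def heisV {d : ℕ} (i : Fin d) (m : ℤ) : Heis d :=
  ((Finsupp.single (i, m) 1, 0) : (Fin d × ℤ →₀ ℂ) × ℂ)

/-- The central basis vector `c`. -/
def heisC (d : ℕ) : Heis d := ((0, 1) : (Fin d × ℤ →₀ ℂ) × ℂ)

theorem heis_bracket {d : ℕ} (i j : Fin d) (m n : ℤ) :
    ⁅heisV i m, heisV j n⁆ = (if m + n = 0 ∧ i = j then (m : ℂ) else 0) • heisC d := by
  refine Prod.ext (by exact (smul_zero _).symm) ?_
  refine (heisForm_single d (i, m) (j, n)).trans ?_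
  exact (mul_one _).symm

/-! ### The algebra `U(ĥ)/⟨c - 1⟩` -/

/-- The relation `c = 1` on the universal enveloping algebra. -/
inductive CRel (d : ℕ) :
    UniversalEnvelopingAlgebra ℂ (Heis d) → UniversalEnvelopingAlgebra ℂ (Heis d) → Prop
  | c_eq_one : CRel d (UniversalEnvelopingAlgebra.ι ℂ (heisC d)) 1

/-- The quotient of `U(ĥ)` by the two-sided ideal generated by `c - 1`. -/
abbrev WeylAlg (d : ℕ) : Type := RingQuot (CRel d)

/-- The image of `v^i(m)` in `U(ĥ)/⟨c - 1⟩`. -/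
def gen {d : ℕ} (i : Fin d) (m : ℤ) : WeylAlg d :=
  RingQuot.mkAlgHom ℂ (CRel d) (UniversalEnvelopingAlgebra.ι ℂ (heisV i m))

/-- `v^{ij}(m, n) = v^i(m) v^j(n)` modulo `⟨c - 1⟩`. -/
def vv {d : ℕ} (i j : Fin d) (m n : ℤ) : WeylAlg d := gen i m * gen j n

theorem gen_comm {d : ℕ} (i j : Fin d) (m n : ℤ) :
    gen i m * gen j n
      = gen j n * gen i m + (if m + n = 0 ∧ i = j then (m : ℂ) else 0) • (1 : WeylAlg d) := by
  have h := congrArg (fun x => RingQuot.mkAlgHom ℂ (CRel d) (UniversalEnvelopingAlgebra.ι ℂ x))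
    (heis_bracket i j m n)
  simp only [LieHom.map_lie, LieRing.of_associative_ring_bracket, map_sub, map_mul, map_smul,
    RingQuot.mkAlgHom_rel ℂ (CRel.c_eq_one (d := d)), map_one] at h
  rw [← sub_eq_iff_eq_add']
  exact h

/-- The set `B`: all `v^{ii}(m, n)` with `m ≤ n`, and all `v^{ij}(m, n)` with `i < j`. -/
def setB (d : ℕ) : Set (WeylAlg d) :=
  {x | ∃ (i : Fin d) (m n : ℤ), m ≤ n ∧ x = vv i i m n} ∪
  {x | ∃ (i j : Fin d) (m n : ℤ), i < j ∧ x = vv i j m n}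

/-- The space `L = span B ⊕ ℂ` inside `U(ĥ)/⟨c - 1⟩`. -/
def calL (d : ℕ) : Submodule ℂ (WeylAlg d) :=
  Submodule.span ℂ (setB d) ⊔ Submodule.span ℂ {1}

theorem one_mem_calL (d : ℕ) : (1 : WeylAlg d) ∈ calL d :=
  Submodule.mem_sup_right (Submodule.mem_span_singleton_self 1)

theorem vv_mem_calL {d : ℕ} (i j : Fin d) (m n : ℤ) : vv i j m n ∈ calL d := by
  have key : ∀ (i j : Fin d) (m n : ℤ), vv i j m n ∈ setB d → vv j i n m ∈ calL d := by
    intro i j m n h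
    have h1 : vv i j m n ∈ calL d := Submodule.mem_sup_left (Submodule.subset_span h)
    have h2 := gen_comm j i n m
    rw [vv, h2]
    exact add_mem h1 (Submodule.smul_mem _ _ (one_mem_calL d))
  rcases lt_trichotomy i j with h | h | h
  · exact Submodule.mem_sup_left (Submodule.subset_span (Or.inr ⟨i, j, m, n, h, rfl⟩))
  · subst h
    rcases le_total m n with h | h
    · exact Submodule.mem_sup_left (Submodule.subset_span (Or.inl ⟨i, m, n, h, rfl⟩))
    · exact key i i n m (Or.inl ⟨i, n, m, h, rfl⟩)
  · exact key j i n m (Or.inr ⟨j, i, n, m, h, rfl⟩)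

theorem calL_eq_span (d : ℕ) :
    calL d = Submodule.span ℂ
      ({x | ∃ (i j : Fin d) (m n : ℤ), x = vv i j m n} ∪ {1}) := by
  apply le_antisymm
  · refine sup_le (Submodule.span_mono ?_) (Submodule.span_mono Set.subset_union_right)
    rintro x (⟨i, m, n, -, rfl⟩ | ⟨i, j, m, n, -, rfl⟩)
    · exact Or.inl ⟨i, i, m, n, rfl⟩
    · exact Or.inl ⟨i, j, m, n, rfl⟩
  · rw [Submodule.span_le]
    rintro x (⟨i, j, m, n, rfl⟩ | rfl)
    · exact vv_mem_calL i j m n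
    · exact one_mem_calL d

/-- `L` is closed under the commutator. -/
theorem comm_mem_calL {d : ℕ} {x y : WeylAlg d} (hx : x ∈ calL d) (hy : y ∈ calL d) :
    x * y - y * x ∈ calL d := by
  rw [calL_eq_span] at hx hy
  induction hx, hy using Submodule.span_induction₂ with
  | mem_mem x y hx hy =>
    rcases hx with ⟨i, j, m, n, rfl⟩ | rfl
    · rcases hy with ⟨k, l, s, t, rfl⟩ | rfl
      · have e1 := gen_comm j k n s
        have e2 := gen_comm i k m s
        have e3 := gen_comm j l n t
        have e4 := gen_comm i l m t
        set a := gen i m with ha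
        set b := gen j n with hb
        set c := gen k s with hc
        set e := gen l t with he
        set p := (if n + s = 0 ∧ j = k then (n : ℂ) else 0) with hp
        set q := (if m + s = 0 ∧ i = k then (m : ℂ) else 0) with hq
        set u := (if n + t = 0 ∧ j = l then (n : ℂ) else 0) with hu
        set w := (if m + t = 0 ∧ i = l then (m : ℂ) else 0) with hw
        have : vv i j m n * vv k l s t - vv k l s t * vv i j m n
            = p • vv i l m t + q • vv j l n t + u • vv k i s m + w • vv k j s n := by
          simp only [vv, ← ha, ← hb, ← hc, ← he]
          calc a * b * (c * e) - c * e * (a * b)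
              = a * (b * c) * e - c * (e * a * b) := by noncomm_ring
            _ = a * (c * b + p • 1) * e - c * (e * a * b) := by rw [e1]
            _ = (a * c) * (b * e) + p • (a * e) - c * (e * a * b) := by
                simp only [mul_add, add_mul, mul_smul_comm, smul_mul_assoc, mul_one]
                noncomm_ring
            _ = (c * a + q • 1) * (b * e) + p • (a * e) - c * (e * a * b) := by rw [e2]
            _ = c * (a * (b * e)) + q • (b * e) + p • (a * e) - c * (e * a * b) := by
                simp only [add_mul, smul_mul_assoc, one_mul, mul_assoc]
            _ = c * (a * (e * b + u • 1)) + q • (b * e) + p • (a * e) - c * (e * a * b) := by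
                rw [e3]
            _ = c * ((a * e) * b) + u • (c * a) + q • (b * e) + p • (a * e)
                  - c * (e * a * b) := by
                simp only [mul_add, mul_smul_comm, mul_one, mul_assoc]
            _ = c * ((e * a + w • 1) * b) + u • (c * a) + q • (b * e) + p • (a * e)
                  - c * (e * a * b) := by rw [e4]
            _ = _ := by
                simp only [add_mul, mul_add, mul_smul_comm, smul_mul_assoc, one_mul]
                abel
        rw [this]
        exact add_mem (add_mem (add_mem (Submodule.smul_mem _ _ (vv_mem_calL _ _ _ _))
          (Submodule.smul_mem _ _ (vv_mem_calL _ _ _ _)))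
          (Submodule.smul_mem _ _ (vv_mem_calL _ _ _ _)))
          (Submodule.smul_mem _ _ (vv_mem_calL _ _ _ _))
      · simp
    · simp
  | zero_left y hy => simp
  | zero_right x hx => simp
  | add_left x y z hx hy hz h1 h2 =>
    have : (x + y) * z - z * (x + y) = (x * z - z * x) + (y * z - z * y) := by noncomm_ring
    rw [this]; exact add_mem h1 h2
  | add_right x y z hx hy hz h1 h2 =>
    have : x * (y + z) - (y + z) * x = (x * y - y * x) + (x * z - z * x) := by noncomm_ring
    rw [this]; exact add_mem h1 h2
  | smul_left t x y hx hy h =>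
    have : (t • x) * y - y * (t • x) = t • (x * y - y * x) := by
      rw [smul_mul_assoc, mul_smul_comm, smul_sub]
    rw [this]; exact Submodule.smul_mem _ _ h
  | smul_right t x y hx hy h =>
    have : x * (t • y) - (t • y) * x = t • (x * y - y * x) := by
      rw [smul_mul_assoc, mul_smul_comm, smul_sub]
    rw [this]; exact Submodule.smul_mem _ _ h

/-! ### `span B` and `ℂ` are independent

This uses the action on polynomials in variables `X_{i,m}`: `v^i(m)` is multiplication by
`X_{i,m}` for `m ≤ 0` and `m ∂/∂X_{i,-m}` for `m > 0`. -/

/-- The operator of `v^i(m)` on polynomials. -/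
def fockGen {d : ℕ} (p : Fin d × ℤ) : Module.End ℂ (MvPolynomial (Fin d × ℤ) ℂ) :=
  if 0 < p.2 then (p.2 : ℂ) • (MvPolynomial.pderiv (p.1, -p.2)).toLinearMap
  else LinearMap.mulLeft ℂ (MvPolynomial.X p)

theorem fockGen_comm {d : ℕ} (p q : Fin d × ℤ) :
    fockGen p * fockGen q - fockGen q * fockGen p
      = (if p.2 + q.2 = 0 ∧ p.1 = q.1 then (p.2 : ℂ) else 0) •
        (1 : Module.End ℂ (MvPolynomial (Fin d × ℤ) ℂ)) := by
  classical
  obtain ⟨i, m⟩ := p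
  obtain ⟨j, n⟩ := q
  apply LinearMap.ext
  intro f
  by_cases hm : 0 < m <;> by_cases hn : 0 < n
  · have h0 : ¬ (m + n = 0 ∧ i = j) := fun h => by omega
    have hc : ⁅MvPolynomial.pderiv (R := ℂ) (i, -m), MvPolynomial.pderiv (R := ℂ) (j, -n)⁆ = 0 :=
      MvPolynomial.derivation_ext fun x => by
        simp [Derivation.commutator_apply, MvPolynomial.pderiv_X, Pi.single_apply,
          apply_ite (MvPolynomial.pderiv _)]
    have hc' := DFunLike.congr_fun hc f
    rw [Derivation.commutator_apply, Derivation.zero_apply, sub_eq_zero] at hc'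
    simp [fockGen, hm, hn, h0, hc', smul_smul, mul_comm]
  · by_cases h : m + n = 0 ∧ i = j
    · obtain ⟨h1, rfl⟩ := h
      obtain rfl : n = -m := by omega
      have hm' : ¬ m < 0 := by omega
      simp [fockGen, hm, hm', MvPolynomial.smul_eq_C_mul]
    · have hne : (j, n) ≠ (i, -m) := fun h' => by
        simp only [Prod.mk.injEq] at h'
        exact h ⟨by omega, h'.1.symm⟩
      simp [fockGen, hm, hn, h, MvPolynomial.pderiv_X_of_ne hne]
  · by_cases h : m + n = 0 ∧ i = j
    · obtain ⟨h1, rfl⟩ := h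
      obtain rfl : m = -n := by omega
      have hn' : ¬ n < 0 := by omega
      simp [fockGen, hn, hn', MvPolynomial.smul_eq_C_mul]
    · have hne : (i, m) ≠ (j, -n) := fun h' => by
        simp only [Prod.mk.injEq] at h'
        exact h ⟨by omega, h'.1⟩
      simp [fockGen, hm, hn, h, MvPolynomial.pderiv_X_of_ne hne]
  · have h0 : ¬ (m + n = 0 ∧ i = j ∧ ¬ m = 0) := fun h => by omega
    by_cases h : m + n = 0 ∧ i = j
    · obtain ⟨h1, rfl⟩ := h
      obtain rfl : m = 0 := by omega
      obtain rfl : n = 0 := by omega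
      simp [fockGen]
    · simp [fockGen, hm, hn, h, mul_left_comm]

/-- The linear span of the `v^i(m)` acting on polynomials. -/
def fockLin (d : ℕ) :
    (Fin d × ℤ →₀ ℂ) →ₗ[ℂ] Module.End ℂ (MvPolynomial (Fin d × ℤ) ℂ) :=
  Finsupp.lift _ ℂ (Fin d × ℤ) fockGen

theorem fockLin_comm {d : ℕ} (f g : Fin d × ℤ →₀ ℂ) :
    fockLin d f * fockLin d g - fockLin d g * fockLin d f
      = heisForm d f g • (1 : Module.End ℂ (MvPolynomial (Fin d × ℤ) ℂ)) := by
  induction f using Finsupp.induction_linear with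
  | zero => simp
  | add f f' h h' =>
    rw [map_add, map_add, LinearMap.add_apply, add_smul, ← h, ← h', add_mul, mul_add]
    abel
  | single p a =>
    induction g using Finsupp.induction_linear with
    | zero => simp
    | add g g' h h' =>
      rw [map_add, map_add, add_smul, ← h, ← h', add_mul, mul_add]
      abel
    | single q b =>
      have e : ∀ (p : Fin d × ℤ) (a : ℂ), Finsupp.single p a = a • Finsupp.single p (1 : ℂ) := by
        intro p a; simp
      have e' : ∀ p : Fin d × ℤ, fockLin d (Finsupp.single p 1) = fockGen p := by
        intro p; simp [fockLin]
      rw [e p a, e q b]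
      simp only [map_smul, LinearMap.smul_apply, e', smul_mul_assoc, mul_smul_comm]
      rw [smul_assoc, smul_assoc, heisForm_single, ← fockGen_comm, smul_sub, smul_sub]
      simp only [smul_smul, mul_comm]

/-- The action of the Heisenberg Lie algebra on polynomials, with `c` acting as `1`. -/
def fockHeis (d : ℕ) : Heis d →ₗ⁅ℂ⁆ Module.End ℂ (MvPolynomial (Fin d × ℤ) ℂ) where
  toFun x := fockLin d x.1 + x.2 • 1
  map_add' x y := by
    change fockLin d (x.1 + y.1) + (x.2 + y.2) • 1 = _
    rw [map_add, add_smul]; abel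
  map_smul' t x := by
    change fockLin d (t • x.1) + (t • x.2) • 1 = t • (_ + _)
    rw [map_smul, smul_add, smul_assoc]
  map_lie' {x y} := by
    change fockLin d 0 + heisForm d x.1 y.1 • 1 = _
    rw [map_zero, zero_add, ← fockLin_comm, LieRing.of_associative_ring_bracket]
    simp only [add_mul, mul_add, smul_mul_assoc, mul_smul_comm, one_mul, mul_one]
    simp only [smul_add, smul_smul, mul_comm y.2 x.2]
    abel

/-- The induced action of `U(ĥ)/⟨c - 1⟩` on polynomials. -/
def fock (d : ℕ) : WeylAlg d →ₐ[ℂ] Module.End ℂ (MvPolynomial (Fin d × ℤ) ℂ) :=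
  RingQuot.liftAlgHom ℂ ⟨UniversalEnvelopingAlgebra.lift ℂ (fockHeis d), by
    rintro _ _ ⟨⟩
    rw [UniversalEnvelopingAlgebra.lift_ι_apply, map_one]
    change fockLin d 0 + (1 : ℂ) • 1 = 1
    simp⟩

theorem fock_gen {d : ℕ} (i : Fin d) (m : ℤ) : fock d (gen i m) = fockGen (i, m) := by
  rw [fock, gen, RingQuot.liftAlgHom_mkAlgHom_apply, UniversalEnvelopingAlgebra.lift_ι_apply]
  change fockLin d (Finsupp.single (i, m) 1) + (0 : ℂ) • 1 = _
  simp [fockLin]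

/-- The functional `x ↦ constant term of x · 1`. -/
def vev (d : ℕ) : WeylAlg d →ₗ[ℂ] ℂ where
  toFun x := MvPolynomial.constantCoeff (fock d x 1)
  map_add' x y := by simp
  map_smul' t x := by simp [MvPolynomial.smul_eq_C_mul]

theorem vev_one (d : ℕ) : vev d 1 = 1 := by
  simp [vev]

theorem vev_setB {d : ℕ} {x : WeylAlg d} (hx : x ∈ setB d) : vev d x = 0 := by
  have key : ∀ (p q : Fin d × ℤ), (p.2 ≤ q.2 ∨ p.1 ≠ q.1) →
      MvPolynomial.constantCoeff (fockGen p (fockGen q 1)) = 0 := by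
    rintro ⟨i, m⟩ ⟨j, n⟩ h
    by_cases hn : 0 < n
    · simp [fockGen, hn]
    · by_cases hm : 0 < m
      · have hne : (j, n) ≠ (i, -m) := fun h' => by
          simp only [Prod.mk.injEq] at h'
          rcases h with h | h
          · change m ≤ n at h
            omega
          · exact h h'.1.symm
        simp [fockGen, hm, hn, MvPolynomial.pderiv_X_of_ne hne]
      · simp [fockGen, hm, hn]
  rcases hx with ⟨i, m, n, h, rfl⟩ | ⟨i, j, m, n, h, rfl⟩
  · have := key (i, m) (i, n) (Or.inl h)
    simpa [vev, vv, fock_gen] using this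
  · have := key (i, m) (j, n) (Or.inr h.ne)
    simpa [vev, vv, fock_gen] using this

theorem isCompl_setB_one (d : ℕ) :
    IsCompl ((Submodule.span ℂ (setB d)).submoduleOf (calL d))
      ((Submodule.span ℂ {(1 : WeylAlg d)}).submoduleOf (calL d)) := by
  constructor
  · rw [Submodule.disjoint_def]
    rintro ⟨x, hx⟩ h1 h2
    have h1' : x ∈ Submodule.span ℂ (setB d) := h1
    have h2' : x ∈ Submodule.span ℂ {(1 : WeylAlg d)} := h2
    obtain ⟨a, rfl⟩ := Submodule.mem_span_singleton.mp h2'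
    have h3 : vev d (a • 1) = 0 := by
      have : Submodule.span ℂ (setB d) ≤ LinearMap.ker (vev d) :=
        Submodule.span_le.mpr fun y hy => vev_setB hy
      exact this h1'
    rw [map_smul, vev_one, smul_eq_mul, mul_one] at h3
    ext
    simp [h3]
  · rw [codisjoint_iff, eq_top_iff]
    rintro ⟨x, hx⟩ -
    obtain ⟨y, hy, z, hz, rfl⟩ := Submodule.mem_sup.mp hx
    exact Submodule.mem_sup.mpr ⟨⟨y, Submodule.mem_sup_left hy⟩, hy,
      ⟨z, Submodule.mem_sup_right hz⟩, hz, rfl⟩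

/-- The projection `π₁` of `L = span B ⊕ ℂ` onto `span B`. -/
def proj₁ (d : ℕ) : calL d →ₗ[ℂ] calL d :=
  Submodule.projection _ _ (isCompl_setB_one d)

/-- The projection `π₂` of `L = span B ⊕ ℂ` onto `ℂ`. -/
def proj₂ (d : ℕ) : calL d →ₗ[ℂ] calL d :=
  Submodule.projection _ _ (isCompl_setB_one d).symm

/-! ### The Lie algebra `L_r` -/

/-- The commutator `xy - yx` as an element of `L`. -/
def commL {d : ℕ} (x y : calL d) : calL d :=
  ⟨(x : WeylAlg d) * y - y * x, comm_mem_calL x.2 y.2⟩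

/-- The bracket `[x, y]_r = π₁([x, y]) + r π₂([x, y])` on `L`. -/
def brk {d : ℕ} (r : ℂ) (x y : calL d) : calL d :=
  proj₁ d (commL x y) + r • proj₂ d (commL x y)

theorem comm_add_left {d : ℕ} (x y z : calL d) : commL (x + y) z = commL x z + commL y z := by
  apply Subtype.ext; simp only [commL, Submodule.coe_add]; noncomm_ring

theorem comm_add_right {d : ℕ} (x y z : calL d) : commL x (y + z) = commL x y + commL x z := by
  apply Subtype.ext; simp only [commL, Submodule.coe_add]; noncomm_ring

theorem comm_smul_right {d : ℕ} (t : ℂ) (x y : calL d) : commL x (t • y) = t • commL x y := by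
  apply Subtype.ext
  simp only [commL, Submodule.coe_smul, smul_mul_assoc, mul_smul_comm, smul_sub]

theorem comm_self {d : ℕ} (x : calL d) : commL x x = 0 := by
  apply Subtype.ext; simp [commL]

theorem comm_swap {d : ℕ} (x y : calL d) : commL x y = - commL y x := by
  apply Subtype.ext; simp [commL]

theorem comm_jacobi {d : ℕ} (x y z : calL d) :
    commL x (commL y z) = commL (commL x y) z + commL y (commL x z) := by
  apply Subtype.ext; simp only [commL, Submodule.coe_add]; noncomm_ring

/-- Changing the constant term of an argument does not change a commutator. -/
theorem comm_brk_right {d : ℕ} (r : ℂ) (x y z : calL d) : commL x (brk r y z) = commL x (commL y z) := by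
  have h1 : brk r y z = commL y z + (r - 1) • proj₂ d (commL y z) := by
    have h := Submodule.projection_add_projection_eq_self (isCompl_setB_one d) (commL y z)
    have h' : proj₁ d (commL y z) + proj₂ d (commL y z) = commL y z := h
    rw [brk]
    nth_rewrite 3 [← h']
    rw [sub_smul, one_smul]
    abel
  have h2 : commL x (proj₂ d (commL y z)) = 0 := by
    have h := Submodule.projection_apply_mem (isCompl_setB_one d).symm (commL y z)
    obtain ⟨a, ha⟩ := Submodule.mem_span_singleton.mp
      (show ((proj₂ d (commL y z) : calL d) : WeylAlg d) ∈ Submodule.span ℂ {(1 : WeylAlg d)} from h)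
    apply Subtype.ext
    change (x : WeylAlg d) * (proj₂ d (commL y z) : calL d)
      - (proj₂ d (commL y z) : calL d) * (x : WeylAlg d) = 0
    rw [← ha, mul_smul_comm, smul_mul_assoc, mul_one, one_mul, sub_self]
  rw [h1, comm_add_right, comm_smul_right, h2, smul_zero, add_zero]

theorem comm_brk_left {d : ℕ} (r : ℂ) (x y z : calL d) : commL (brk r x y) z = commL (commL x y) z := by
  rw [comm_swap, comm_brk_right, ← comm_swap]

theorem brk_add_left {d : ℕ} (r : ℂ) (x y z : calL d) :
    brk r (x + y) z = brk r x z + brk r y z := by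
  simp only [brk, comm_add_left, map_add, smul_add]
  abel

theorem brk_add_right {d : ℕ} (r : ℂ) (x y z : calL d) :
    brk r x (y + z) = brk r x y + brk r x z := by
  simp only [brk, comm_add_right, map_add, smul_add]
  abel

theorem brk_smul_right {d : ℕ} (r t : ℂ) (x y : calL d) : brk r x (t • y) = t • brk r x y := by
  simp only [brk, comm_smul_right, map_smul, smul_add, smul_comm r t]

theorem brk_self {d : ℕ} (r : ℂ) (x : calL d) : brk r x x = 0 := by
  simp [brk, comm_self]

theorem brk_jacobi {d : ℕ} (r : ℂ) (x y z : calL d) :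
    brk r x (brk r y z) = brk r (brk r x y) z + brk r y (brk r x z) := by
  rw [brk, brk.eq_1 r (brk r x y) z, brk.eq_1 r y (brk r x z), comm_brk_right, comm_brk_right,
    comm_brk_left, comm_jacobi]
  simp only [map_add, smul_add]
  abel

/-- The Lie algebra `L_r`: the vector space `L` with the bracket `[·, ·]_r`. -/
def LieL (d : ℕ) (_r : ℂ) : Type := calL d

instance (d : ℕ) (r : ℂ) : AddCommGroup (LieL d r) := inferInstanceAs (AddCommGroup (calL d))

instance (d : ℕ) (r : ℂ) : Module ℂ (LieL d r) := inferInstanceAs (Module ℂ (calL d))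

instance (d : ℕ) (r : ℂ) : LieRing (LieL d r) where
  bracket x y := brk (d := d) r x y
  add_lie x y z := brk_add_left (d := d) r x y z
  lie_add x y z := brk_add_right (d := d) r x y z
  lie_self x := brk_self (d := d) r x
  leibniz_lie x y z := brk_jacobi (d := d) r x y z

instance (d : ℕ) (r : ℂ) : LieAlgebra ℂ (LieL d r) where
  lie_smul t x y := brk_smul_right (d := d) r t x y

/-- `v^{ij}(m, n)` as an element of `L_r`. -/
def lv {d : ℕ} (r : ℂ) (i j : Fin d) (m n : ℤ) : LieL d r :=
  (⟨vv i j m n, vv_mem_calL i j m n⟩ : calL d)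

/-- The scalar `s ∈ ℂ ⊆ L` as an element of `L_r`. -/
def lscalar (d : ℕ) (r : ℂ) (s : ℂ) : LieL d r :=
  (⟨s • 1, Submodule.smul_mem _ s (one_mem_calL d)⟩ : calL d)

/-- The set `B₊` of those `v^{ij}(m, n) ∈ B` with `m ≥ 0` or `n ≥ 0`. -/
def setBplus (d : ℕ) (r : ℂ) : Set (LieL d r) :=
  {x | ∃ (i : Fin d) (m n : ℤ), m ≤ n ∧ (0 ≤ m ∨ 0 ≤ n) ∧ x = lv r i i m n} ∪
  {x | ∃ (i j : Fin d) (m n : ℤ), i < j ∧ (0 ≤ m ∨ 0 ≤ n) ∧ x = lv r i j m n}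

/-! ### The induced module `M_r` -/

/-- The universal enveloping algebra of `L_r`. -/
abbrev UL (d : ℕ) (r : ℂ) : Type := UniversalEnvelopingAlgebra ℂ (LieL d r)

/-- The canonical map `L_r → U(L_r)`. -/
def iota {d : ℕ} {r : ℂ} (x : LieL d r) : UL d r := UniversalEnvelopingAlgebra.ι ℂ x

/-- The left ideal of `U(L_r)` generated by `B₊` and by the differences between the element
`s ∈ ℂ ⊆ L_r` and the number `s`, for `s ∈ ℂ`. -/
def vacIdeal (d : ℕ) (r : ℂ) : Submodule (UL d r) (UL d r) :=
  Submodule.span (UL d r)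
    (iota '' setBplus d r ∪
      {u | ∃ s : ℂ, u = iota (lscalar d r s) - algebraMap ℂ (UL d r) s})

/-- The module `M_r = U(L_r) ⊗_{U(L_r⁺)} ℂ1` induced from the one-dimensional module `ℂ1` of
`L_r⁺ = span B₊ ⊕ ℂ` on which `B₊` acts by zero and `s ∈ ℂ ⊆ L_r⁺` acts as the number `s`.
As `ℂ1` is cyclic, `M_r` is the quotient of `U(L_r)` by the left ideal generated by the
annihilator of `1` in `U(L_r⁺)`. -/
def ModM (d : ℕ) (r : ℂ) : Type := UL d r ⧸ vacIdeal d r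

instance (d : ℕ) (r : ℂ) : AddCommGroup (ModM d r) :=
  inferInstanceAs (AddCommGroup (UL d r ⧸ vacIdeal d r))

instance (d : ℕ) (r : ℂ) : Module (UL d r) (ModM d r) :=
  inferInstanceAs (Module (UL d r) (UL d r ⧸ vacIdeal d r))

instance (d : ℕ) (r : ℂ) : Module ℂ (ModM d r) :=
  inferInstanceAs (Module ℂ (UL d r ⧸ vacIdeal d r))

instance (d : ℕ) (r : ℂ) : IsScalarTower ℂ (UL d r) (ModM d r) :=
  inferInstanceAs (IsScalarTower ℂ (UL d r) (UL d r ⧸ vacIdeal d r))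

instance (d : ℕ) (r : ℂ) : SMulCommClass ℂ (UL d r) (ModM d r) where
  smul_comm t u m := by
    rw [← algebraMap_smul (UL d r) t (u • m), ← algebraMap_smul (UL d r) t m, smul_smul,
      smul_smul, Algebra.commutes]

/-- The action of `L_r` on `M_r`. -/
instance (d : ℕ) (r : ℂ) : LieRingModule (LieL d r) (ModM d r) where
  bracket x m := iota x • m
  add_lie x y m := by
    change iota (x + y) • m = iota x • m + iota y • m
    rw [← add_smul]; simp only [iota, map_add]
  lie_add x m n := smul_add (iota x) m n
  leibniz_lie x y m := by
    change iota x • iota y • m = iota ⁅x, y⁆ • m + iota y • iota x • m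
    simp only [iota, LieHom.map_lie, LieRing.of_associative_ring_bracket, sub_smul, mul_smul]
    abel

instance (d : ℕ) (r : ℂ) : LieModule ℂ (LieL d r) (ModM d r) where
  smul_lie t x m := by
    change iota (t • x) • m = t • iota x • m
    rw [← smul_assoc]; simp only [iota, map_smul]
  lie_smul t x m := by
    change iota x • t • m = t • iota x • m
    rw [smul_comm]

/-- The vector `1 ∈ M_r`. -/
def vac (d : ℕ) (r : ℂ) : ModM d r := Submodule.Quotient.mk (p := vacIdeal d r) 1

/-! ### `L_r^{(1)}` and `M_r^{(1)}`

The index `1 ∈ {1, …, d}` is `0 : Fin d`. -/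

/-- `L_r^{(1)}`: the Lie subalgebra of `L_r` generated by the `v^{11}(m, n)` with `m ≤ n`. -/
def LieL1 (d : ℕ) [NeZero d] (r : ℂ) : LieSubalgebra ℂ (LieL d r) :=
  LieSubalgebra.lieSpan ℂ (LieL d r) {x | ∃ m n : ℤ, m ≤ n ∧ x = lv r (0 : Fin d) 0 m n}

/-- `M_r^{(1)} = U(L_r^{(1)}) 1`: the `L_r^{(1)}`-submodule of `M_r` generated by `1`. -/
def ModM1 (d : ℕ) [NeZero d] (r : ℂ) : LieSubmodule ℂ (LieL1 d r) (ModM d r) :=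
  LieSubmodule.lieSpan ℂ (LieL1 d r) {vac d r}

/-! ### Weights and singular vectors -/

/-- `h_{k,l} = -(1/l) v^{kk}(l, -l)`, for `l < 0`. -/
def hElt {d : ℕ} (r : ℂ) (k : Fin d) (l : {l : ℤ // l < 0}) : LieL d r :=
  (-(1 / ((l : ℤ) : ℂ))) • lv r k k (l : ℤ) (-(l : ℤ))

/-- The cone `Q₊ = ∑ ℤ_{≥ 0} Λ_{k,l}` of weights, where the `Λ_{k,l}` are dual to the basis
`h_{k,l}` of the span `H` of all `v^{kk}(l, -l)`: the coefficient of `Λ_{k,l}` in `lam`, that is,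
the value of `lam` at `h_{k,l}`, is `lam (k, l)`. -/
abbrev QPlus (d : ℕ) : Type := Fin d × {l : ℤ // l < 0} →₀ ℕ

/-- `u ∈ M_r` lies in the weight space of weight `lam`. As the `h_{k,l}` span `H`, it is enough
to require `h u = lam(h) u` for them. -/
def InWeightSpace {d : ℕ} {r : ℂ} (lam : QPlus d) (u : ModM d r) : Prop :=
  ∀ (k : Fin d) (l : {l : ℤ // l < 0}), ⁅hElt r k l, u⁆ = (lam (k, l) : ℂ) • u

/-- A singular vector of `M_r^{(1)}`: a nonzero vector, homogeneous of some weight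
`lam ∈ Q₊^{(1)} ∖ {0}` with `Q₊^{(1)} = ∑_l ℤ_{≥ 0} Λ_{1,l}`, that is killed by all `v^{11}(m, n)`
with `m + n > 0`. -/
def IsSingular {d : ℕ} [NeZero d] {r : ℂ} (u : ModM1 d r) : Prop :=
  u ≠ 0 ∧
  (∃ lam : QPlus d, (∀ k l, k ≠ 0 → lam (k, l) = 0) ∧ lam ≠ 0 ∧
    InWeightSpace lam (u : ModM d r)) ∧
  ∀ m n : ℤ, 0 < m + n → ⁅lv r (0 : Fin d) 0 m n, (u : ModM d r)⁆ = 0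

/-! ### The vectors `(det V_p)^ν 1` -/

/-- The determinant of the `p × p` matrix `V_p = (v^{11}(-s, -t))_{1 ≤ s, t ≤ p}`, in `U(L_r)`.
Its entries commute with each other; the factors are taken in the order of the rows. -/
def detV (d : ℕ) [NeZero d] (r : ℂ) (p : ℕ) : UL d r :=
  ∑ σ : Equiv.Perm (Fin p), (Equiv.Perm.sign σ : ℤ) •
    (List.ofFn fun q : Fin p =>
      iota (lv r (0 : Fin d) 0 (-((q : ℤ) + 1)) (-((σ q : ℤ) + 1)))).prod

theorem lv_mem_LieL1 {d : ℕ} [NeZero d] (r : ℂ) {m n : ℤ} (h : m + n ≠ 0) :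
    lv r (0 : Fin d) 0 m n ∈ LieL1 d r := by
  rcases le_total m n with hmn | hmn
  · exact LieSubalgebra.subset_lieSpan ⟨m, n, hmn, rfl⟩
  · refine LieSubalgebra.subset_lieSpan ⟨n, m, hmn, Subtype.ext ?_⟩
    change gen (0 : Fin d) m * gen (0 : Fin d) n = gen (0 : Fin d) n * gen (0 : Fin d) m
    rw [gen_comm, if_neg (fun h' => h h'.1), zero_smul, add_zero]

theorem iota_smul_mem {d : ℕ} [NeZero d] {r : ℂ} {x : LieL d r} (hx : x ∈ LieL1 d r)
    {u : ModM d r} (hu : u ∈ ModM1 d r) : iota x • u ∈ ModM1 d r :=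
  LieSubmodule.lie_mem (ModM1 d r) (x := (⟨x, hx⟩ : LieL1 d r)) hu

theorem detV_smul_mem {d : ℕ} [NeZero d] {r : ℂ} (p : ℕ) {u : ModM d r} (hu : u ∈ ModM1 d r) :
    detV d r p • u ∈ ModM1 d r := by
  have key : ∀ L : List (UL d r),
      (∀ y ∈ L, ∃ x ∈ LieL1 d r, y = iota x) → L.prod • u ∈ ModM1 d r := by
    intro L
    induction L with
    | nil => intro _; simpa using hu
    | cons a L ih =>
      intro h
      obtain ⟨x, hx, rfl⟩ := h a (by simp)
      rw [List.prod_cons, mul_smul]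
      exact iota_smul_mem hx (ih fun y hy => h y (by simp [hy]))
  rw [detV, Finset.sum_smul]
  refine sum_mem fun σ _ => ?_
  rw [smul_assoc]
  refine zsmul_mem (key _ ?_) _
  intro y hy
  obtain ⟨q, rfl⟩ := (List.mem_ofFn' _ _).mp hy
  exact ⟨_, lv_mem_LieL1 r (by omega), rfl⟩

theorem detV_pow_smul_vac_mem (d : ℕ) [NeZero d] (r : ℂ) (p ν : ℕ) :
    detV d r p ^ ν • vac d r ∈ ModM1 d r := by
  induction ν with
  | zero =>
    rw [pow_zero, one_smul]
    exact LieSubmodule.subset_lieSpan (Set.mem_singleton (vac d r))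
  | succ ν ih =>
    rw [pow_succ', mul_smul]
    exact detV_smul_mem p ih

/-- The vector `(det V_p)^ν 1` of `M_r^{(1)}`. -/
def detVec (d : ℕ) [NeZero d] (r : ℂ) (p ν : ℕ) : ModM1 d r :=
  ⟨detV d r p ^ ν • vac d r, detV_pow_smul_vac_mem d r p ν⟩

/-- `W_r^{(1)}`: the `L_r^{(1)}`-submodule of `M_r^{(1)}` generated by the vectors `(det V_p)^ν 1`
with `p, ν ≥ 1` and `r = 1 - 2ν + p`. -/
def SubW1 (d : ℕ) [NeZero d] (r : ℤ) : LieSubmodule ℂ (LieL1 d (r : ℂ)) (ModM1 d (r : ℂ)) :=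
  LieSubmodule.lieSpan ℂ (LieL1 d (r : ℂ))
    {w | ∃ p ν : ℕ, 1 ≤ p ∧ 1 ≤ ν ∧ r = 1 - 2 * (ν : ℤ) + (p : ℤ) ∧ w = detVec d (r : ℂ) p ν}

end NiiboriSagaki

end

noncomputable section

namespace NiiboriSagaki

attribute [local instance 100] LieRing.ofAssociativeRing

/-! The module M_r^{(1)} is a polynomial ring. Let x_{st} = x_{ts} (s, t ≥ 0) stand for v(-s-1,
-t-1). Up to nonzero scalars, pairs of creation modes multiply by x_{st}. Mixed pairs act by the
polarizations D_{st} = ∑_e x_{se} ∂_{te}, which span a copy of gl_∞. Pairs of annihilation modes act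
by E_{ab} = ∑ x_{ce} ∂_{ac} ∂_{be} + r ∂_{ab}, where ∂_{aa} is twice the partial derivative, and
pairs with a zero mode act by 0. The level r enters only through E_{ab}. An explicit representation
(`model`) shows that no polynomial becomes 0 in M_r (`polyToM_injective`), so submodules of
M_r^{(1)} correspond to subspaces stable under these operators (`IsStable`).

A singular vector is a highest weight vector for gl_∞ that every E_{ab} kills. Highest weight
vectors of a given weight are multiples of a product of leading principal minors Δ_p
(`IsHighest.exists_minors`): such a vector is determined by its restriction to diagonal matrices. On
a product with largest minor Δ_p occurring ν times, E_{p-1,p-1} replaces one Δ_p by Δ_{p-1} and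
multiplies by 2ν(r - p - 1 + 2ν) (`second_top_minors`). Hence r = 1 - 2ν + p, and a second, smaller
minor is impossible because its own coefficient would be positive
(`eq_pow_minor_of_second_eq_zero`). Conversely Δ_p^ν is killed by every E_{ab} when r = 1 - 2ν + p
(`second_pow_minor`).

W_r^{(1)} is proper since it lies in the ideal generated by the polynomials without constant term
killed by all E_{ab}; that ideal is stable and misses 1 (`isStable_secondIdeal`).

For maximality, let N be proper and V = N + W_r^{(1)}, which still misses 1. By induction on the
energy of weights, a weight vector in V is a highest weight vector plus an element of W_r^{(1)}; the
orthogonal projection for the Fischer inner product replaces complete reducibility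
(`exists_isHighest_add`). So the question is about a product of minors in V. If no critical pair (p,
ν) fits into it, meaning at least ν factors of size at least p, the operators E_{aa} bring it down
to 1 (`one_mem_of_minors_mem`), which is excluded. If one fits, the product already lies in
W_r^{(1)} (`IsStable.minors_mem`). Irreducibility of the quotient follows. -/

/-! ### Operators on polynomials in the entries of a symmetric matrix -/

section Operators

variable {K : Type*}

/-- Polynomials in the entries `x a b = x b a` of a generic symmetric matrix. -/
abbrev SymPoly (K : Type*) : Type _ := MvPolynomial (Sym2 K) ℂ

/-- The entry of the generic symmetric matrix. -/
def entry (a b : K) : SymPoly K := MvPolynomial.X s(a, b)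

theorem entry_comm (a b : K) : entry a b = entry b a := by
  rw [entry, entry, Sym2.eq_swap]

theorem symPoly_derivation_ext {M : Type*} [AddCommMonoid M] [Module ℂ M] [Module (SymPoly K) M]
    [IsScalarTower ℂ (SymPoly K) M]
    {D D' : Derivation ℂ (SymPoly K) M} (h : ∀ a b, D (entry a b) = D' (entry a b)) : D = D' :=
  MvPolynomial.derivation_ext fun e => by
    induction e with
    | _ a b => exact h a b

/-- Multiplication by an entry is the action of a creation pair, so this induction builds vectors
from the vacuum. -/
theorem symPoly_induction {p : SymPoly K → Prop} (f : SymPoly K) (h1 : p 1)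
    (hs : ∀ (t : ℂ) f, p f → p (t • f)) (ha : ∀ f g, p f → p g → p (f + g))
    (hx : ∀ a b f, p f → p (entry a b * f)) : p f := by
  induction f using MvPolynomial.induction_on with
  | C t =>
    have := hs t 1 h1
    rwa [MvPolynomial.smul_eq_C_mul, mul_one] at this
  | add f g hf hg => exact ha f g hf hg
  | mul_X f e hf =>
    induction e with
    | _ a b => rw [mul_comm]; exact hx a b f hf

variable [DecidableEq K]

/-- The derivative with respect to row `a`. -/
def grad (a : K) : Derivation ℂ (SymPoly K) (K →₀ SymPoly K) :=
  MvPolynomial.mkDerivation ℂ (Sym2.lift ⟨fun d e =>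
    (if a = d then Finsupp.single e 1 else 0) + (if a = e then Finsupp.single d 1 else 0),
    fun _ _ => add_comm _ _⟩)

theorem grad_entry (a d e : K) : grad a (entry d e) =
    (if a = d then Finsupp.single e 1 else 0) + (if a = e then Finsupp.single d 1 else 0) := by
  simp [grad, entry, MvPolynomial.mkDerivation_X]

theorem grad_entry_apply (a b d e : K) : grad a (entry d e) b =
    (if a = d ∧ b = e then 1 else 0) + (if a = e ∧ b = d then 1 else 0) := by
  rw [grad_entry, Finsupp.add_apply]
  congr 1
  · by_cases h1 : a = d <;> by_cases h2 : b = e <;> simp [h1, h2]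
  · by_cases h1 : a = e <;> by_cases h2 : b = d <;> simp [h1, h2]

/-- The polarization operator replacing the index `a` by `c`. -/
def polar (c a : K) : Derivation ℂ (SymPoly K) (SymPoly K) :=
  MvPolynomial.mkDerivation ℂ (Sym2.lift ⟨fun d e =>
    (if a = d then entry c e else 0) + (if a = e then entry c d else 0),
    fun _ _ => add_comm _ _⟩)

theorem polar_entry (c a d e : K) : polar c a (entry d e) =
    (if a = d then entry c e else 0) + (if a = e then entry c d else 0) := by
  simp [polar, entry, MvPolynomial.mkDerivation_X]

/-- The formal infinite sum ∑_e x_{ce} ∂_{ae} is finite on each polynomial; `grad` is finitely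
supported in order to carry it. -/
theorem polar_eq_linearCombination (c a : K) (f : SymPoly K) :
    polar c a f = Finsupp.linearCombination (SymPoly K) (entry c) (grad a f) := by
  have : polar c a = (Finsupp.linearCombination (SymPoly K) (entry c)).compDer (grad a) :=
    symPoly_derivation_ext fun d e => by
      rw [polar_entry]
      change _ = Finsupp.linearCombination (SymPoly K) (entry c) (grad a (entry d e))
      rw [grad_entry, map_add]
      split_ifs <;> simp
  rw [this]
  rfl

theorem polar_eq_sum (c a : K) (f : SymPoly K) {S : Finset K} (hS : (grad a f).support ⊆ S) :
    polar c a f = ∑ e ∈ S, entry c e * grad a f e := by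
  rw [polar_eq_linearCombination, Finsupp.linearCombination_apply,
    Finsupp.sum_of_support_subset _ hS _ (by simp)]
  exact Finset.sum_congr rfl fun e _ => mul_comm _ _

theorem grad_comm (a b : K) (f : SymPoly K) : grad a f b = grad b f a := by
  have : (Finsupp.lapply (R := SymPoly K) b).compDer (grad a)
      = (Finsupp.lapply (R := SymPoly K) a).compDer (grad b) :=
    symPoly_derivation_ext fun d e => by
      change grad a (entry d e) b = grad b (entry d e) a
      rw [grad_entry_apply, grad_entry_apply, add_comm]
      simp only [and_comm]
  exact DFunLike.congr_fun this f

/-- A single partial derivative as a derivation. -/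
def gradAt (a b : K) : Derivation ℂ (SymPoly K) (SymPoly K) :=
  (Finsupp.lapply (R := SymPoly K) b).compDer (grad a)

theorem gradAt_apply (a b : K) (f : SymPoly K) : gradAt a b f = grad a f b := rfl

theorem grad_polar (a b c d : K) (f : SymPoly K) :
    grad a (polar c d f) b = polar c d (grad a f b)
      + ((if a = c then grad b f d else 0) + (if b = c then grad a f d else 0)) := by
  -- A commutator of derivations is a derivation, so it suffices to compare both sides on entries.
  have : ⁅gradAt a b, polar c d⁆
      = (if a = c then gradAt b d else 0) + (if b = c then gradAt a d else 0) :=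
    symPoly_derivation_ext fun e g => by
      rw [Derivation.commutator_apply, polar_entry, gradAt_apply, gradAt_apply, grad_entry_apply]
      have h0 : polar c d ((if a = e ∧ b = g then (1 : SymPoly K) else 0)
          + if a = g ∧ b = e then 1 else 0) = 0 := by
        rw [map_add]; split_ifs <;> simp
      rw [h0, sub_zero, map_add, Finsupp.add_apply]
      have h1 : ∀ (p : Prop) [Decidable p] (x : SymPoly K),
          grad a (if p then x else 0) b = if p then grad a x b else 0 := by
        intro p _ x; split_ifs <;> simp
      have h2 : ∀ (p : Prop) [Decidable p] (D : Derivation ℂ (SymPoly K) (SymPoly K))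
          (x : SymPoly K), (if p then D else 0) x = if p then D x else 0 := by
        intro p _ D x; split_ifs <;> simp
      rw [h1, h1, Derivation.add_apply, h2, h2, gradAt_apply, gradAt_apply]
      simp only [grad_entry_apply]
      by_cases h3 : d = e <;> by_cases h4 : d = g <;> by_cases h5 : a = c <;> by_cases h6 : b = c
        <;> simp [h3, h4, h5, h6] <;> grind
  have h := DFunLike.congr_fun this f
  rw [Derivation.commutator_apply, sub_eq_iff_eq_add', Derivation.add_apply] at h
  rw [← gradAt_apply, h, gradAt_apply]
  congr 2 <;> split_ifs <;> rfl

/-- The second order operator `∑ (c, e), x c e ∂_{a c} ∂_{b e} + r ∂_{a b}`. -/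
def second (r : ℂ) (a b : K) : SymPoly K →ₗ[ℂ] SymPoly K :=
  (Finsupp.lsum ℂ (fun c => (polar c b).toLinearMap)) ∘ₗ (grad a).toLinearMap
    + r • (gradAt a b).toLinearMap

theorem second_eq_sum (r : ℂ) (a b : K) (f : SymPoly K) {S : Finset K}
    (hS : (grad a f).support ⊆ S) :
    second r a b f = ∑ c ∈ S, polar c b (grad a f c) + r • grad a f b := by
  change Finsupp.lsum ℂ (fun c => (polar c b).toLinearMap) (grad a f) + r • grad a f b = _
  rw [Finsupp.lsum_apply, Finsupp.sum_of_support_subset _ hS _ (by simp)]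
  rfl

theorem second_one (r : ℂ) (a b : K) : second r a b (1 : SymPoly K) = 0 := by
  rw [second_eq_sum (S := ∅) r a b 1 (by simp)]
  simp

theorem second_of_grad_eq_zero (r : ℂ) (a b : K) {f : SymPoly K} (h : grad a f = 0) :
    second r a b f = 0 := by
  rw [second_eq_sum (S := ∅) r a b f (by simp [h])]
  simp [h]

/-- The defect from the Leibniz rule is the bilinear form of the second order symbol; the term r
∂_{ab} contributes nothing to it. -/
theorem second_mul (r : ℂ) (a b : K) (f g : SymPoly K) {S : Finset K}
    (hf : (grad a f).support ⊆ S) (hg : (grad a g).support ⊆ S) :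
    second r a b (f * g) = f * second r a b g + g * second r a b f
      + ∑ c ∈ S, (polar c b f * grad a g c + polar c b g * grad a f c) := by
  have hfg : (grad a (f * g)).support ⊆ S := by
    intro c hc
    by_contra hcS
    rw [Finsupp.mem_support_iff, Derivation.leibniz] at hc
    apply hc
    have h1 : grad a f c = 0 := Finsupp.notMem_support_iff.mp fun h => hcS (hf h)
    have h2 : grad a g c = 0 := Finsupp.notMem_support_iff.mp fun h => hcS (hg h)
    simp [h1, h2]
  rw [second_eq_sum r a b _ hfg, second_eq_sum r a b _ hf, second_eq_sum r a b _ hg,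
    mul_add, mul_add, Finset.mul_sum, Finset.mul_sum]
  have : ∀ c, polar c b (grad a (f * g) c) = f * polar c b (grad a g c) + g * polar c b (grad a f c)
      + (polar c b f * grad a g c + polar c b g * grad a f c) := by
    intro c
    rw [Derivation.leibniz]
    simp only [Finsupp.add_apply, Finsupp.smul_apply, smul_eq_mul, map_add, Derivation.leibniz]
    ring
  simp only [this, Finset.sum_add_distrib]
  rw [Derivation.leibniz]
  simp only [Finsupp.add_apply, Finsupp.smul_apply, smul_eq_mul, smul_add, mul_smul_comm]
  ring

/-- Both sides are the double sum of x_{ce} (∂_{be} f)(∂_{ac} g), read in two orders with x_{ce} =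
x_{ec}. -/
theorem sum_polar_mul_grad (a b : K) (f g : SymPoly K) {S : Finset K}
    (hf : (grad b f).support ⊆ S) (hg : (grad a g).support ⊆ S) :
    ∑ c ∈ S, polar c b f * grad a g c = ∑ c ∈ S, polar c a g * grad b f c := by
  simp only [polar_eq_sum _ b f hf, polar_eq_sum _ a g hg, Finset.sum_mul]
  rw [Finset.sum_comm]
  refine Finset.sum_congr rfl fun c _ => Finset.sum_congr rfl fun e _ => ?_
  rw [entry_comm e c]
  ring

theorem second_entry (r : ℂ) (a b c d : K) : second r a b (entry c d) =
    r • ((if a = c ∧ b = d then 1 else 0) + (if a = d ∧ b = c then 1 else 0)) := by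
  rw [second_eq_sum r a b _ subset_rfl, grad_entry_apply]
  convert zero_add _
  refine Finset.sum_eq_zero fun e _ => ?_
  rw [grad_entry_apply, map_add]
  split_ifs <;> simp

/-- This mirrors the bracket of an annihilation pair with a creation pair: one contraction leaves a
polarization, two leave a scalar multiple of r. -/
theorem second_entry_mul (r : ℂ) (a b c d : K) (f : SymPoly K) :
    second r a b (entry c d * f) = entry c d * second r a b f
      + (((if b = c then polar d a f else 0) + (if b = d then polar c a f else 0))
      + ((if a = c then polar d b f else 0) + (if a = d then polar c b f else 0)))
      + r • (((if a = c ∧ b = d then 1 else 0) + (if a = d ∧ b = c then 1 else 0)) * f) := by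
  have key : ∀ (a b : K), (∑ e ∈ (grad a f).support ∪ {c, d}, polar e b (entry c d) * grad a f e)
      = (if b = c then polar d a f else 0) + (if b = d then polar c a f else 0) := by
    intro a b
    rw [polar_eq_sum d a f Finset.subset_union_left, polar_eq_sum c a f Finset.subset_union_left]
    simp only [polar_entry, add_mul, ite_mul, zero_mul, Finset.sum_add_distrib]
    congr 1
    · by_cases h : b = c
      · simp only [h, if_true]
        exact Finset.sum_congr rfl fun e _ => by rw [entry_comm]
      · simp [h]
    · by_cases h : b = d
      · simp only [h, if_true]
        exact Finset.sum_congr rfl fun e _ => by rw [entry_comm]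
      · simp [h]
  have hx : ∀ a : K, (grad a (entry c d)).support ⊆ {c, d} := by
    intro a e he
    rw [Finsupp.mem_support_iff, grad_entry_apply] at he
    by_contra h
    simp only [Finset.mem_insert, Finset.mem_singleton, not_or] at h
    simp [h.1, h.2] at he
  rw [second_mul r a b (entry c d) f
    (S := (grad a f).support ∪ {c, d} ∪ ((grad b f).support ∪ {c, d}))
    ((hx a).trans (by grind)) (by grind), Finset.sum_add_distrib]
  have e1 : (∑ e ∈ (grad a f).support ∪ {c, d} ∪ ((grad b f).support ∪ {c, d}),
      polar e b (entry c d) * grad a f e)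
      = (if b = c then polar d a f else 0) + (if b = d then polar c a f else 0) := by
    rw [← key a b]
    symm
    apply Finset.sum_subset Finset.subset_union_left
    intro e _ he
    rw [Finsupp.notMem_support_iff.mp (fun h => he (Finset.mem_union_left _ h)), mul_zero]
  have e2 : (∑ e ∈ (grad a f).support ∪ {c, d} ∪ ((grad b f).support ∪ {c, d}),
      polar e b f * grad a (entry c d) e)
      = (if a = c then polar d b f else 0) + (if a = d then polar c b f else 0) := by
    rw [sum_polar_mul_grad a b f (entry c d) (by grind) ((hx a).trans (by grind)), ← key b a]
    symm
    apply Finset.sum_subset Finset.subset_union_right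
    intro e _ he
    rw [Finsupp.notMem_support_iff.mp (fun h => he (Finset.mem_union_left _ h)), mul_zero]
  rw [e1, e2, second_entry, mul_smul_comm, mul_comm f]
  abel

/-- The definition treats `a` and `b` differently, but the commutation rule with entries is
symmetric and determines the operator from its value at 1. -/
theorem second_comm (r : ℂ) (a b : K) (f : SymPoly K) : second r a b f = second r b a f := by
  induction f using symPoly_induction with
  | h1 => rw [second_one, second_one]
  | hs t f hf => rw [map_smul, map_smul, hf]
  | ha f g hf hg => rw [map_add, map_add, hf, hg]
  | hx c d f hf =>
    rw [second_entry_mul, second_entry_mul, hf]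
    simp only [and_comm (a := a = c), and_comm (a := a = d)]
    rw [add_comm (ite (b = d ∧ a = c) _ _)]
    abel

theorem polar_entry_mul (c a d e : K) (f : SymPoly K) : polar c a (entry d e * f) =
    entry d e * polar c a f
      + ((if a = d then entry c e * f else 0) + (if a = e then entry c d * f else 0)) := by
  rw [Derivation.leibniz, polar_entry, smul_eq_mul, smul_eq_mul, mul_comm f, add_mul]
  simp only [ite_mul, zero_mul]

end Operators

/-! ### Normally ordered quadratic elements -/

section NormalOrder

variable {d : ℕ}

/-- The commutator of two modes. -/
def modeForm (a b : Fin d × ℤ) : ℂ := if a.2 + b.2 = 0 ∧ a.1 = b.1 then (a.2 : ℂ) else 0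

/-- The contraction of two modes, that is, the vacuum expectation value of their product. -/
def contraction (a b : Fin d × ℤ) : ℂ :=
  if 0 < a.2 ∧ a.2 + b.2 = 0 ∧ a.1 = b.1 then (a.2 : ℂ) else 0

theorem modeForm_eq (a b : Fin d × ℤ) : modeForm a b = contraction a b - contraction b a := by
  obtain ⟨i, m⟩ := a
  obtain ⟨j, n⟩ := b
  simp only [modeForm, contraction]
  by_cases h : m + n = 0 ∧ i = j
  · obtain ⟨h1, rfl⟩ := h
    obtain rfl : n = -m := by omega
    rcases lt_trichotomy m 0 with h | rfl | h
    · have : ¬ 0 < m := by omega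
      simp [h, this]
    · simp
    · have : ¬ m < 0 := by omega
      simp [h, this]
  · have h2 : ¬ (0 < m ∧ m + n = 0 ∧ i = j) := fun h' => h h'.2
    have h3 : ¬ (0 < n ∧ n + m = 0 ∧ j = i) := fun h' => h ⟨by omega, h'.2.2.symm⟩
    rw [if_neg h, if_neg h2, if_neg h3, sub_zero]

theorem gen_mul_comm (a b : Fin d × ℤ) :
    gen a.1 a.2 * gen b.1 b.2 = gen b.1 b.2 * gen a.1 a.2 + modeForm a b • (1 : WeylAlg d) :=
  gen_comm a.1 b.1 a.2 b.2

theorem quadratic_comm (a b c e : Fin d × ℤ) :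
    vv a.1 b.1 a.2 b.2 * vv c.1 e.1 c.2 e.2 - vv c.1 e.1 c.2 e.2 * vv a.1 b.1 a.2 b.2
      = modeForm b c • vv a.1 e.1 a.2 e.2 + modeForm a c • vv b.1 e.1 b.2 e.2
        + modeForm b e • vv c.1 a.1 c.2 a.2 + modeForm a e • vv c.1 b.1 c.2 b.2 := by
  have e1 := sub_eq_iff_eq_add'.mpr (gen_mul_comm b c)
  have e2 := sub_eq_iff_eq_add'.mpr (gen_mul_comm a c)
  have e3 := sub_eq_iff_eq_add'.mpr (gen_mul_comm b e)
  have e4 := sub_eq_iff_eq_add'.mpr (gen_mul_comm a e)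
  simp only [vv]
  set A := gen a.1 a.2
  set B := gen b.1 b.2
  set C := gen c.1 c.2
  set E := gen e.1 e.2
  have h : A * B * (C * E) - C * E * (A * B)
      = A * (B * C - C * B) * E + (A * C - C * A) * (B * E)
        + C * A * (B * E - E * B) + C * (A * E - E * A) * B := by noncomm_ring
  rw [h, e1, e2, e3, e4]
  simp only [mul_smul_comm, smul_mul_assoc, mul_one, one_mul]

variable (r : ℂ)

/-- The central element `1 ∈ ℂ` of `L_r`. -/
def central (d : ℕ) (r : ℂ) : LieL d r := lscalar d r 1

/-- The normally ordered product of two modes. -/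
def nord (a b : Fin d × ℤ) : LieL d r :=
  lv r a.1 b.1 a.2 b.2 - contraction a b • central d r

variable {r}

/-- The inclusion of `L_r` into the associative algebra. -/
def toWeyl (d : ℕ) (r : ℂ) : LieL d r →ₗ[ℂ] WeylAlg d := (calL d).subtype

theorem toWeyl_injective : Function.Injective (toWeyl d r) := Subtype.val_injective

theorem toWeyl_central : toWeyl d r (central d r) = 1 := one_smul ℂ (1 : WeylAlg d)

theorem toWeyl_lv (i j : Fin d) (m n : ℤ) : toWeyl d r (lv r i j m n) = vv i j m n := rfl

theorem toWeyl_nord (a b : Fin d × ℤ) :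
    toWeyl d r (nord r a b) = vv a.1 b.1 a.2 b.2 - contraction a b • 1 := by
  rw [nord, map_sub, map_smul, toWeyl_central, toWeyl_lv]

theorem lv_eq_nord (i j : Fin d) (m n : ℤ) :
    lv r i j m n = nord r (i, m) (j, n) + contraction (i, m) (j, n) • central d r := by
  rw [nord, sub_add_cancel]

theorem nord_comm (a b : Fin d × ℤ) : nord r a b = nord r b a := by
  apply toWeyl_injective
  rw [toWeyl_nord, toWeyl_nord]
  simp only [vv]
  rw [gen_mul_comm a b, modeForm_eq, sub_smul]
  abel

/-- In the order prescribed by `setB` the contraction vanishes, and normal ordering forgets the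
order. Thus π₁ keeps the normally ordered part of a commutator and π₂ the scalar part. -/
theorem toWeyl_nord_mem (a b : Fin d × ℤ) :
    toWeyl d r (nord r a b) ∈ Submodule.span ℂ (setB d) := by
  have key : ∀ a b : Fin d × ℤ, (a.1 < b.1 ∨ (a.1 = b.1 ∧ a.2 ≤ b.2)) →
      toWeyl d r (nord r a b) ∈ Submodule.span ℂ (setB d) := by
    rintro ⟨i, m⟩ ⟨j, n⟩ h
    have h0 : contraction (i, m) (j, n) = 0 := by
      refine if_neg ?_
      rintro ⟨h1, h2, h3⟩
      simp only at h1 h2 h3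
      rcases h with h | h
      · exact h.ne h3
      · have := h.2
        simp only at this
        omega
    rw [toWeyl_nord, h0, zero_smul, sub_zero]
    apply Submodule.subset_span
    rcases h with h | ⟨rfl, h⟩
    · exact Or.inr ⟨i, j, m, n, h, rfl⟩
    · exact Or.inl ⟨i, m, n, h, rfl⟩
  rcases lt_trichotomy a.1 b.1 with h | h | h
  · exact key a b (Or.inl h)
  · rcases le_total a.2 b.2 with h' | h'
    · exact key a b (Or.inr ⟨h, h'⟩)
    · rw [nord_comm]; exact key b a (Or.inr ⟨h.symm, h'⟩)
  · rw [nord_comm]; exact key b a (Or.inl h)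

theorem bracket_eq {x y z : LieL d r} {s : ℂ}
    (hz : toWeyl d r z ∈ Submodule.span ℂ (setB d))
    (h : toWeyl d r x * toWeyl d r y - toWeyl d r y * toWeyl d r x = toWeyl d r z + s • 1) :
    ⁅x, y⁆ = z + (r * s) • central d r := by
  have h1 : commL (d := d) x y = (z + s • central d r : LieL d r) := by
    apply Subtype.ext
    refine h.trans ?_
    rw [← toWeyl_central (d := d) (r := r), ← map_smul, ← map_add]
    rfl
  have hz' : (show calL d from z) ∈ (Submodule.span ℂ (setB d)).submoduleOf (calL d) := hz
  have hs : (show calL d from s • central d r) ∈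
      (Submodule.span ℂ {(1 : WeylAlg d)}).submoduleOf (calL d) := by
    refine Submodule.mem_span_singleton.mpr ⟨s, ?_⟩
    change _ = toWeyl d r (s • central d r)
    rw [map_smul, toWeyl_central]
  change proj₁ d (commL x y) + r • proj₂ d (commL x y) = _
  rw [h1]
  have p1 : proj₁ d (z + s • central d r : LieL d r) = z := by
    refine (map_add (proj₁ d) (show calL d from z) (show calL d from s • central d r)).trans ?_
    rw [proj₁, Submodule.projection_apply_of_mem_left _ hz',
      Submodule.projection_apply_of_mem_right _ hs, add_zero]
  have p2 : proj₂ d (z + s • central d r : LieL d r) = s • central d r := by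
    refine (map_add (proj₂ d) (show calL d from z) (show calL d from s • central d r)).trans ?_
    rw [proj₂, Submodule.projection_apply_of_mem_right _ hz',
      Submodule.projection_apply_of_mem_left _ hs, zero_add]
  rw [p1, p2, mul_smul]
  rfl

/-- Wick's rule: single contractions give normally ordered pairs, double contractions give the
scalar, and only the latter acquires the factor `r`. -/
theorem nord_bracket (a b c e : Fin d × ℤ) : ⁅nord r a b, nord r c e⁆ =
    modeForm b c • nord r a e + modeForm a c • nord r b e
      + modeForm b e • nord r a c + modeForm a e • nord r b c
      + (r * (contraction a e * contraction b c + contraction a c * contraction b e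
        - contraction e b * contraction c a - contraction e a * contraction c b)) •
          central d r := by
  apply bracket_eq
  · simp only [map_add, map_smul]
    exact add_mem (add_mem (add_mem (Submodule.smul_mem _ _ (toWeyl_nord_mem _ _))
      (Submodule.smul_mem _ _ (toWeyl_nord_mem _ _)))
      (Submodule.smul_mem _ _ (toWeyl_nord_mem _ _)))
      (Submodule.smul_mem _ _ (toWeyl_nord_mem _ _))
  · rw [nord_comm a c, nord_comm b c]
    simp only [map_add, map_smul, toWeyl_nord]
    have h := quadratic_comm a b c e
    set P := vv a.1 b.1 a.2 b.2
    set Q := vv c.1 e.1 c.2 e.2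
    have h1 : (P - contraction a b • 1) * (Q - contraction c e • 1)
        - (Q - contraction c e • 1) * (P - contraction a b • 1) = P * Q - Q * P := by
      simp only [mul_sub, sub_mul, mul_smul_comm, smul_mul_assoc, mul_one, one_mul, smul_sub,
        smul_smul, mul_comm (contraction c e)]
      abel
    rw [h1, h]
    simp only [modeForm_eq]
    module

theorem central_bracket (x : LieL d r) : ⁅x, central d r⁆ = 0 := by
  rw [bracket_eq (z := 0) (s := 0)]
  · simp
  · simp
  · rw [toWeyl_central]; simp

theorem span_nord : Submodule.span ℂ
    ({x : LieL d r | ∃ a b, x = nord r a b} ∪ {central d r}) = ⊤ := by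
  rw [eq_top_iff]
  rintro ⟨x, hx⟩ -
  rw [calL_eq_span] at hx
  have hx' : x ∈ (Submodule.span ℂ
    ({x : LieL d r | ∃ a b, x = nord r a b} ∪ {central d r})).map (toWeyl d r) := by
    refine Submodule.span_le.mpr ?_ hx
    rintro y (⟨i, j, m, n, rfl⟩ | rfl)
    · refine ⟨lv r i j m n, ?_, rfl⟩
      rw [lv_eq_nord]
      exact add_mem (Submodule.subset_span (Or.inl ⟨_, _, rfl⟩))
        (Submodule.smul_mem _ _ (Submodule.subset_span (Or.inr rfl)))
    · exact ⟨central d r, Submodule.subset_span (Or.inr rfl), toWeyl_central⟩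
  obtain ⟨y, hy, rfl⟩ := hx'
  exact hy

theorem lieL_induction {p : LieL d r → Prop} (x : LieL d r) (hn : ∀ a b, p (nord r a b))
    (hc : p (central d r)) (ha : ∀ x y, p x → p y → p (x + y)) (hs : ∀ (t : ℂ) x, p x → p (t • x)) :
    p x := by
  have hx : x ∈ Submodule.span ℂ ({x : LieL d r | ∃ a b, x = nord r a b} ∪ {central d r}) := by
    rw [span_nord]; trivial
  induction hx using Submodule.span_induction with
  | mem x hx =>
    rcases hx with ⟨a, b, rfl⟩ | rfl
    · exact hn a b
    · exact hc
  | zero => simpa using hs 0 _ hc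
  | add x y _ _ hx hy => exact ha x y hx hy
  | smul t x _ hx => exact hs t x hx

end NormalOrder

/-! ### The polynomial model of `M_r` -/

section Model

variable {d : ℕ}

/-- The creation mode with index `k`. -/
def creat (k : Fin d × ℕ) : Fin d × ℤ := (k.1, Int.negSucc k.2)

/-- The annihilation mode with index `k`. -/
def annih (k : Fin d × ℕ) : Fin d × ℤ := (k.1, Int.ofNat (k.2 + 1))

theorem mode_cases (a : Fin d × ℤ) :
    (∃ k, a = creat k) ∨ (∃ k, a = annih k) ∨ ∃ i, a = (i, 0) := by
  obtain ⟨i, m⟩ := a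
  match m with
  | Int.negSucc s => exact Or.inl ⟨(i, s), rfl⟩
  | Int.ofNat 0 => exact Or.inr (Or.inr ⟨i, rfl⟩)
  | Int.ofNat (s + 1) => exact Or.inr (Or.inl ⟨(i, s), rfl⟩)

/-- The operator of the normally ordered product of two modes. -/
def modeOp (r : ℂ) : Fin d × ℤ → Fin d × ℤ → Module.End ℂ (SymPoly (Fin d × ℕ))
  | (i, Int.negSucc s), (j, Int.negSucc t) => LinearMap.mulLeft ℂ (entry (i, s) (j, t))
  -- The annihilation mode with index `t` is v^j(t + 1), whose commutator with v^j(-(t + 1)) is t +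
  -- 1.
  | (i, Int.negSucc s), (j, Int.ofNat (t + 1)) => ((t : ℂ) + 1) • (polar (i, s) (j, t)).toLinearMap
  | (i, Int.ofNat (s + 1)), (j, Int.negSucc t) => ((s : ℂ) + 1) • (polar (j, t) (i, s)).toLinearMap
  | (i, Int.ofNat (s + 1)), (j, Int.ofNat (t + 1)) =>
      (((s : ℂ) + 1) * ((t : ℂ) + 1)) • second r (i, s) (j, t)
  -- Zero modes have zero commutator with every mode, and pairs containing one kill the vacuum, so
  -- such pairs act by 0.
  | (_, Int.ofNat 0), _ => 0
  | _, (_, Int.ofNat 0) => 0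

variable (r : ℂ) (k l : Fin d × ℕ) (f : SymPoly (Fin d × ℕ))

theorem modeOp_creat_creat : modeOp r (creat k) (creat l) f = entry k l * f := rfl

theorem modeOp_creat_annih :
    modeOp r (creat k) (annih l) f = ((l.2 : ℂ) + 1) • polar k l f := rfl

theorem modeOp_annih_creat :
    modeOp r (annih k) (creat l) f = ((k.2 : ℂ) + 1) • polar l k f := rfl

theorem modeOp_annih_annih : modeOp r (annih k) (annih l) f =
    (((k.2 : ℂ) + 1) * ((l.2 : ℂ) + 1)) • second r k l f := rfl

theorem modeOp_zero_left (i : Fin d) (a : Fin d × ℤ) : modeOp r (i, 0) a = 0 := by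
  obtain ⟨k, rfl⟩ | ⟨k, rfl⟩ | ⟨j, rfl⟩ := mode_cases a <;> rfl

theorem modeOp_zero_right (i : Fin d) (a : Fin d × ℤ) : modeOp r a (i, 0) = 0 := by
  obtain ⟨k, rfl⟩ | ⟨k, rfl⟩ | ⟨j, rfl⟩ := mode_cases a <;> rfl

theorem modeOp_comm (a b : Fin d × ℤ) : modeOp r a b = modeOp r b a := by
  apply LinearMap.ext
  intro f
  obtain ⟨k, rfl⟩ | ⟨k, rfl⟩ | ⟨i, rfl⟩ := mode_cases a
  · obtain ⟨l, rfl⟩ | ⟨l, rfl⟩ | ⟨j, rfl⟩ := mode_cases b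
    · rw [modeOp_creat_creat, modeOp_creat_creat, entry_comm]
    · rw [modeOp_creat_annih, modeOp_annih_creat]
    · rw [modeOp_zero_left, modeOp_zero_right]
  · obtain ⟨l, rfl⟩ | ⟨l, rfl⟩ | ⟨j, rfl⟩ := mode_cases b
    · rw [modeOp_creat_annih, modeOp_annih_creat]
    · rw [modeOp_annih_annih, modeOp_annih_annih, second_comm, mul_comm ((k.2 : ℂ) + 1)]
    · rw [modeOp_zero_left, modeOp_zero_right]
  · rw [modeOp_zero_left, modeOp_zero_right]

theorem contraction_creat_left (a : Fin d × ℤ) : contraction (creat k) a = 0 := by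
  refine if_neg fun h => ?_
  have := h.1
  simp only [creat] at this
  omega

theorem contraction_zero_left (i : Fin d) (a : Fin d × ℤ) : contraction (i, 0) a = 0 :=
  if_neg fun h => lt_irrefl _ h.1

theorem contraction_zero_right (i : Fin d) (a : Fin d × ℤ) : contraction a (i, 0) = 0 :=
  if_neg fun h => by
    have h1 := h.1
    have h2 := h.2.1
    simp only at h1 h2
    omega

theorem contraction_annih_annih : contraction (annih k) (annih l) = 0 :=
  if_neg fun h => by
    have h2 := h.2.1
    simp only [annih, Int.ofNat_eq_natCast] at h2
    omega

theorem contraction_annih_creat :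
    contraction (annih k) (creat l) = if k = l then (k.2 : ℂ) + 1 else 0 := by
  obtain ⟨i, s⟩ := k
  obtain ⟨j, t⟩ := l
  simp only [contraction, annih, creat, Prod.mk.injEq, Int.ofNat_eq_natCast]
  refine if_congr ?_ (by simp) rfl
  constructor
  · rintro ⟨h1, h2, h3⟩
    refine ⟨h3, ?_⟩
    omega
  · rintro ⟨h1, rfl⟩
    refine ⟨?_, ?_, h1⟩ <;> omega

theorem modeForm_annih_creat :
    modeForm (annih k) (creat l) = if k = l then (k.2 : ℂ) + 1 else 0 := by
  rw [modeForm_eq, contraction_creat_left, contraction_annih_creat, sub_zero]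

theorem modeForm_creat_creat : modeForm (creat k) (creat l) = 0 := by
  rw [modeForm_eq, contraction_creat_left, contraction_creat_left, sub_zero]

theorem modeForm_zero_left (i : Fin d) (a : Fin d × ℤ) : modeForm (i, 0) a = 0 := by
  rw [modeForm_eq, contraction_zero_left, contraction_zero_right, sub_zero]

theorem modeForm_swap (a b : Fin d × ℤ) : modeForm a b = - modeForm b a := by
  rw [modeForm_eq, modeForm_eq b a, neg_sub]

theorem modeForm_zero_right (i : Fin d) (a : Fin d × ℤ) : modeForm a (i, 0) = 0 := by
  rw [modeForm_swap, modeForm_zero_left, neg_zero]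

theorem modeForm_annih_annih : modeForm (annih k) (annih l) = 0 := by
  rw [modeForm_eq, contraction_annih_annih, contraction_annih_annih, sub_zero]

/-- The correction terms are those of `nord_bracket` for a creation pair on the right; this match
makes the operators a representation. -/
theorem modeOp_entry_mul (a b : Fin d × ℤ) :
    modeOp r a b (entry k l * f) = entry k l * modeOp r a b f
      + (modeForm b (creat k) • modeOp r a (creat l) f
        + modeForm a (creat k) • modeOp r b (creat l) f
        + modeForm b (creat l) • modeOp r a (creat k) f
        + modeForm a (creat l) • modeOp r b (creat k) f)
      + (r * (contraction a (creat l) * contraction b (creat k)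
        + contraction a (creat k) * contraction b (creat l))) • f := by
  obtain ⟨s, rfl⟩ | ⟨s, rfl⟩ | ⟨i, rfl⟩ := mode_cases a
  · obtain ⟨t, rfl⟩ | ⟨t, rfl⟩ | ⟨j, rfl⟩ := mode_cases b
    · simp only [modeOp_creat_creat, modeForm_creat_creat, contraction_creat_left]
      simp only [mul_left_comm, zero_smul, add_zero, mul_zero]
    · simp only [modeOp_creat_annih, modeOp_creat_creat, modeOp_annih_creat, modeForm_annih_creat,
        modeForm_creat_creat, contraction_creat_left, contraction_annih_creat, polar_entry_mul]
      by_cases h1 : t = k <;> by_cases h2 : t = l <;>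
        simp [h1, h2, smul_add]
    · simp only [modeOp_zero_right, modeOp_zero_left, modeForm_zero_left, modeForm_creat_creat,
        contraction_creat_left]
      simp
  · obtain ⟨t, rfl⟩ | ⟨t, rfl⟩ | ⟨j, rfl⟩ := mode_cases b
    · simp only [modeOp_creat_creat, modeOp_annih_creat, modeForm_annih_creat,
        modeForm_creat_creat, contraction_creat_left, contraction_annih_creat, polar_entry_mul]
      by_cases h1 : s = k <;> by_cases h2 : s = l <;>
        simp [h1, h2, smul_add]
    · simp only [modeOp_annih_annih, modeOp_annih_creat, modeForm_annih_creat,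
        contraction_annih_creat, second_entry_mul]
      rcases eq_or_ne k l with rfl | h5
      · by_cases h1 : s = k <;> by_cases h2 : t = k <;>
          simp only [h1, h2, if_true, if_false, mul_smul_comm, smul_add, add_zero, zero_add,
            zero_smul, mul_zero, zero_mul, smul_zero, one_mul, add_mul, and_self, and_true,
            and_false] <;> module
      · by_cases h1 : s = k <;> by_cases h2 : s = l <;> by_cases h3 : t = k <;>
          by_cases h4 : t = l <;>
          simp only [h1, h2, h3, h4, h5, h5.symm, if_true, if_false, and_true, and_false,
            mul_smul_comm, smul_add, add_zero, zero_add, zero_smul, mul_zero, zero_mul, smul_zero,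
            one_mul, add_mul, and_self] <;> module
    · simp only [modeOp_zero_right, modeOp_zero_left, modeForm_zero_left, contraction_zero_left]
      simp
  · simp only [modeOp_zero_left, modeForm_zero_left, contraction_zero_left]
    obtain ⟨t, rfl⟩ | ⟨t, rfl⟩ | ⟨j, rfl⟩ := mode_cases b <;> simp [modeOp_zero_left]

/-- The coefficient of a normally ordered product of two modes, up to the factor coming from the
symmetry. -/
def nordCoeff (p : (Fin d × ℤ) × (Fin d × ℤ)) : WeylAlg d →ₗ[ℂ] ℂ :=
  -- Two commutators with the opposite modes turn a pair into a number. If a mode is 0 the inverse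
  -- is 0 by convention; nothing is lost, since `modeOp` vanishes there.
  ((p.1.2 : ℂ) * p.2.2)⁻¹ • (vev d ∘ₗ
    (LinearMap.mulRight ℂ (gen p.1.1 (-p.1.2)) - LinearMap.mulLeft ℂ (gen p.1.1 (-p.1.2))) ∘ₗ
    (LinearMap.mulRight ℂ (gen p.2.1 (-p.2.2)) - LinearMap.mulLeft ℂ (gen p.2.1 (-p.2.2))))

theorem nordCoeff_one (p : (Fin d × ℤ) × (Fin d × ℤ)) : nordCoeff p (1 : WeylAlg d) = 0 := by
  simp [nordCoeff]

theorem modeForm_neg (a b : Fin d × ℤ) :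
    modeForm a (b.1, -b.2) = if a = b then (a.2 : ℂ) else 0 := by
  obtain ⟨i, m⟩ := a
  obtain ⟨j, n⟩ := b
  simp only [modeForm, Prod.mk.injEq]
  exact if_congr (by rw [add_neg_eq_zero, and_comm]) rfl rfl

theorem nordCoeff_vv (a b : Fin d × ℤ) (p : (Fin d × ℤ) × (Fin d × ℤ)) :
    nordCoeff p (vv a.1 b.1 a.2 b.2) = ((a.2 : ℂ) * b.2)⁻¹ * ((a.2 : ℂ) * b.2) *
      ((if p = (a, b) then 1 else 0) + if p = (b, a) then 1 else 0) := by
  obtain ⟨c, e⟩ := p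
  have h1 := sub_eq_iff_eq_add'.mpr (gen_mul_comm a (e.1, -e.2))
  have h2 := sub_eq_iff_eq_add'.mpr (gen_mul_comm b (e.1, -e.2))
  have h3 := sub_eq_iff_eq_add'.mpr (gen_mul_comm a (c.1, -c.2))
  have h4 := sub_eq_iff_eq_add'.mpr (gen_mul_comm b (c.1, -c.2))
  rw [modeForm_neg] at h1 h2 h3 h4
  have key : vv a.1 b.1 a.2 b.2 * gen e.1 (-e.2) - gen e.1 (-e.2) * vv a.1 b.1 a.2 b.2
      = (if b = e then (b.2 : ℂ) else 0) • gen a.1 a.2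
        + (if a = e then (a.2 : ℂ) else 0) • gen b.1 b.2 := by
    have : vv a.1 b.1 a.2 b.2 * gen e.1 (-e.2) - gen e.1 (-e.2) * vv a.1 b.1 a.2 b.2
      = gen a.1 a.2 * (gen b.1 b.2 * gen e.1 (-e.2) - gen e.1 (-e.2) * gen b.1 b.2)
        + (gen a.1 a.2 * gen e.1 (-e.2) - gen e.1 (-e.2) * gen a.1 a.2) * gen b.1 b.2 := by
      simp only [vv]; noncomm_ring
    rw [this]
    simp only at h1 h2
    rw [h1, h2]
    simp only [mul_smul_comm, smul_mul_assoc, mul_one, one_mul]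
  have key2 : ∀ s t : ℂ, (s • gen a.1 a.2 + t • gen b.1 b.2) * gen c.1 (-c.2)
      - gen c.1 (-c.2) * (s • gen a.1 a.2 + t • gen b.1 b.2)
      = (s * (if a = c then (a.2 : ℂ) else 0) + t * (if b = c then (b.2 : ℂ) else 0)) •
        (1 : WeylAlg d) := by
    intro s t
    have : (s • gen a.1 a.2 + t • gen b.1 b.2) * gen c.1 (-c.2)
      - gen c.1 (-c.2) * (s • gen a.1 a.2 + t • gen b.1 b.2)
      = s • (gen a.1 a.2 * gen c.1 (-c.2) - gen c.1 (-c.2) * gen a.1 a.2)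
        + t • (gen b.1 b.2 * gen c.1 (-c.2) - gen c.1 (-c.2) * gen b.1 b.2) := by
      simp only [add_mul, mul_add, mul_smul_comm, smul_mul_assoc, smul_sub]
      abel
    rw [this]
    simp only at h3 h4
    rw [h3, h4, smul_smul, smul_smul, add_smul]
  simp only [nordCoeff, LinearMap.smul_apply, LinearMap.comp_apply, LinearMap.sub_apply,
    LinearMap.mulLeft_apply, LinearMap.mulRight_apply, Prod.mk.injEq]
  rw [key, key2, map_smul, vev_one]
  simp only [smul_eq_mul, mul_one]
  by_cases h1 : a = e <;> by_cases h2 : b = e <;> by_cases h3 : a = c <;> by_cases h4 : b = c <;>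
    grind

theorem nordCoeff_support_finite (x : LieL d r) :
    (Function.support fun p => nordCoeff p (toWeyl d r x)).Finite := by
  induction x using lieL_induction with
  | hn a b =>
    refine Set.Finite.subset (Set.toFinite {(a, b), (b, a)}) fun p hp => ?_
    rw [Function.mem_support, toWeyl_nord, map_sub, map_smul, nordCoeff_one, nordCoeff_vv] at hp
    by_contra h
    simp only [Set.mem_insert_iff, Set.mem_singleton_iff, not_or] at h
    simp [h.1, h.2] at hp
  | hc => simp [toWeyl_central, nordCoeff_one]
  | ha x y hx hy =>
    refine (hx.union hy).subset ?_
    simp only [map_add]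
    exact Function.support_add _ _
  | hs t x hx =>
    refine hx.subset ?_
    simp only [map_smul]
    exact Function.support_const_smul_subset t _

/-- The action of `L_r` on the polynomial model. -/
def model (d : ℕ) (r : ℂ) : LieL d r →ₗ[ℂ] Module.End ℂ (SymPoly (Fin d × ℕ)) where
  toFun x := vev d (toWeyl d r x) • 1
    -- A normally ordered pair is detected at (a, b) and at (b, a), or with coefficient 2 if a = b;
    -- the half corrects this.
    + (1 / 2 : ℂ) • ∑ᶠ p, nordCoeff p (toWeyl d r x) • modeOp r p.1 p.2
  map_add' x y := by
    have h := fun x : LieL d r => (nordCoeff_support_finite r x).subset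
      (Function.support_smul_subset_left _ (fun p => modeOp r p.1 p.2))
    have h2 := finsum_add_distrib (h x) (h y)
    simp only [map_add, add_smul]
    refine Eq.trans ?_ (add_add_add_comm _ _ _ _)
    rw [← smul_add]
    exact congrArg _ (congrArg _ h2)
  map_smul' t x := by
    simp only [map_smul, smul_assoc, RingHom.id_apply, smul_add]
    rw [smul_comm t (1 / 2 : ℂ), smul_finsum t]

theorem model_central : model d r (central d r) = 1 := by
  change vev d (toWeyl d r _) • 1 + _ • ∑ᶠ p, nordCoeff p (toWeyl d r _) • modeOp r p.1 p.2 = _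
  rw [toWeyl_central]
  simp [nordCoeff_one, vev_one]

theorem model_nord (a b : Fin d × ℤ) : model d r (nord r a b) = modeOp r a b := by
  have h0 : vev d (toWeyl d r (nord r a b)) = 0 := by
    have : Submodule.span ℂ (setB d) ≤ LinearMap.ker (vev d) :=
      Submodule.span_le.mpr fun y hy => vev_setB hy
    exact this (toWeyl_nord_mem a b)
  have h1 : (((a.2 : ℂ) * b.2)⁻¹ * ((a.2 : ℂ) * b.2)) • modeOp r a b = modeOp r a b := by
    by_cases ha : a.2 = 0
    · have : modeOp r a b = 0 := by
        rw [show a = (a.1, 0) from Prod.ext rfl ha, modeOp_zero_left]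
      rw [this, smul_zero]
    · by_cases hb : b.2 = 0
      · have : modeOp r a b = 0 := by
          rw [show b = (b.1, 0) from Prod.ext rfl hb, modeOp_zero_right]
        rw [this, smul_zero]
      · have ha' : (a.2 : ℂ) ≠ 0 := by exact_mod_cast ha
        have hb' : (b.2 : ℂ) ≠ 0 := by exact_mod_cast hb
        rw [inv_mul_cancel₀ (mul_ne_zero ha' hb'), one_smul]
  change vev d (toWeyl d r _) • 1 + _ • ∑ᶠ p, nordCoeff p (toWeyl d r _) • modeOp r p.1 p.2 = _
  rw [h0, zero_smul, zero_add]
  have h2 : ∀ p : (Fin d × ℤ) × (Fin d × ℤ),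
      nordCoeff p (toWeyl d r (nord r a b)) • modeOp r p.1 p.2
      = (if p = (a, b) then modeOp r a b else 0) + (if p = (b, a) then modeOp r a b else 0) := by
    intro p
    rw [toWeyl_nord, map_sub, map_smul, nordCoeff_one, smul_zero, sub_zero, nordCoeff_vv,
      mul_add, add_smul]
    congr 1
    · by_cases h : p = (a, b)
      · rw [if_pos h, if_pos h, h, mul_one, h1]
      · simp [h]
    · by_cases h : p = (b, a)
      · rw [if_pos h, if_pos h, h, mul_one, modeOp_comm, h1]
      · simp [h]
  have h3 : ∀ q : (Fin d × ℤ) × (Fin d × ℤ),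
      (Function.support fun p => if p = q then modeOp r a b else 0).Finite := fun q =>
    (Set.finite_singleton q).subset fun p hp => by
      by_contra h
      exact hp (if_neg h)
  rw [finsum_congr h2, finsum_add_distrib (h3 _) (h3 _),
    finsum_eq_single _ (a, b) (fun p hp => if_neg hp),
    finsum_eq_single _ (b, a) (fun p hp => if_neg hp), if_pos rfl, if_pos rfl, ← two_smul ℂ,
    smul_smul]
  norm_num

/-- This is compatibility with brackets against creation pairs, which carries the representation
property from the vector 1 to all polynomials. -/
theorem model_lie_entry_mul (x : LieL d r) :
    model d r x (entry k l * f) = entry k l * model d r x f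
      + model d r ⁅x, nord r (creat k) (creat l)⁆ f := by
  induction x using lieL_induction with
  | hn a b =>
    rw [nord_bracket]
    simp only [map_add, map_smul, model_nord, model_central, LinearMap.add_apply,
      LinearMap.smul_apply, Module.End.one_apply]
    rw [modeOp_entry_mul]
    simp only [contraction_creat_left, mul_zero, sub_zero]
    abel
  | hc =>
    rw [← lie_skew, central_bracket]
    simp [model_central]
  | ha x y hx hy =>
    rw [add_lie, map_add, map_add, LinearMap.add_apply, LinearMap.add_apply, LinearMap.add_apply,
      hx, hy]
    ring
  | hs t x hx =>
    rw [smul_lie, map_smul, map_smul, LinearMap.smul_apply, LinearMap.smul_apply,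
      LinearMap.smul_apply, hx, smul_add, mul_smul_comm]

theorem modeOp_one (a b : Fin d × ℤ) (h : ¬ ((∃ k, a = creat k) ∧ ∃ l, b = creat l)) :
    modeOp r a b 1 = 0 := by
  obtain ⟨s, rfl⟩ | ⟨s, rfl⟩ | ⟨i, rfl⟩ := mode_cases a
  · obtain ⟨t, rfl⟩ | ⟨t, rfl⟩ | ⟨j, rfl⟩ := mode_cases b
    · exact absurd ⟨⟨s, rfl⟩, ⟨t, rfl⟩⟩ h
    · simp [modeOp_creat_annih]
    · simp [modeOp_zero_right]
  · obtain ⟨t, rfl⟩ | ⟨t, rfl⟩ | ⟨j, rfl⟩ := mode_cases b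
    · simp [modeOp_annih_creat]
    · simp [modeOp_annih_annih, second_one]
    · simp [modeOp_zero_right]
  · simp [modeOp_zero_left]

end Model

/-! ### The model as a representation, and the relations of the vacuum -/

section ModelHom

variable {d : ℕ} (r : ℂ)

theorem model_creat (k l : Fin d × ℕ) (f : SymPoly (Fin d × ℕ)) :
    model d r (nord r (creat k) (creat l)) f = entry k l * f := by
  rw [model_nord, modeOp_creat_creat]

/-- If neither pair is a creation pair, each term of the bracket either has coefficient 0 or kills
1; a nonzero double contraction needs a creation pair against an annihilation pair. -/
theorem model_lie_nord_one (a b c e : Fin d × ℤ)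
    (h : ¬ ((∃ k, a = creat k) ∧ ∃ l, b = creat l)) (h' : ¬ ((∃ k, c = creat k) ∧ ∃ l, e = creat l)) :
    model d r ⁅nord r a b, nord r c e⁆ 1 = 0 := by
  rw [nord_bracket]
  simp only [map_add, map_smul, model_nord, model_central, LinearMap.add_apply,
    LinearMap.smul_apply, Module.End.one_apply]
  obtain ⟨k, rfl⟩ | ⟨k, rfl⟩ | ⟨i, rfl⟩ := mode_cases a <;>
  obtain ⟨l, rfl⟩ | ⟨l, rfl⟩ | ⟨j, rfl⟩ := mode_cases b <;>
  first
  | exact absurd ⟨⟨_, rfl⟩, ⟨_, rfl⟩⟩ h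
  | obtain ⟨s, rfl⟩ | ⟨s, rfl⟩ | ⟨i, rfl⟩ := mode_cases c <;>
    obtain ⟨t, rfl⟩ | ⟨t, rfl⟩ | ⟨j, rfl⟩ := mode_cases e <;>
    first
    | exact absurd ⟨⟨_, rfl⟩, ⟨_, rfl⟩⟩ h'
    | simp only [modeForm_creat_creat, modeForm_annih_annih, modeForm_zero_left, modeForm_zero_right,
        contraction_creat_left, contraction_annih_annih, contraction_zero_left,
        contraction_zero_right, modeOp_creat_annih, modeOp_annih_creat, modeOp_annih_annih,
        modeOp_zero_left, modeOp_zero_right, second_one, Derivation.map_one_eq_zero, smul_zero,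
        zero_smul, mul_zero, zero_mul, add_zero, sub_zero, LinearMap.zero_apply]

theorem model_lie_one (x y : LieL d r) :
    model d r ⁅x, y⁆ 1 = model d r x (model d r y 1) - model d r y (model d r x 1) := by
  have key : ∀ (x : LieL d r) (k l : Fin d × ℕ),
      model d r ⁅x, nord r (creat k) (creat l)⁆ 1
        = model d r x (model d r (nord r (creat k) (creat l)) 1)
          - model d r (nord r (creat k) (creat l)) (model d r x 1) := by
    intro x k l
    rw [model_creat, model_creat, model_lie_entry_mul]
    abel
  induction x using lieL_induction with
  | hn a b =>
    by_cases h : (∃ k, a = creat k) ∧ ∃ l, b = creat l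
    · obtain ⟨⟨k, rfl⟩, l, rfl⟩ := h
      rw [← lie_skew, map_neg, LinearMap.neg_apply, key, neg_sub]
    · induction y using lieL_induction with
      | hn c e =>
        by_cases h' : (∃ k, c = creat k) ∧ ∃ l, e = creat l
        · obtain ⟨⟨k, rfl⟩, l, rfl⟩ := h'
          rw [key]
        · rw [model_lie_nord_one r a b c e h h', model_nord, model_nord, modeOp_one r a b h,
            modeOp_one r c e h', map_zero, map_zero, sub_zero]
      | hc => simp [central_bracket, model_central]
      | ha y z hy hz =>
        rw [lie_add]
        simp only [map_add, LinearMap.add_apply, hy, hz]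
        abel
      | hs t y hy =>
        rw [lie_smul]
        simp only [map_smul, LinearMap.smul_apply, hy, smul_sub]
  | hc =>
    rw [← lie_skew, central_bracket]
    simp [model_central]
  | ha x z hx hz =>
    rw [add_lie]
    simp only [map_add, LinearMap.add_apply, hx, hz]
    abel
  | hs t x hx =>
    rw [smul_lie]
    simp only [map_smul, LinearMap.smul_apply, hx, smul_sub]

/-- Induction on `f`: multiplication by an entry is the action of a creation pair, and the step is
the Jacobi identity. -/
theorem model_lie (x y : LieL d r) (f : SymPoly (Fin d × ℕ)) :
    model d r ⁅x, y⁆ f = model d r x (model d r y f) - model d r y (model d r x f) := by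
  induction f using symPoly_induction generalizing x y with
  | h1 => exact model_lie_one r x y
  | hs t f hf => simp only [map_smul, hf, smul_sub]
  | ha f g hf hg =>
    simp only [map_add, hf, hg]
    abel
  | hx k l f hf =>
    rw [model_lie_entry_mul, model_lie_entry_mul, model_lie_entry_mul, map_add, map_add,
      model_lie_entry_mul, model_lie_entry_mul, lie_lie, map_sub, LinearMap.sub_apply]
    simp only [hf]
    ring

/-- The polynomial model as a representation of `L_r`. -/
def modelHom (d : ℕ) (r : ℂ) : LieL d r →ₗ⁅ℂ⁆ Module.End ℂ (SymPoly (Fin d × ℕ)) where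
  toLinearMap := model d r
  map_lie' {x y} := by
    apply LinearMap.ext
    intro f
    exact model_lie r x y f

/-- The polynomial model as a representation of `U(L_r)`. -/
def modelAlg (d : ℕ) (r : ℂ) : UL d r →ₐ[ℂ] Module.End ℂ (SymPoly (Fin d × ℕ)) :=
  UniversalEnvelopingAlgebra.lift ℂ (modelHom d r)

theorem modelAlg_iota (x : LieL d r) : modelAlg d r (iota x) = model d r x :=
  UniversalEnvelopingAlgebra.lift_ι_apply ℂ (modelHom d r) x

theorem contraction_eq_zero {i j : Fin d} {m n : ℤ} (h : i ≠ j ∨ m + n ≠ 0 ∨ m ≤ n) :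
    contraction (i, m) (j, n) = 0 := by
  refine if_neg ?_
  rintro ⟨h1, h2, h3⟩
  simp only at h1 h2 h3
  rcases h with h | h | h
  · exact h h3
  · exact h h2
  · omega

theorem lv_eq_nord_of {i j : Fin d} {m n : ℤ} (h : i ≠ j ∨ m + n ≠ 0 ∨ m ≤ n) :
    lv r i j m n = nord r (i, m) (j, n) := by
  rw [lv_eq_nord, contraction_eq_zero h, zero_smul, add_zero]

theorem setBplus_eq_nord {x : LieL d r} (hx : x ∈ setBplus d r) :
    ∃ a b : Fin d × ℤ, (0 ≤ a.2 ∨ 0 ≤ b.2) ∧ x = nord r a b := by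
  rcases hx with ⟨i, m, n, h, h', rfl⟩ | ⟨i, j, m, n, h, h', rfl⟩
  · exact ⟨(i, m), (i, n), h', lv_eq_nord_of r (Or.inr (Or.inr h))⟩
  · exact ⟨(i, m), (j, n), h', lv_eq_nord_of r (Or.inl h.ne)⟩

theorem nord_mem_setBplus {a b : Fin d × ℤ} (h : 0 ≤ a.2 ∨ 0 ≤ b.2) :
    nord r a b ∈ setBplus d r := by
  have key : ∀ a b : Fin d × ℤ, (0 ≤ a.2 ∨ 0 ≤ b.2) → (a.1 < b.1 ∨ (a.1 = b.1 ∧ a.2 ≤ b.2)) →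
      nord r a b ∈ setBplus d r := by
    rintro ⟨i, m⟩ ⟨j, n⟩ h (h' | ⟨rfl, h'⟩)
    · rw [← lv_eq_nord_of r (Or.inl (ne_of_lt h'))]
      exact Or.inr ⟨i, j, m, n, h', h, rfl⟩
    · rw [← lv_eq_nord_of r (Or.inr (Or.inr h'))]
      exact Or.inl ⟨i, m, n, h', h, rfl⟩
  rcases lt_trichotomy a.1 b.1 with h' | h' | h'
  · exact key a b h (Or.inl h')
  · rcases le_total a.2 b.2 with h'' | h''
    · exact key a b h (Or.inr ⟨h', h''⟩)
    · rw [nord_comm]; exact key b a h.symm (Or.inr ⟨h'.symm, h''⟩)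
  · rw [nord_comm]; exact key b a h.symm (Or.inl h')

/-- Hence u ↦ u · 1 in the model factors through M_r, which allows relations in M_r to be tested on
polynomials. -/
theorem modelAlg_vacIdeal {u : UL d r} (hu : u ∈ vacIdeal d r) : modelAlg d r u 1 = 0 := by
  induction hu using Submodule.span_induction with
  | mem u hu =>
    rcases hu with ⟨x, hx, rfl⟩ | ⟨s, rfl⟩
    · obtain ⟨a, b, h, rfl⟩ := setBplus_eq_nord r hx
      rw [modelAlg_iota, model_nord]
      apply modeOp_one
      rintro ⟨⟨k, rfl⟩, l, rfl⟩
      simp only [creat] at h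
      omega
    · have : lscalar d r s = s • central d r := by
        apply toWeyl_injective
        rw [map_smul, toWeyl_central]
        rfl
      rw [map_sub, modelAlg_iota, this, map_smul, model_central, AlgHom.commutes]
      simp
  | zero => simp
  | add u v _ _ hu hv => rw [map_add, LinearMap.add_apply, hu, hv, add_zero]
  | smul a u _ hu =>
    rw [smul_eq_mul, map_mul, Module.End.mul_apply, hu, map_zero]

theorem smul_vac_eq_zero_iff (u : UL d r) : u • vac d r = 0 ↔ u ∈ vacIdeal d r := by
  have : u • vac d r = Submodule.Quotient.mk (p := vacIdeal d r) u := by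
    change Submodule.Quotient.mk (u • (1 : UL d r)) = _
    rw [smul_eq_mul, mul_one]
  rw [this]
  exact Submodule.Quotient.mk_eq_zero _

theorem nord_vac {a b : Fin d × ℤ} (h : 0 ≤ a.2 ∨ 0 ≤ b.2) :
    iota (nord r a b) • vac d r = 0 := by
  rw [smul_vac_eq_zero_iff]
  exact Submodule.subset_span (Or.inl ⟨_, nord_mem_setBplus r h, rfl⟩)

theorem iota_central_vac : iota (central d r) • vac d r = vac d r := by
  have h : (iota (lscalar d r 1) - algebraMap ℂ (UL d r) 1) • vac d r = 0 := by
    rw [smul_vac_eq_zero_iff]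
    exact Submodule.subset_span (Or.inr ⟨1, rfl⟩)
  rw [sub_smul, map_one, one_smul, sub_eq_zero] at h
  exact h

theorem iota_add (x y : LieL d r) : iota (x + y) = iota x + iota y := map_add _ x y

theorem iota_smul (t : ℂ) (x : LieL d r) : iota (t • x) = t • iota x := map_smul _ t x

theorem iota_zero : iota (0 : LieL d r) = 0 := map_zero _

theorem iota_mul_eq (x y : LieL d r) : iota x * iota y = iota y * iota x + iota ⁅x, y⁆ := by
  simp only [iota, LieHom.map_lie, LieRing.of_associative_ring_bracket]
  abel

end ModelHom

open scoped IsMulCommutative in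
-- Polynomial evaluation needs a commutative target, so it is made into the subalgebra generated by
-- the commuting elements and then included.
theorem exists_algHom_of_commute {σ A : Type*} [Ring A] [Algebra ℂ A] (g : σ → A)
    (hg : ∀ i j, g i * g j = g j * g i) :
    ∃ φ : MvPolynomial σ ℂ →ₐ[ℂ] A, ∀ i, φ (MvPolynomial.X i) = g i := by
  have : IsMulCommutative (Algebra.adjoin ℂ (Set.range g)) :=
    Algebra.isMulCommutative_adjoin ℂ (by
      rintro _ ⟨i, rfl⟩ _ ⟨j, rfl⟩
      exact hg i j)
  let φ : MvPolynomial σ ℂ →ₐ[ℂ] Algebra.adjoin ℂ (Set.range g) :=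
    MvPolynomial.aeval fun i => ⟨g i, Algebra.subset_adjoin ⟨i, rfl⟩⟩
  refine ⟨(Algebra.adjoin ℂ (Set.range g)).val.comp φ, fun i => ?_⟩
  simp [φ]

/-! ### The polynomial description of `M_r^{(1)}` -/

section FirstBlock

variable {d : ℕ} [NeZero d] (r : ℂ)

/-- The creation mode `v^1(-(s + 1))`. -/
def creat₁ (d : ℕ) [NeZero d] (s : ℕ) : Fin d × ℤ := creat (0, s)

/-- The annihilation mode `v^1(s + 1)`. -/
def annih₁ (d : ℕ) [NeZero d] (s : ℕ) : Fin d × ℤ := annih (0, s)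

theorem exists_polyToUL (d : ℕ) [NeZero d] (r : ℂ) : ∃ φ : SymPoly ℕ →ₐ[ℂ] UL d r,
    ∀ s t, φ (entry s t) = iota (nord r (creat₁ d s) (creat₁ d t)) := by
  obtain ⟨φ, hφ⟩ := exists_algHom_of_commute (σ := Sym2 ℕ) (A := UL d r)
    (Sym2.lift ⟨fun s t => iota (nord r (creat₁ d s) (creat₁ d t)),
      fun s t => congrArg iota (nord_comm _ _)⟩) (by
    intro i j
    induction i with
    | _ a b =>
    induction j with
    | _ c e =>
    simp only [Sym2.lift_mk]
    rw [iota_mul_eq, nord_bracket]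
    simp [creat₁, modeForm_creat_creat, contraction_creat_left, iota_zero])
  exact ⟨φ, fun s t => hφ s(s, t)⟩

/-- The algebra homomorphism sending the entries of the generic symmetric matrix to the
quadratic creation operators. -/
def polyToUL (d : ℕ) [NeZero d] (r : ℂ) : SymPoly ℕ →ₐ[ℂ] UL d r :=
  (exists_polyToUL d r).choose

theorem polyToUL_entry (s t : ℕ) :
    polyToUL d r (entry s t) = iota (nord r (creat₁ d s) (creat₁ d t)) :=
  (exists_polyToUL d r).choose_spec s t

/-- The map `f ↦ f(v(-s, -t)) 1`. -/
def polyToM (d : ℕ) [NeZero d] (r : ℂ) : SymPoly ℕ →ₗ[ℂ] ModM d r :=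
  (LinearMap.toSpanSingleton (UL d r) (ModM d r) (vac d r)).restrictScalars ℂ ∘ₗ
    (polyToUL d r).toLinearMap

theorem polyToM_apply (f : SymPoly ℕ) : polyToM d r f = polyToUL d r f • vac d r := rfl

theorem polyToM_one : polyToM d r 1 = vac d r := by
  rw [polyToM_apply, map_one, one_smul]

theorem polyToM_entry_mul (s t : ℕ) (f : SymPoly ℕ) : polyToM d r (entry s t * f) =
    iota (nord r (creat₁ d s) (creat₁ d t)) • polyToM d r f := by
  rw [polyToM_apply, map_mul, polyToUL_entry, mul_smul, polyToM_apply]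

theorem modelAlg_polyToUL (f : SymPoly ℕ) (g : SymPoly (Fin d × ℕ)) :
    modelAlg d r (polyToUL d r f) g
      = MvPolynomial.rename (Sym2.map fun s : ℕ => ((0 : Fin d), s)) f * g := by
  induction f using symPoly_induction with
  | h1 => simp
  | hs t f hf => simp [hf]
  | ha f f' hf hf' => simp only [map_add, LinearMap.add_apply, hf, hf', add_mul]
  | hx a b f hf =>
    rw [map_mul, map_mul, polyToUL_entry, modelAlg_iota, Module.End.mul_apply, hf, creat₁, creat₁,
      model_creat, map_mul, mul_assoc]
    congr 1
    simp [entry]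

/-- If f · 1 = 0 in M_r, then acting on 1 in the model gives 0; but there the result is `f` itself
with its variables renamed. -/
theorem polyToM_injective : Function.Injective (polyToM d r) := by
  rw [injective_iff_map_eq_zero]
  intro f hf
  rw [polyToM_apply, smul_vac_eq_zero_iff] at hf
  have h := modelAlg_vacIdeal r hf
  rw [modelAlg_polyToUL, mul_one] at h
  have hinj : Function.Injective (Sym2.map fun s : ℕ => ((0 : Fin d), s)) :=
    Sym2.map.injective fun s t hst => (Prod.mk.inj hst).2
  exact (map_eq_zero_iff _ (MvPolynomial.rename_injective _ hinj)).mp h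

theorem central_polyToM (f : SymPoly ℕ) :
    iota (central d r) • polyToM d r f = polyToM d r f := by
  induction f using symPoly_induction with
  | h1 => rw [polyToM_one, iota_central_vac]
  | hs t f hf => rw [map_smul, smul_comm, hf]
  | ha f g hf hg => rw [map_add, smul_add, hf, hg]
  | hx a b f hf =>
    rw [polyToM_entry_mul, smul_smul, iota_mul_eq, ← lie_skew, central_bracket, neg_zero]
    rw [iota_zero, add_zero, mul_smul, hf]

theorem iota_polyToM_entry_mul (x : LieL d r) (s t : ℕ) (f : SymPoly ℕ) :
    iota x • polyToM d r (entry s t * f) =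
      iota (nord r (creat₁ d s) (creat₁ d t)) • iota x • polyToM d r f
        + iota ⁅x, nord r (creat₁ d s) (creat₁ d t)⁆ • polyToM d r f := by
  rw [polyToM_entry_mul, smul_smul, iota_mul_eq, add_smul, mul_smul]

theorem zero_polyToM (i : Fin d) (a : Fin d × ℤ) (f : SymPoly ℕ) :
    iota (nord r (i, 0) a) • polyToM d r f = 0 := by
  induction f using symPoly_induction generalizing a with
  | h1 => rw [polyToM_one, nord_vac r (Or.inl le_rfl)]
  | hs t f hf => rw [map_smul, smul_comm, hf, smul_zero]
  | ha f g hf hg => rw [map_add, smul_add, hf, hg, add_zero]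
  | hx s t f hf =>
    rw [iota_polyToM_entry_mul, hf, nord_bracket]
    simp only [creat₁, iota_add, iota_smul, modeForm_zero_left, contraction_zero_left,
      contraction_creat_left, zero_smul, zero_mul, mul_zero, add_zero, sub_zero, add_smul,
      smul_assoc, smul_zero, hf]

theorem pair_inj (s t : ℕ) : (((0 : Fin d), s) = ((0 : Fin d), t)) = (s = t) := by simp

/-- The action on M_r itself is found by moving the operator past creation pairs to the vacuum.
Together with `second_polyToM` and `zero_polyToM` this transports the whole action to polynomials.
-/
theorem polar_polyToM (s t : ℕ) (f : SymPoly ℕ) :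
    iota (nord r (creat₁ d s) (annih₁ d t)) • polyToM d r f
      = ((t : ℂ) + 1) • polyToM d r (polar s t f) := by
  induction f using symPoly_induction with
  | h1 =>
    rw [polyToM_one, nord_vac r]
    · simp
    · right
      simp only [annih₁, annih, Int.ofNat_eq_natCast]
      omega
  | hs c f hf => rw [map_smul, Derivation.map_smul, map_smul, smul_comm, hf, smul_comm]
  | ha f g hf hg => rw [map_add, map_add, map_add, smul_add, hf, hg, smul_add]
  | hx a b f hf =>
    rw [iota_polyToM_entry_mul, hf, nord_bracket, polar_entry_mul, smul_comm,
      ← polyToM_entry_mul, map_add, smul_add]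
    congr 1
    simp only [iota_add, iota_smul, creat₁, annih₁, modeForm_annih_creat, modeForm_creat_creat,
      contraction_creat_left, zero_smul, zero_mul, mul_zero, add_zero, sub_zero, add_smul,
      smul_assoc, pair_inj]
    change _ • iota (nord r (creat₁ d s) (creat₁ d b)) • polyToM d r f
      + _ • iota (nord r (creat₁ d s) (creat₁ d a)) • polyToM d r f = _
    rw [← polyToM_entry_mul, ← polyToM_entry_mul, map_add]
    simp only [apply_ite (polyToM d r), map_zero]
    rcases eq_or_ne a b with rfl | h5
    · by_cases h1 : t = a <;> simp only [h1, if_true, if_false] <;> module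
    · by_cases h1 : t = a <;> by_cases h2 : t = b <;>
        simp only [h1, h2, h5, h5.symm, if_true, if_false] <;> module

theorem second_polyToM (s t : ℕ) (f : SymPoly ℕ) :
    iota (nord r (annih₁ d s) (annih₁ d t)) • polyToM d r f
      = (((s : ℂ) + 1) * ((t : ℂ) + 1)) • polyToM d r (second r s t f) := by
  induction f using symPoly_induction with
  | h1 =>
    rw [polyToM_one, nord_vac r, second_one, map_zero, smul_zero]
    left
    simp only [annih₁, annih, Int.ofNat_eq_natCast]
    omega
  | hs c f hf => rw [map_smul, map_smul, map_smul, smul_comm, hf, smul_comm]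
  | ha f g hf hg => rw [map_add, map_add, map_add, smul_add, hf, hg, smul_add]
  | hx a b f hf =>
    have h : iota ⁅nord r (annih₁ d s) (annih₁ d t), nord r (creat₁ d a) (creat₁ d b)⁆ •
        polyToM d r f = (((s : ℂ) + 1) * ((t : ℂ) + 1)) • polyToM d r
          (((if t = a then polar b s f else 0) + (if t = b then polar a s f else 0))
            + ((if s = a then polar b t f else 0) + (if s = b then polar a t f else 0)))
        + (((s : ℂ) + 1) * ((t : ℂ) + 1)) • polyToM d r
          (r • (((if s = a ∧ t = b then 1 else 0) + (if s = b ∧ t = a then 1 else 0)) * f)) := by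
      rw [nord_bracket]
      simp only [iota_add, iota_smul, add_smul, smul_assoc, central_polyToM]
      congr 1
      · rw [nord_comm (annih₁ d s), nord_comm (annih₁ d t), nord_comm (annih₁ d s),
          nord_comm (annih₁ d t)]
        simp only [polar_polyToM]
        simp only [creat₁, annih₁, modeForm_annih_creat, pair_inj, apply_ite (polyToM d r),
          map_add, map_zero]
        rcases eq_or_ne a b with rfl | h5
        · by_cases h1 : s = a <;> by_cases h2 : t = a <;>
            simp only [h1, h2, if_true, if_false] <;> module
        · by_cases h1 : s = a <;> by_cases h2 : s = b <;> by_cases h3 : t = a <;>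
            by_cases h4 : t = b <;>
            simp only [h1, h2, h3, h4, h5, h5.symm, if_true, if_false] <;> module
      · simp only [creat₁, annih₁, contraction_annih_creat, contraction_creat_left, pair_inj,
          mul_zero, sub_zero, map_smul, add_mul, map_add, ite_mul, one_mul, zero_mul,
          apply_ite (polyToM d r), map_zero]
        rcases eq_or_ne a b with rfl | h5
        · by_cases h1 : s = a <;> by_cases h2 : t = a <;>
            simp only [h1, h2, if_true, if_false, and_true, and_false] <;> module
        · by_cases h1 : s = a <;> by_cases h2 : s = b <;> by_cases h3 : t = a <;>
            by_cases h4 : t = b <;>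
            simp only [h1, h2, h3, h4, h5, h5.symm, if_true, if_false, and_true, and_false] <;>
            module
    rw [iota_polyToM_entry_mul, hf, h, second_entry_mul, smul_comm, ← polyToM_entry_mul]
    simp only [map_add, smul_add]
    abel

end FirstBlock

/-! ### Leading principal minors -/

section Minors

open Finset

theorem derivation_prod {ι A : Type*} [CommRing A] [Algebra ℂ A] [DecidableEq ι]
    (D : Derivation ℂ A A) (S : Finset ι) (f : ι → A) :
    D (∏ i ∈ S, f i) = ∑ i ∈ S, (∏ j ∈ S.erase i, f j) * D (f i) := by
  induction S using Finset.induction_on with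
  | empty => simp
  | insert a S ha ih =>
    rw [prod_insert ha, Derivation.leibniz, ih, sum_insert ha, erase_insert ha, smul_eq_mul,
      smul_eq_mul, mul_sum, add_comm]
    congr 1
    refine sum_congr rfl fun i hi => ?_
    have hia : a ≠ i := fun h => ha (h ▸ hi)
    rw [erase_insert_of_ne hia, prod_insert (fun h => ha (mem_of_mem_erase h)), mul_assoc]

/-- Jacobi's formula. By Cramer's rule the sum over `i` is the determinant with column `j`
differentiated, and the sum over `j` is the product rule. -/
theorem derivation_det {ι A : Type*} [CommRing A] [Algebra ℂ A] [DecidableEq ι] [Fintype ι]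
    (D : Derivation ℂ A A) (M : Matrix ι ι A) :
    D M.det = ∑ i, ∑ j, M.adjugate j i * D (M i j) := by
  have h : ∀ j, ∑ i, M.adjugate j i * D (M i j) = (M.updateCol j fun i => D (M i j)).det := by
    intro j
    rw [← Matrix.cramer_apply, Matrix.cramer_eq_adjugate_mulVec]
    rfl
  rw [sum_comm]
  simp only [h]
  simp only [Matrix.det_apply]
  rw [map_sum, sum_comm]
  refine sum_congr rfl fun σ _ => ?_
  rw [Units.smul_def, map_zsmul, derivation_prod, smul_sum]
  refine sum_congr rfl fun i _ => ?_
  rw [← mul_prod_erase univ _ (mem_univ i), Units.smul_def]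
  congr 1
  rw [Matrix.updateCol_self, mul_comm]
  congr 1
  refine prod_congr rfl fun j hj => ?_
  rw [Matrix.updateCol_ne (ne_of_mem_erase hj)]

/-- The generic symmetric matrix of size `p`. -/
def genericMatrix (p : ℕ) : Matrix (Fin p) (Fin p) (SymPoly ℕ) :=
  Matrix.of fun i j => entry (i : ℕ) (j : ℕ)

/-- The leading principal minor of size `p`. -/
def minor (p : ℕ) : SymPoly ℕ := (genericMatrix p).det

theorem minor_zero : minor 0 = 1 := Matrix.det_isEmpty

theorem derivation_minor (D : Derivation ℂ (SymPoly ℕ) (SymPoly ℕ)) (p : ℕ) :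
    D (minor p) = ∑ i : Fin p, ∑ j : Fin p, (genericMatrix p).adjugate j i * D (entry i j) :=
  derivation_det D (genericMatrix p)

/-- By Jacobi's formula the result is an entry of M · adj M plus an entry of adj M · M, both equal
to det M times the identity; hence the factor 2. -/
theorem polar_minor_of_lt {p c q : ℕ} (hc : c < p) (hq : q < p) :
    polar c q (minor p) = if c = q then (2 : ℂ) • minor p else 0 := by
  rw [derivation_minor]
  have h1 : ∑ i : Fin p, ∑ j : Fin p, (genericMatrix p).adjugate j i * polar c q (entry i j)
      = (genericMatrix p * (genericMatrix p).adjugate) ⟨c, hc⟩ ⟨q, hq⟩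
        + ((genericMatrix p).adjugate * genericMatrix p) ⟨q, hq⟩ ⟨c, hc⟩ := by
    simp only [polar_entry, mul_add, sum_add_distrib]
    congr 1
    · rw [sum_eq_single ⟨q, hq⟩]
      · rw [Matrix.mul_apply]
        refine sum_congr rfl fun j _ => ?_
        rw [if_pos rfl, mul_comm]
        rfl
      · intro i _ hi
        refine sum_eq_zero fun j _ => ?_
        rw [if_neg (fun h => hi (Fin.ext h.symm)), mul_zero]
      · simp
    · rw [sum_comm, sum_eq_single ⟨q, hq⟩]
      · rw [Matrix.mul_apply]
        refine sum_congr rfl fun j _ => ?_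
        rw [if_pos rfl, entry_comm]
        rfl
      · intro i _ hi
        refine sum_eq_zero fun j _ => ?_
        rw [if_neg (fun h => hi (Fin.ext h.symm)), mul_zero]
      · simp
  rw [h1, Matrix.mul_adjugate, Matrix.adjugate_mul, Matrix.smul_apply, Matrix.smul_apply,
    Matrix.one_apply, Matrix.one_apply]
  simp only [Fin.mk.injEq]
  by_cases h : c = q
  · subst h
    simp [minor, two_smul]
  · simp [h, Ne.symm h]

theorem grad_minor_of_le {p a : ℕ} (h : p ≤ a) : grad a (minor p) = 0 := by
  ext1 b
  rw [← gradAt_apply, derivation_minor]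
  refine sum_eq_zero fun i _ => sum_eq_zero fun j _ => ?_
  rw [gradAt_apply, grad_entry_apply, if_neg (fun h' => by have := i.2; omega),
    if_neg (fun h' => by have := j.2; omega), add_zero, mul_zero]

theorem polar_of_grad_eq_zero {a : ℕ} {f : SymPoly ℕ} (h : grad a f = 0) (c : ℕ) :
    polar c a f = 0 := by
  rw [polar_eq_linearCombination, h, map_zero]

theorem polar_minor_eq_zero {p c q : ℕ} (h : c < q) : polar c q (minor p) = 0 := by
  by_cases hq : q < p
  · rw [polar_minor_of_lt (h.trans hq) hq, if_neg h.ne]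
  · exact polar_of_grad_eq_zero (grad_minor_of_le (by omega)) c

/-- Only the corner entry involves the index `n` twice. Its cofactor is the preceding minor, and
`grad` counts a diagonal entry twice. -/
theorem grad_minor_last (n : ℕ) : grad n (minor (n + 1)) n = (2 : ℂ) • minor n := by
  rw [← gradAt_apply, derivation_minor, sum_eq_single (Fin.last n), sum_eq_single (Fin.last n)]
  · rw [gradAt_apply, grad_entry_apply, Matrix.adjugate_fin_succ_eq_det_submatrix]
    simp only [Fin.val_last, and_self, if_true, Fin.succAbove_last]
    have : (genericMatrix (n + 1)).submatrix Fin.castSucc Fin.castSucc = genericMatrix n := by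
      ext1 i j
      rfl
    rw [this, ← minor, ← two_mul, Even.neg_one_pow ⟨n, two_mul n⟩, two_smul]
    ring
  · intro j _ hj
    have : (j : ℕ) ≠ n := fun h => hj (Fin.ext h)
    rw [gradAt_apply, grad_entry_apply]
    simp [this.symm]
  · simp
  · intro i _ hi
    have : (i : ℕ) ≠ n := fun h => hi (Fin.ext h)
    refine sum_eq_zero fun j _ => ?_
    rw [gradAt_apply, grad_entry_apply]
    simp [this.symm]
  · simp

/-- The evaluation at the identity matrix. -/
def evalOne : SymPoly ℕ →ₐ[ℂ] ℂ := MvPolynomial.aeval fun e => if e.IsDiag then 1 else 0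

theorem evalOne_entry (a b : ℕ) : evalOne (entry a b) = if a = b then 1 else 0 := by
  simp [evalOne, entry]

theorem evalOne_minor (p : ℕ) : evalOne (minor p) = 1 := by
  rw [minor, AlgHom.map_det]
  have : evalOne.mapMatrix (genericMatrix p) = 1 := by
    ext i j
    simp [genericMatrix, evalOne_entry, Matrix.one_apply, Fin.ext_iff]
  rw [this, Matrix.det_one]

/-- A product of leading principal minors. -/
def minors (s : Multiset ℕ) : SymPoly ℕ := (s.map minor).prod

theorem minors_zero : minors 0 = 1 := by simp [minors]

theorem minors_cons (p : ℕ) (s : Multiset ℕ) : minors (p ::ₘ s) = minor p * minors s := by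
  simp [minors]

theorem minors_add (s t : Multiset ℕ) : minors (s + t) = minors s * minors t := by
  simp [minors]

theorem minors_replicate (p k : ℕ) : minors (Multiset.replicate k p) = minor p ^ k := by
  simp [minors]

theorem evalOne_minors (s : Multiset ℕ) : evalOne (minors s) = 1 := by
  induction s using Multiset.induction_on with
  | empty => rw [minors_zero, map_one]
  | cons p s ih => rw [minors_cons, map_mul, ih, evalOne_minor, one_mul]

theorem minors_ne_zero (s : Multiset ℕ) : minors s ≠ 0 := by
  intro h
  have := evalOne_minors s
  rw [h, map_zero] at this
  exact zero_ne_one this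

theorem minor_ne_zero (p : ℕ) : minor p ≠ 0 := by
  have := minors_ne_zero {p}
  rwa [← Multiset.replicate_one, minors_replicate, pow_one] at this

theorem minors_eq_one {s : Multiset ℕ} (h : ∀ p ∈ s, p = 0) : minors s = 1 := by
  induction s using Multiset.induction_on with
  | empty => exact minors_zero
  | cons p s ih =>
    rw [minors_cons, ih fun q hq => h q (Multiset.mem_cons_of_mem hq),
      h p (Multiset.mem_cons_self p s), minor_zero, one_mul]

/-- A highest weight vector: all raising operators vanish. -/
def IsHighest (f : SymPoly ℕ) : Prop := ∀ s t : ℕ, s < t → polar s t f = 0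

theorem isHighest_minors (s : Multiset ℕ) : IsHighest (minors s) := by
  intro c q h
  induction s using Multiset.induction_on with
  | empty => rw [minors_zero, Derivation.map_one_eq_zero]
  | cons p s ih => rw [minors_cons, Derivation.leibniz, ih, polar_minor_eq_zero h]; simp

theorem polar_self_minor (p a : ℕ) :
    polar a a (minor p) = (if a < p then 2 else 0 : ℂ) • minor p := by
  by_cases h : a < p
  · rw [polar_minor_of_lt h h, if_pos rfl, if_pos h]
  · rw [polar_of_grad_eq_zero (grad_minor_of_le (by omega)), if_neg h, zero_smul]

theorem polar_self_minors (s : Multiset ℕ) (a : ℕ) :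
    polar a a (minors s) = (2 * ((s.filter (a < ·)).card : ℂ)) • minors s := by
  induction s using Multiset.induction_on with
  | empty => simp [minors_zero]
  | cons p s ih =>
    rw [minors_cons, Derivation.leibniz, ih, polar_self_minor]
    by_cases h : a < p
    · rw [if_pos h, Multiset.filter_cons_of_pos _ h, Multiset.card_cons]
      simp only [smul_eq_mul, MvPolynomial.smul_eq_C_mul, Nat.cast_add, Nat.cast_one, map_add,
        map_mul, map_one]
      ring
    · rw [if_neg h, Multiset.filter_cons_of_neg _ h]
      simp

theorem grad_minors_eq_zero {s : Multiset ℕ} {a : ℕ} (h : ∀ p ∈ s, p ≤ a) :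
    grad a (minors s) = 0 := by
  induction s using Multiset.induction_on with
  | empty => rw [minors_zero, Derivation.map_one_eq_zero]
  | cons p s ih =>
    rw [minors_cons, Derivation.leibniz, ih fun q hq => h q (Multiset.mem_cons_of_mem hq),
      grad_minor_of_le (h p (Multiset.mem_cons_self p s))]
    simp

/-! ### The second order operators on products of minors -/

/-- Only indices below `p` matter, and moving `grad` to the left of the polarizations costs p + 1
copies of `grad a f b`. Polarizations then act first, where they are known on minors. -/
theorem second_eq_grad_polar (r : ℂ) {p a : ℕ} (b : ℕ) {f : SymPoly ℕ}
    (hf : ∀ c, p ≤ c → grad c f = 0) (ha : a < p) :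
    second r a b f = (r - p - 1) • grad a f b + ∑ c ∈ range p, grad a (polar c b f) c := by
  have hS : (grad a f).support ⊆ range p := by
    intro c hc
    rw [mem_range]
    by_contra h
    rw [Finsupp.mem_support_iff, grad_comm, hf c (by omega)] at hc
    exact hc rfl
  rw [second_eq_sum r a b f hS]
  have h : ∑ c ∈ range p, grad a (polar c b f) c
      = ∑ c ∈ range p, polar c b (grad a f c) + (1 + p : ℂ) • grad a f b := by
    simp only [grad_polar, sum_add_distrib, if_true, sum_const, card_range]
    rw [sum_ite_eq, if_pos (mem_range.mpr ha), add_smul, one_smul, Nat.cast_smul_eq_nsmul]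
  rw [h]
  module

/-- With p = n + 1 in `second_eq_grad_polar`, raising operators remove all terms with c < n, and the
term c = n contributes the weight. -/
theorem second_highest (r : ℂ) {n : ℕ} {lam : ℂ} {f : SymPoly ℕ} (hf : IsHighest f)
    (hlam : polar n n f = lam • f) (hg : ∀ c, n < c → grad c f = 0) :
    second r n n f = (r - n - 2 + lam) • grad n f n := by
  rw [second_eq_grad_polar r n (p := n + 1) (fun c hc => hg c hc) (Nat.lt_succ_self n),
    sum_range_succ, hlam, sum_eq_zero]
  · rw [Derivation.map_smul, Finsupp.smul_apply]
    push_cast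
    module
  · intro c hc
    rw [hf c n (mem_range.mp hc)]
    simp

theorem grad_top_minors {n k : ℕ} {s : Multiset ℕ} (hs : ∀ p ∈ s, p ≤ n) :
    grad n (minor (n + 1) ^ (k + 1) * minors s) n
      = (2 * ((k : ℂ) + 1)) • (minor n * minor (n + 1) ^ k * minors s) := by
  rw [← gradAt_apply, Derivation.leibniz, Derivation.leibniz_pow, gradAt_apply, gradAt_apply,
    grad_minors_eq_zero hs, grad_minor_last]
  simp only [Finsupp.zero_apply, Nat.add_sub_cancel, smul_eq_mul,
    mul_smul_comm, nsmul_eq_mul]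
  rw [mul_smul, MvPolynomial.smul_eq_C_mul, MvPolynomial.smul_eq_C_mul,
    MvPolynomial.smul_eq_C_mul]
  push_cast
  simp only [map_add, map_one, map_natCast]
  ring

theorem pow_mul_minors (p k : ℕ) (s : Multiset ℕ) :
    minor p ^ k * minors s = minors (Multiset.replicate k p + s) := by
  rw [minors_add, minors_replicate]

theorem card_filter_top {n k : ℕ} {s : Multiset ℕ} (hs : ∀ p ∈ s, p ≤ n) :
    ((Multiset.replicate k (n + 1) + s).filter (n < ·)).card = k := by
  rw [Multiset.filter_add, Multiset.filter_eq_nil.mpr fun p hp => not_lt.mpr (hs p hp),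
    Multiset.filter_eq_self.mpr fun p hp => by rw [Multiset.eq_of_mem_replicate hp]; omega]
  simp

/-- Since 2(k + 1) ≠ 0, the scalar vanishes exactly when r = 1 - 2(k + 1) + (n + 1); this is where
the condition on `r` originates. -/
theorem second_top_minors (r : ℂ) {n k : ℕ} {s : Multiset ℕ} (hs : ∀ p ∈ s, p ≤ n) :
    second r n n (minor (n + 1) ^ (k + 1) * minors s)
      = ((r - n - 2 + 2 * ((k : ℂ) + 1)) * (2 * ((k : ℂ) + 1))) •
        (minor n * minor (n + 1) ^ k * minors s) := by
  rw [second_highest r (lam := 2 * ((k : ℂ) + 1)), grad_top_minors hs, smul_smul]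
  · rw [pow_mul_minors]; exact isHighest_minors _
  · rw [pow_mul_minors, polar_self_minors, card_filter_top hs]
    push_cast
    rfl
  · intro c hc
    rw [pow_mul_minors]
    apply grad_minors_eq_zero
    intro p hp
    rcases Multiset.mem_add.mp hp with hp | hp
    · rw [Multiset.eq_of_mem_replicate hp]; exact hc
    · exact (hs p hp).trans hc.le

theorem grad_pow_minor_eq_zero {p c : ℕ} (ν : ℕ) (h : p ≤ c) : grad c (minor p ^ ν) = 0 := by
  rw [← minors_replicate]
  exact grad_minors_eq_zero fun q hq => by rw [Multiset.eq_of_mem_replicate hq]; exact h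

theorem polar_pow_minor {p c q : ℕ} (ν : ℕ) (hc : c < p) (hq : q < p) :
    polar c q (minor p ^ ν) = if c = q then (2 * (ν : ℂ)) • minor p ^ ν else 0 := by
  rcases ν with - | ν
  · simp
  · rw [Derivation.leibniz_pow, polar_minor_of_lt hc hq]
    split_ifs
    · simp only [Nat.add_sub_cancel, smul_eq_mul, mul_smul_comm, ← pow_succ]
      rw [← Nat.cast_smul_eq_nsmul ℂ, smul_smul, mul_comm]
    · simp

/-- Inside the block of size `p`, a power of the determinant is an eigenvector of diagonal
polarizations and is killed by the others, so the operator becomes r - p - 1 + 2ν times a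
derivative. -/
theorem second_pow_minor (r : ℂ) {p ν : ℕ} (h : r = 1 - 2 * ν + p) (a b : ℕ) :
    second r a b (minor p ^ ν) = 0 := by
  by_cases ha : p ≤ a
  · exact second_of_grad_eq_zero r a b (grad_pow_minor_eq_zero ν ha)
  by_cases hb : p ≤ b
  · rw [second_comm]
    exact second_of_grad_eq_zero r b a (grad_pow_minor_eq_zero ν hb)
  rw [not_le] at ha hb
  rw [second_eq_grad_polar r b (fun c hc => grad_pow_minor_eq_zero ν hc) ha,
    sum_eq_single b]
  · rw [polar_pow_minor ν hb hb, if_pos rfl, Derivation.map_smul, Finsupp.smul_apply, h]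
    module
  · intro c hc hcb
    rw [polar_pow_minor ν (mem_range.mp hc) hb, if_neg hcb]
    simp
  · intro hb'
    exact absurd (mem_range.mpr hb) hb'

end Minors

/-! ### Weights -/

section Weights

open Finsupp MvPolynomial

/-- The weight of an entry of the generic symmetric matrix. -/
def entryWeight : Sym2 ℕ → (ℕ →₀ ℕ) :=
  Sym2.lift ⟨fun a b => single a 1 + single b 1, fun _ _ => add_comm _ _⟩

theorem entryWeight_mk (a b : ℕ) : entryWeight s(a, b) = single a 1 + single b 1 := rfl

theorem coeff_polar_self (a : ℕ) (f : SymPoly ℕ) (m : Sym2 ℕ →₀ ℕ) :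
    coeff m (polar a a f) = (weight entryWeight m a : ℂ) * coeff m f := by
  induction f using symPoly_induction generalizing m with
  | h1 =>
    rw [Derivation.map_one_eq_zero, coeff_zero, coeff_one]
    by_cases h : 0 = m
    · subst h; simp
    · simp [h]
  | hs t f hf => simp only [Derivation.map_smul, coeff_smul, hf, smul_eq_mul]; ring
  | ha f g hf hg => simp only [map_add, coeff_add, hf, hg]; ring
  | hx c e f hf =>
    have h1 : polar a a (entry c e * f)
        = entry c e * polar a a f + (entryWeight s(c, e) a : ℂ) • (entry c e * f) := by
      rw [polar_entry_mul, entryWeight_mk, Finsupp.add_apply, single_apply, single_apply]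
      congr 1
      rcases eq_or_ne c e with rfl | h
      · by_cases h1 : a = c
        · subst h1; simp [two_smul]
        · simp [h1, Ne.symm h1]
      · by_cases h1 : a = c
        · subst h1; simp [h, h.symm]
        · by_cases h2 : a = e
          · subst h2; simp [h, h1, entry_comm]
          · simp [h1, h2, Ne.symm h1, Ne.symm h2]
    rw [h1, coeff_add, coeff_smul, entry, coeff_X_mul', coeff_X_mul', hf, smul_eq_mul]
    by_cases h : s(c, e) ∈ m.support
    · rw [if_pos h, if_pos h]
      have h2 : m = (m - single s(c, e) 1) + single s(c, e) 1 := by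
        rw [tsub_add_cancel_of_le]
        rw [Finsupp.single_le_iff]
        exact Nat.one_le_iff_ne_zero.mpr (Finsupp.mem_support_iff.mp h)
      conv_rhs => rw [h2]
      rw [map_add, weight_single, one_smul, Finsupp.add_apply]
      simp only [add_tsub_cancel_right]
      push_cast
      ring
    · rw [if_neg h, if_neg h]; simp

/-- `f` is homogeneous of weight `lam`. -/
def HasWeight (f : SymPoly ℕ) (lam : ℕ →₀ ℕ) : Prop := IsWeightedHomogeneous entryWeight f lam

theorem HasWeight.polar_self {f : SymPoly ℕ} {lam : ℕ →₀ ℕ} (h : HasWeight f lam) (a : ℕ) :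
    polar a a f = (lam a : ℂ) • f := by
  ext m
  rw [coeff_polar_self, coeff_smul, smul_eq_mul]
  by_cases hm : coeff m f = 0
  · rw [hm, mul_zero, mul_zero]
  · rw [h hm]

theorem coeff_eq_zero_of_polar_self {f : SymPoly ℕ} {a : ℕ} {x : ℂ} (h : polar a a f = x • f)
    {m : Sym2 ℕ →₀ ℕ} (hm : coeff m f ≠ 0) : (weight entryWeight m a : ℂ) = x := by
  have h1 := coeff_polar_self a f m
  rw [h, coeff_smul, smul_eq_mul] at h1
  exact (mul_right_cancel₀ hm h1).symm

theorem hasWeight_of_polar_self {f : SymPoly ℕ} {lam : ℕ →₀ ℕ}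
    (h : ∀ a, polar a a f = (lam a : ℂ) • f) : HasWeight f lam := by
  intro m hm
  ext a
  exact_mod_cast coeff_eq_zero_of_polar_self (h a) hm

theorem HasWeight.sub {f g : SymPoly ℕ} {lam : ℕ →₀ ℕ} (hf : HasWeight f lam)
    (hg : HasWeight g lam) : HasWeight (f - g) lam :=
  hasWeight_of_polar_self fun a => by
    rw [map_sub, hf.polar_self, hg.polar_self, smul_sub]

/-- The relations of matrix units in gl_∞, checked on entries since both sides are derivations. -/
theorem polar_polar (a b c d : ℕ) (f : SymPoly ℕ) : polar a b (polar c d f) =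
    polar c d (polar a b f)
      + ((if b = c then polar a d f else 0) - (if a = d then polar c b f else 0)) := by
  have : ⁅polar a b, polar c d⁆
      = (if b = c then polar a d else 0) - (if a = d then polar c b else 0) :=
    symPoly_derivation_ext fun e g => by
      have h2 : ∀ (p : Prop) [Decidable p] (D : Derivation ℂ (SymPoly ℕ) (SymPoly ℕ))
          (x : SymPoly ℕ), (if p then D else 0) x = if p then D x else 0 := by
        intro p _ D x; split_ifs <;> simp
      rw [Derivation.commutator_apply, Derivation.sub_apply, h2, h2]
      simp only [polar_entry, map_add, apply_ite (polar a b), apply_ite (polar c d), map_zero]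
      by_cases h3 : d = e <;> by_cases h4 : d = g <;> by_cases h5 : b = c <;> by_cases h6 : a = d
        <;> by_cases h7 : b = e <;> by_cases h8 : b = g <;>
        simp only [h3, h4, h5, h6, h7, h8, if_true, if_false] <;> grind [entry_comm]
  have h := DFunLike.congr_fun this f
  rw [Derivation.commutator_apply, sub_eq_iff_eq_add', Derivation.sub_apply] at h
  rw [h]
  congr 2 <;> split_ifs <;> rfl

theorem HasWeight.weight_of_coeff_polar {f : SymPoly ℕ} {lam : ℕ →₀ ℕ} (h : HasWeight f lam)
    {s t : ℕ} {m : Sym2 ℕ →₀ ℕ} (hm : coeff m (polar s t f) ≠ 0) :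
    weight entryWeight m + single t 1 = lam + single s 1 := by
  ext a
  have h1 : polar a a (polar s t f)
      = ((lam a : ℂ) + ((if a = s then 1 else 0) - (if a = t then 1 else 0))) • polar s t f := by
    rw [polar_polar, h.polar_self, Derivation.map_smul, add_smul, sub_smul]
    congr 2
    · split_ifs with h
      · rw [h, one_smul]
      · rw [zero_smul]
    · split_ifs with h
      · rw [h, one_smul]
      · rw [zero_smul]
  have h2 := coeff_eq_zero_of_polar_self h1 hm
  rw [Finsupp.add_apply, Finsupp.add_apply, single_apply, single_apply]
  have h3 : ((weight entryWeight m a + (if t = a then 1 else 0) : ℕ) : ℂ)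
      = ((lam a + (if s = a then 1 else 0) : ℕ) : ℂ) := by
    push_cast
    rw [h2]
    simp only [eq_comm (a := s), eq_comm (a := t)]
    ring
  exact_mod_cast h3

theorem HasWeight.polar {f : SymPoly ℕ} {lam lam' : ℕ →₀ ℕ} (h : HasWeight f lam) {s t : ℕ}
    (hl : lam' + single t 1 = lam + single s 1) : HasWeight (polar s t f) lam' := by
  intro m hm
  have := h.weight_of_coeff_polar hm
  rw [← hl] at this
  exact add_right_cancel this

theorem HasWeight.polar_eq_zero {f : SymPoly ℕ} {lam : ℕ →₀ ℕ} (h : HasWeight f lam) {s t : ℕ}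
    (hst : s ≠ t) (hl : lam t = 0) : NiiboriSagaki.polar s t f = 0 := by
  ext m
  rw [coeff_zero]
  by_contra hm
  have := DFunLike.congr_fun (h.weight_of_coeff_polar hm) t
  simp [hl, hst] at this

/-- The component of weight `lam`. -/
def weightComponent (lam : ℕ →₀ ℕ) : SymPoly ℕ →ₗ[ℂ] SymPoly ℕ :=
  weightedHomogeneousComponent entryWeight lam

theorem coeff_weightComponent (lam : ℕ →₀ ℕ) (f : SymPoly ℕ) (m : Sym2 ℕ →₀ ℕ) :
    coeff m (weightComponent lam f) = if weight entryWeight m = lam then coeff m f else 0 :=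
  coeff_weightedHomogeneousComponent _ _ _

theorem hasWeight_weightComponent (lam : ℕ →₀ ℕ) (f : SymPoly ℕ) :
    HasWeight (weightComponent lam f) lam :=
  weightedHomogeneousComponent_isWeightedHomogeneous _ _

theorem mem_of_weightComponent_mem {W : Submodule ℂ (SymPoly ℕ)} {f : SymPoly ℕ}
    (h : ∀ lam, weightComponent lam f ∈ W) : f ∈ W := by
  rw [← finsum_weightedHomogeneousComponent entryWeight f]
  exact finsum_induction (· ∈ W) W.zero_mem (fun _ _ => W.add_mem) h

theorem weightComponent_mem {W : Submodule ℂ (SymPoly ℕ)}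
    (hW : ∀ a, ∀ f ∈ W, polar a a f ∈ W) {f : SymPoly ℕ} (hf : f ∈ W) (lam : ℕ →₀ ℕ) :
    weightComponent lam f ∈ W := by
  classical
  -- `S` collects the weights already removed, while the component of weight `lam` stays untouched.
  have key : ∀ S : Finset (ℕ →₀ ℕ), lam ∉ S → ∃ g ∈ W, ∀ m,
      (weight entryWeight m = lam → coeff m g = coeff m f) ∧
      (weight entryWeight m ∈ S → coeff m g = 0) ∧ (coeff m f = 0 → coeff m g = 0) := by
    intro S
    induction S using Finset.induction_on with
    | empty => exact fun _ => ⟨f, hf, fun m => ⟨fun _ => rfl, by simp, id⟩⟩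
    | insert κ S _ ih =>
      intro hl
      rw [Finset.mem_insert, not_or] at hl
      obtain ⟨g, hg, hgm⟩ := ih hl.2
      obtain ⟨a, ha⟩ : ∃ a, lam a ≠ κ a := by
        by_contra h
        push Not at h
        exact hl.1 (Finsupp.ext h)
      have hne : (lam a : ℂ) - κ a ≠ 0 := sub_ne_zero.mpr (by exact_mod_cast ha)
      -- A Lagrange factor: on components whose weight at `a` is x it acts by (x - κ a) / (lam a - κ
      -- a), thus by 0 on weight κ and by 1 on weight lam.
      refine ⟨((lam a : ℂ) - κ a)⁻¹ • (NiiboriSagaki.polar a a g - (κ a : ℂ) • g),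
        W.smul_mem _ (W.sub_mem (hW a g hg) (W.smul_mem _ hg)), fun m => ?_⟩
      have hc : coeff m (((lam a : ℂ) - κ a)⁻¹ • (NiiboriSagaki.polar a a g - (κ a : ℂ) • g))
          = ((lam a : ℂ) - κ a)⁻¹ * ((weight entryWeight m a : ℂ) - κ a) * coeff m g := by
        rw [coeff_smul, coeff_sub, coeff_smul, coeff_polar_self]
        simp only [smul_eq_mul]
        ring
      rw [hc]
      refine ⟨fun h => ?_, fun h => ?_, fun h => ?_⟩
      · rw [h, inv_mul_cancel₀ hne, one_mul, (hgm m).1 h]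
      · rcases Finset.mem_insert.mp h with h | h
        · rw [h, sub_self, mul_zero, zero_mul]
        · rw [(hgm m).2.1 h, mul_zero]
      · rw [(hgm m).2.2 h, mul_zero]
  obtain ⟨g, hg, hgm⟩ := key ((f.support.image (weight entryWeight)).erase lam)
    (Finset.notMem_erase _ _)
  have : weightComponent lam f = g := by
    ext m
    rw [coeff_weightComponent]
    split_ifs with h
    · exact ((hgm m).1 h).symm
    · by_cases hm : coeff m f = 0
      · exact ((hgm m).2.2 hm).symm
      · refine ((hgm m).2.1 (Finset.mem_erase.mpr ⟨h, Finset.mem_image.mpr ⟨m, ?_, rfl⟩⟩)).symm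
        exact MvPolynomial.mem_support_iff.mpr hm
  rwa [this]

end Weights

/-! ### Restriction to diagonal matrices -/

section Diagonal

open Finsupp MvPolynomial

theorem diag_injective : Function.Injective (Sym2.diag : ℕ → Sym2 ℕ) := Sym2.diag_injective

/-- The restriction of a polynomial to diagonal matrices. -/
def restrictDiag : SymPoly ℕ →ₐ[ℂ] MvPolynomial ℕ ℂ :=
  aeval (Sym2.lift ⟨fun a b => if a = b then X a else 0, fun a b => by
    by_cases h : a = b
    · subst h; rfl
    · simp [h, Ne.symm h]⟩)

theorem restrictDiag_entry (a b : ℕ) : restrictDiag (entry a b) = if a = b then X a else 0 := by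
  simp [restrictDiag, entry]

theorem coeff_restrictDiag (f : SymPoly ℕ) (k : ℕ →₀ ℕ) :
    coeff k (restrictDiag f) = coeff (k.mapDomain Sym2.diag) f := by
  induction f using symPoly_induction generalizing k with
  | h1 =>
    rw [map_one, coeff_one, coeff_one]
    refine if_congr ?_ rfl rfl
    rw [eq_comm, eq_comm (a := (0 : Sym2 ℕ →₀ ℕ))]
    constructor
    · rintro rfl; exact mapDomain_zero
    · intro h
      exact mapDomain_injective diag_injective (h.trans mapDomain_zero.symm)
  | hs t f hf => simp only [map_smul, coeff_smul, hf]
  | ha f g hf hg => simp only [map_add, coeff_add, hf, hg]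
  | hx a b f hf =>
    rw [map_mul, restrictDiag_entry, entry, coeff_X_mul']
    by_cases h : a = b
    · subst h
      rw [if_pos rfl, coeff_X_mul']
      have h1 : k.mapDomain Sym2.diag s(a, a) = k a := mapDomain_apply diag_injective k a
      refine if_congr ?_ ?_ rfl
      · rw [Finsupp.mem_support_iff, Finsupp.mem_support_iff, h1]
      · rw [hf]
        congr 1
        ext e
        by_cases he : e ∈ Set.range Sym2.diag
        · obtain ⟨c, rfl⟩ := he
          rw [mapDomain_apply diag_injective, Finsupp.tsub_apply, Finsupp.tsub_apply,
            mapDomain_apply diag_injective, single_apply, single_apply]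
          congr 1
          exact if_congr (diag_injective.eq_iff (a := a) (b := c)).symm rfl rfl
        · rw [Finsupp.tsub_apply, mapDomain_of_notMem_range _ _ he, mapDomain_of_notMem_range _ _ he,
            zero_tsub]
    · rw [if_neg h, zero_mul, coeff_zero, if_neg]
      rw [Finsupp.mem_support_iff, not_not]
      apply mapDomain_of_notMem_range
      rintro ⟨c, hc⟩
      have : s(c, c) = s(a, b) := hc
      rw [Sym2.eq_iff] at this
      grind

end Diagonal

/-! ### Classification of highest weight vectors -/

section HighestWeight

open Finsupp MvPolynomial

/-- The degree of a monomial in the off-diagonal entries. -/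
def offDegree : (Sym2 ℕ →₀ ℕ) →+ ℕ := weight fun e => if e.IsDiag then 0 else 1

theorem offDegree_single (e : Sym2 ℕ) (k : ℕ) :
    offDegree (single e k) = k * if e.IsDiag then 0 else 1 := by
  simp [offDegree, weight_single]

/-- A derivation that does not lower the off-diagonal degree of any variable cannot produce a
monomial below the minimal off-diagonal degree of `f`. -/
theorem exists_offDegree_le {g : Sym2 ℕ → SymPoly ℕ}
    (hg : ∀ e, ∀ j ∈ (g e).support, offDegree (single e 1) ≤ offDegree j)
    {f : SymPoly ℕ} {m : Sym2 ℕ →₀ ℕ} (hm : coeff m (mkDerivation ℂ g f) ≠ 0) :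
    ∃ n ∈ f.support, offDegree n ≤ offDegree m := by
  classical
  rw [f.as_sum, map_sum, coeff_sum] at hm
  obtain ⟨n, hn, h1⟩ := Finset.exists_ne_zero_of_sum_ne_zero hm
  refine ⟨n, hn, ?_⟩
  rw [mkDerivation_monomial, Finsupp.sum, coeff_smul, coeff_sum] at h1
  obtain ⟨e, he, h2⟩ := Finset.exists_ne_zero_of_sum_ne_zero (right_ne_zero_of_mul h1)
  rw [smul_eq_mul] at h2
  obtain ⟨j, hj, k, hk, h3⟩ := Finset.mem_add.mp (support_mul _ _ (MvPolynomial.mem_support_iff.mpr h2))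
  have hj' : j = n - single e 1 := by
    simpa using support_monomial_subset hj
  have hn' : n = (n - single e 1) + single e 1 := by
    rw [tsub_add_cancel_of_le]
    rw [Finsupp.single_le_iff]
    exact Nat.one_le_iff_ne_zero.mpr (Finsupp.mem_support_iff.mp he)
  have h4 := hg e k hk
  change j + k = m at h3
  rw [← h3, hn', map_add, map_add, hj']
  omega

/-- Geometrically, `f` is invariant under unipotent congruences, and these move diagonal matrices
onto a dense set. The proof is infinitesimal: some raising operator acts nontrivially on a monomial
of least off-diagonal degree. -/
theorem IsHighest.eq_zero {f : SymPoly ℕ} (hf : IsHighest f) (hd : restrictDiag f = 0) : f = 0 := by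
  classical
  by_contra hne
  obtain ⟨m, hm, hmin⟩ := Finset.exists_min_image f.support offDegree
    (Finset.nonempty_iff_ne_empty.mpr fun h => hne (support_eq_empty.mp h))
  have hm0 : coeff m f ≠ 0 := MvPolynomial.mem_support_iff.mp hm
  obtain ⟨e, he, hed⟩ : ∃ e ∈ m.support, ¬ e.IsDiag := by
    by_contra h
    push Not at h
    have h1 : (m.support : Set (Sym2 ℕ)) ⊆ Set.range Sym2.diag := fun e he => by
      have := h e he
      induction e with
      | _ a b => exact ⟨a, by rw [Sym2.mk_isDiag_iff] at this; rw [this]; rfl⟩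
    rw [← mapDomain_comapDomain _ diag_injective m h1] at hm0
    rw [← coeff_restrictDiag, hd, coeff_zero] at hm0
    exact hm0 rfl
  obtain ⟨s, t, hst, rfl⟩ : ∃ s t : ℕ, s < t ∧ e = s(s, t) := by
    induction e with
    | _ a b =>
      rw [Sym2.mk_isDiag_iff] at hed
      rcases lt_or_gt_of_ne hed with h | h
      · exact ⟨a, b, h, rfl⟩
      · exact ⟨b, a, h, Sym2.eq_swap⟩
  -- The raising operator is split as x_{ss} ∂/∂x_{st} plus a part that never lowers the
  -- off-diagonal degree.
  let B : Sym2 ℕ → SymPoly ℕ := fun e => if e = s(s, t) then 0 else polar s t (X e)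
  have hB : polar s t = entry s s • pderiv s(s, t) + mkDerivation ℂ B := by
    apply MvPolynomial.derivation_ext
    intro e
    rw [Derivation.add_apply, Derivation.smul_apply, mkDerivation_X]
    by_cases h : e = s(s, t)
    · subst h
      simp only [B, if_true, pderiv_X_self]
      change polar s t (entry s t) = _
      simp [polar_entry, hst.ne']
    · simp [B, h, pderiv_X_of_ne h]
  -- The image of `m` when one x_{st} becomes x_{ss}. Its off-diagonal degree is below the minimum,
  -- so no other part of the operator reaches it.
  let m' := m - single s(s, t) 1 + single s(s, s) 1
  have hmm : m = (m - single s(s, t) 1) + single s(s, t) 1 := by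
    rw [tsub_add_cancel_of_le]
    rw [Finsupp.single_le_iff]
    exact Nat.one_le_iff_ne_zero.mpr (Finsupp.mem_support_iff.mp he)
  have hoff : offDegree m' < offDegree m := by
    rw [hmm]
    simp only [m', map_add, offDegree_single]
    simp [hst.ne]
  have h1 := hf s t hst
  rw [hB, Derivation.add_apply, Derivation.smul_apply, smul_eq_mul] at h1
  have h2 : coeff m' (mkDerivation ℂ B f) = 0 := by
    by_contra h
    have hg : ∀ e, ∀ j ∈ (B e).support, offDegree (single e 1) ≤ offDegree j := by
      intro e j hj
      simp only [B] at hj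
      split_ifs at hj with h'
      · simp at hj
      · induction e with
        | _ a b =>
          change j ∈ (polar s t (entry a b)).support at hj
          rw [polar_entry] at hj
          have key : ∀ c, c ≠ s → j ∈ (entry s c).support →
              offDegree (single s(a, b) 1) ≤ offDegree j := by
            intro c hc h
            rw [entry, support_X, Finset.mem_singleton] at h
            have hd : ¬ s(s, c).IsDiag := by simpa using hc.symm
            rw [h, offDegree_single, offDegree_single, if_neg hd]
            split_ifs <;> simp
          rcases Finset.mem_union.mp (MvPolynomial.support_add hj) with hj | hj
          · split_ifs at hj with hta
            · exact key b (fun hb => h' (by rw [hb, hta, Sym2.eq_swap])) hj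
            · simp at hj
          · split_ifs at hj with htb
            · exact key a (fun ha => h' (by rw [ha, htb])) hj
            · simp at hj
    obtain ⟨n, hn, hn'⟩ := exists_offDegree_le hg h
    have := hmin n hn
    omega
  have h3 := congrArg (coeff m') h1
  rw [coeff_add, h2, add_zero, coeff_zero, entry, mul_comm, coeff_mul_X, coeff_pderiv, ← hmm] at h3
  have h4 : (((m - single s(s, t) 1 : Sym2 ℕ →₀ ℕ) s(s, t) : ℂ) + 1) ≠ 0 :=
    Nat.cast_add_one_ne_zero _
  exact mul_ne_zero hm0 h4 h3

/-! ### Weights and uniqueness of highest weight vectors -/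

/-- Half of the weight of a product of leading principal minors. -/
def colSum (s : Multiset ℕ) : ℕ →₀ ℕ := (s.map fun p => ∑ i ∈ Finset.range p, single i 1).sum

theorem colSum_apply (s : Multiset ℕ) (a : ℕ) :
    colSum s a = (s.filter (a < ·)).card := by
  induction s using Multiset.induction_on with
  | empty => simp [colSum]
  | cons p s ih =>
    have h : colSum (p ::ₘ s) = ∑ i ∈ Finset.range p, single i 1 + colSum s := by simp [colSum]
    have h' : (∑ i ∈ Finset.range p, (single i 1 : ℕ →₀ ℕ)) a = if a < p then 1 else 0 := by
      rw [Finsupp.finsetSum_apply]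
      simp [single_apply]
    rw [h, Finsupp.add_apply, ih, h']
    by_cases hp : a < p
    · rw [if_pos hp, Multiset.filter_cons_of_pos _ hp, Multiset.card_cons, add_comm]
    · rw [if_neg hp, Multiset.filter_cons_of_neg _ hp, zero_add]

theorem hasWeight_minors (s : Multiset ℕ) : HasWeight (minors s) (2 • colSum s) :=
  hasWeight_of_polar_self fun a => by
    rw [polar_self_minors, Finsupp.smul_apply, colSum_apply]
    simp

theorem weight_mapDomain_diag (k : ℕ →₀ ℕ) :
    weight entryWeight (k.mapDomain Sym2.diag) = 2 • k := by
  induction k using Finsupp.induction_linear with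
  | zero => simp
  | add f g hf hg => rw [mapDomain_add, map_add, hf, hg, smul_add]
  | single a n =>
    rw [mapDomain_single, weight_single]
    change n • (single a 1 + single a 1) = _
    ext b
    simp [single_apply, two_mul]

theorem HasWeight.eq_of_coeff_restrictDiag {f : SymPoly ℕ} {lam : ℕ →₀ ℕ} (h : HasWeight f lam)
    {k : ℕ →₀ ℕ} (hk : coeff k (restrictDiag f) ≠ 0) : 2 • k = lam := by
  rw [coeff_restrictDiag] at hk
  rw [← weight_mapDomain_diag]
  exact h hk

theorem IsHighest.exists_coeff_ne_zero {f : SymPoly ℕ} (hf : IsHighest f) (h : f ≠ 0) :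
    ∃ k, coeff k (restrictDiag f) ≠ 0 := by
  by_contra h'
  push Not at h'
  exact h (hf.eq_zero (MvPolynomial.ext _ _ h'))

/-- The restriction to the diagonal has a single possible monomial, of exponent lam / 2. A suitable
combination of `f` and `g` therefore vanishes on the diagonal, hence is 0. -/
theorem IsHighest.exists_eq_smul {f g : SymPoly ℕ} {lam : ℕ →₀ ℕ} (hf : IsHighest f)
    (hg : IsHighest g) (hfl : HasWeight f lam) (hgl : HasWeight g lam) (h : g ≠ 0) :
    ∃ c : ℂ, f = c • g := by
  obtain ⟨k, hk⟩ := hg.exists_coeff_ne_zero h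
  refine ⟨coeff k (restrictDiag f) / coeff k (restrictDiag g), ?_⟩
  rw [← sub_eq_zero]
  apply IsHighest.eq_zero
  · intro s t hst
    rw [map_sub, Derivation.map_smul, hf s t hst, hg s t hst, smul_zero, sub_zero]
  · ext j
    rw [map_sub, map_smul, coeff_sub, coeff_smul, coeff_zero, smul_eq_mul]
    by_cases hj : j = k
    · rw [hj, div_mul_cancel₀ _ hk, sub_self]
    · have h1 : ∀ p : SymPoly ℕ, HasWeight p lam → coeff j (restrictDiag p) = 0 := by
        intro p hp
        by_contra h'
        apply hj
        have h2 := (hp.eq_of_coeff_restrictDiag h').trans (hgl.eq_of_coeff_restrictDiag hk).symm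
        ext a
        have := DFunLike.congr_fun h2 a
        simpa using this
      rw [h1 f hfl, h1 g hgl, mul_zero, sub_zero]

/-- The sl₂ argument: if the weight increased from q to q + 1, no power of the lowering operator
would kill `f`, since the scalars in `h2` never vanish. -/
theorem IsHighest.weight_antitone {f : SymPoly ℕ} {lam : ℕ →₀ ℕ} (hf : IsHighest f)
    (hfl : HasWeight f lam) (h : f ≠ 0) (q : ℕ) : lam (q + 1) ≤ lam q := by
  by_contra hlt
  rw [not_le] at hlt
  let F : ℕ → SymPoly ℕ := fun k => (⇑(NiiboriSagaki.polar (q + 1) q))^[k] f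
  have hF : ∀ k, F (k + 1) = NiiboriSagaki.polar (q + 1) q (F k) := fun k =>
    Function.iterate_succ_apply' _ _ _
  have h0 : ∀ k, NiiboriSagaki.polar q q (F k) = ((lam q : ℂ) - k) • F k := by
    intro k
    induction k with
    | zero =>
      rw [Nat.cast_zero, sub_zero]
      exact hfl.polar_self q
    | succ k ih =>
      rw [hF, polar_polar, ih, if_neg (by omega), if_pos rfl, Derivation.map_smul]
      push_cast
      module
  have h1 : ∀ k, NiiboriSagaki.polar (q + 1) (q + 1) (F k) = ((lam (q + 1) : ℂ) + k) • F k := by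
    intro k
    induction k with
    | zero =>
      rw [Nat.cast_zero, add_zero]
      exact hfl.polar_self (q + 1)
    | succ k ih =>
      rw [hF, polar_polar, ih, if_pos rfl, if_neg (by omega), Derivation.map_smul]
      push_cast
      module
  have h2 : ∀ k : ℕ, NiiboriSagaki.polar q (q + 1) (F (k + 1))
      = (((k : ℂ) + 1) * (lam q - lam (q + 1) - k)) • F k := by
    intro k
    induction k with
    | zero =>
      rw [hF, polar_polar, if_pos rfl, if_pos rfl, h0, h1]
      change NiiboriSagaki.polar _ _ (NiiboriSagaki.polar _ _ f) + _ = _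
      rw [hf _ _ (Nat.lt_succ_self q), map_zero]
      push_cast
      module
    | succ k ih =>
      rw [hF, polar_polar, if_pos rfl, if_pos rfl, h0, h1, ih, Derivation.map_smul, ← hF]
      push_cast
      module
  have h3 : ∀ k, F k ≠ 0 := by
    intro k
    induction k with
    | zero => exact h
    | succ k ih =>
      intro hk
      have := h2 k
      rw [hk, map_zero, eq_comm, smul_eq_zero] at this
      rcases this with this | this
      · rcases mul_eq_zero.mp this with this | this
        · exact Nat.cast_add_one_ne_zero k this
        · have h4 : (lam q : ℂ) = ((lam (q + 1) + k : ℕ) : ℂ) := by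
            push_cast
            linear_combination this
          have h5 := Nat.cast_injective h4
          omega
      · exact ih this
  -- After lam q + 1 lowerings, a monomial would contain the index `q` exactly -1 times.
  obtain ⟨m, hm⟩ := MvPolynomial.ne_zero_iff.mp (h3 (lam q + 1))
  have h4 := coeff_eq_zero_of_polar_self (h0 (lam q + 1)) hm
  have h5 : ((weight entryWeight m q + 1 : ℕ) : ℂ) = (0 : ℕ) := by
    push_cast at h4 ⊢
    rw [h4]
    ring
  exact absurd (Nat.cast_injective h5) (by omega)

/-- The conjugate partition: the part M + 1 is taken with multiplicity b M - b (M + 1). -/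
theorem exists_colSum_eq {b : ℕ →₀ ℕ} (hb : ∀ q, b (q + 1) ≤ b q) : ∃ s, colSum s = b := by
  obtain ⟨N, hN⟩ : ∃ N, ∀ a, N ≤ a → b a = 0 := by
    refine ⟨b.support.sup id + 1, fun a ha => ?_⟩
    by_contra h
    have := Finset.le_sup (f := id) (Finsupp.mem_support_iff.mpr h)
    simp only [id] at this
    omega
  have key : ∀ M, ∃ s, ∀ a, colSum s a = b a - b (max a M) := by
    intro M
    induction M with
    | zero => exact ⟨0, fun a => by simp [colSum]⟩
    | succ M ih =>
      obtain ⟨s, hs⟩ := ih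
      refine ⟨Multiset.replicate (b M - b (M + 1)) (M + 1) + s, fun a => ?_⟩
      rw [colSum_apply, Multiset.filter_add, Multiset.card_add, ← colSum_apply, ← colSum_apply, hs]
      have : colSum (Multiset.replicate (b M - b (M + 1)) (M + 1)) a
          = if a < M + 1 then b M - b (M + 1) else 0 := by
        rw [colSum_apply]
        split_ifs with h
        · rw [Multiset.filter_eq_self.mpr, Multiset.card_replicate]
          intro p hp
          rwa [Multiset.eq_of_mem_replicate hp]
        · rw [Multiset.filter_eq_nil.mpr, Multiset.card_zero]
          intro p hp
          rwa [Multiset.eq_of_mem_replicate hp]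
      rw [this]
      have hanti : Antitone b := antitone_nat_of_succ_le hb
      split_ifs with h
      · rw [max_eq_right (show a ≤ M by omega), max_eq_right (show a ≤ M + 1 by omega)]
        have h1 := hb M
        have h2 := hanti (show a ≤ M by omega)
        omega
      · rw [max_eq_left (show M ≤ a by omega), max_eq_left (show M + 1 ≤ a by omega)]
        omega
  obtain ⟨s, hs⟩ := key N
  refine ⟨s, Finsupp.ext fun a => ?_⟩
  rw [hs, hN (max a N) (le_max_right _ _), Nat.sub_zero]

/-- A highest weight vector is a multiple of a product of leading principal minors. -/
theorem IsHighest.exists_minors {f : SymPoly ℕ} {lam : ℕ →₀ ℕ} (hf : IsHighest f)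
    (hfl : HasWeight f lam) (h : f ≠ 0) :
    ∃ (s : Multiset ℕ) (c : ℂ), c ≠ 0 ∧ 2 • colSum s = lam ∧ f = c • minors s := by
  obtain ⟨k, hk⟩ := hf.exists_coeff_ne_zero h
  have hkl := hfl.eq_of_coeff_restrictDiag hk
  -- The weight is twice the exponent `k` of a diagonal monomial, so `k` inherits the monotonicity
  -- and is the conjugate of a partition.
  obtain ⟨s, rfl⟩ : ∃ s, colSum s = k := exists_colSum_eq fun q => by
    have := hf.weight_antitone hfl h q
    rw [← hkl] at this
    simpa using this
  obtain ⟨c, hc⟩ := hf.exists_eq_smul (isHighest_minors s) hfl (hkl ▸ hasWeight_minors s)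
    (minors_ne_zero s)
  refine ⟨s, c, ?_, hkl, hc⟩
  rintro rfl
  rw [zero_smul] at hc
  exact h hc

end HighestWeight

/-! ### The Fischer inner product -/

section Fischer

open MvPolynomial

/-- The squared norm of an entry of the generic symmetric matrix. -/
def entryNorm (e : Sym2 ℕ) : ℕ := if e.IsDiag then 2 else 1

/-- The squared norm of a monomial. -/
def monomialNorm (m : Sym2 ℕ →₀ ℕ) : ℕ := m.prod fun e k => k.factorial * entryNorm e ^ k

theorem entryNorm_pos (e : Sym2 ℕ) : 0 < entryNorm e := by
  unfold entryNorm
  split_ifs <;> simp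

theorem monomialNorm_pos (m : Sym2 ℕ →₀ ℕ) : 0 < monomialNorm m :=
  Finset.prod_pos fun e _ => Nat.mul_pos (Nat.factorial_pos _) (Nat.pow_pos (entryNorm_pos e))

theorem monomialNorm_add_single (m : Sym2 ℕ →₀ ℕ) (e : Sym2 ℕ) :
    monomialNorm (m + Finsupp.single e 1) = monomialNorm m * ((m e + 1) * entryNorm e) := by
  classical
  have h1 : m.support ⊆ insert e m.support := Finset.subset_insert _ _
  have h2 : (m + Finsupp.single e 1).support ⊆ insert e m.support := by
    intro j hj
    rw [Finsupp.mem_support_iff, Finsupp.add_apply] at hj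
    by_contra h
    rw [Finset.mem_insert, not_or, Finsupp.notMem_support_iff] at h
    rw [h.2, Finsupp.single_apply, if_neg (Ne.symm h.1)] at hj
    exact hj rfl
  rw [monomialNorm, monomialNorm, Finsupp.prod_of_support_subset _ h1 _ (by simp),
    Finsupp.prod_of_support_subset _ h2 _ (by simp),
    ← Finset.mul_prod_erase _ _ (Finset.mem_insert_self e m.support),
    ← Finset.mul_prod_erase _ _ (Finset.mem_insert_self e m.support)]
  have h3 : ∀ j ∈ (insert e m.support).erase e,
      ((m + Finsupp.single e 1 : Sym2 ℕ →₀ ℕ) j).factorial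
          * entryNorm j ^ (m + Finsupp.single e 1 : Sym2 ℕ →₀ ℕ) j
        = (m j).factorial * entryNorm j ^ m j := by
    intro j hj
    rw [Finsupp.add_apply, Finsupp.single_apply, if_neg (Ne.symm (Finset.ne_of_mem_erase hj)),
      add_zero]
  rw [Finset.prod_congr rfl h3, Finsupp.add_apply, Finsupp.single_eq_same, Nat.factorial_succ,
    pow_succ]
  ring

/-- The Fischer inner product on polynomials in the entries of a symmetric matrix. -/
def fischer (f g : SymPoly ℕ) : ℂ :=
  ∑ m ∈ f.support, (monomialNorm m : ℂ) * (starRingEnd ℂ (coeff m f) * coeff m g)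

theorem fischer_eq_sum {f : SymPoly ℕ} (g : SymPoly ℕ) {S : Finset (Sym2 ℕ →₀ ℕ)}
    (hS : f.support ⊆ S) :
    fischer f g = ∑ m ∈ S, (monomialNorm m : ℂ) * (starRingEnd ℂ (coeff m f) * coeff m g) :=
  Finset.sum_subset hS fun m _ hm => by
    rw [MvPolynomial.notMem_support_iff.mp hm, map_zero, zero_mul, mul_zero]

theorem fischer_conj (f g : SymPoly ℕ) : starRingEnd ℂ (fischer g f) = fischer f g := by
  classical
  rw [fischer_eq_sum f (S := f.support ∪ g.support) Finset.subset_union_right,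
    fischer_eq_sum g (S := f.support ∪ g.support) Finset.subset_union_left, map_sum]
  refine Finset.sum_congr rfl fun m _ => ?_
  rw [map_mul, map_mul, Complex.conj_conj, Complex.conj_natCast, mul_comm (coeff m g)]

theorem fischer_add_right (f g h : SymPoly ℕ) : fischer f (g + h) = fischer f g + fischer f h := by
  simp only [fischer, coeff_add, mul_add, Finset.sum_add_distrib]

theorem fischer_smul_right (t : ℂ) (f g : SymPoly ℕ) : fischer f (t • g) = t * fischer f g := by
  simp only [fischer, coeff_smul, smul_eq_mul, Finset.mul_sum]
  refine Finset.sum_congr rfl fun m _ => ?_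
  ring

theorem fischer_sum_right {ι : Type*} (S : Finset ι) (f : SymPoly ℕ) (g : ι → SymPoly ℕ) :
    fischer f (∑ i ∈ S, g i) = ∑ i ∈ S, fischer f (g i) := by
  simp only [fischer, coeff_sum, Finset.mul_sum]
  exact Finset.sum_comm

theorem fischer_sum_left {ι : Type*} (S : Finset ι) (f : ι → SymPoly ℕ) (g : SymPoly ℕ) :
    fischer (∑ i ∈ S, f i) g = ∑ i ∈ S, fischer (f i) g := by
  rw [← fischer_conj, fischer_sum_right, map_sum]
  exact Finset.sum_congr rfl fun i _ => fischer_conj _ _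

theorem fischer_self (f : SymPoly ℕ) :
    fischer f f = ((∑ m ∈ f.support, (monomialNorm m : ℝ) * ‖coeff m f‖ ^ 2 : ℝ) : ℂ) := by
  rw [fischer, Complex.ofReal_sum]
  refine Finset.sum_congr rfl fun m _ => ?_
  rw [Complex.conj_mul']
  push_cast
  rfl

theorem fischer_self_eq_zero {f : SymPoly ℕ} (h : fischer f f = 0) : f = 0 := by
  rw [fischer_self, Complex.ofReal_eq_zero, Finset.sum_eq_zero_iff_of_nonneg
    fun m _ => by positivity] at h
  rw [← support_eq_empty, Finset.eq_empty_iff_forall_notMem]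
  intro m hm
  rcases mul_eq_zero.mp (h m hm) with h1 | h1
  · exact (monomialNorm_pos m).ne' (by exact_mod_cast h1)
  · exact MvPolynomial.mem_support_iff.mp hm (norm_eq_zero.mp (pow_eq_zero_iff two_ne_zero |>.mp h1))

/-- The Fischer inner product as an inner product space structure. -/
abbrev fischerCore : InnerProductSpace.Core ℂ (SymPoly ℕ) where
  inner := fischer
  conj_inner_symm := fischer_conj
  re_inner_nonneg f := by
    rw [fischer_self]
    exact (Finset.sum_nonneg fun m _ => by positivity : (0 : ℝ) ≤ _).trans_eq
      (Complex.ofReal_re _).symm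
  add_left f g h := by
    rw [← fischer_conj, fischer_add_right, map_add, fischer_conj, fischer_conj]
  smul_left f g t := by
    rw [← fischer_conj, fischer_smul_right, map_mul, fischer_conj]
  definite _ := fischer_self_eq_zero

theorem exists_fischer_orthogonal (W : Submodule ℂ (SymPoly ℕ)) [FiniteDimensional ℂ W]
    (f : SymPoly ℕ) : ∃ w ∈ W, ∀ v ∈ W, fischer v (f - w) = 0 := by
  let : NormedAddCommGroup (SymPoly ℕ) :=
    @InnerProductSpace.Core.toNormedAddCommGroup ℂ _ _ _ _ fischerCore
  let : InnerProductSpace ℂ (SymPoly ℕ) := InnerProductSpace.ofCore fischerCore.toCore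
  refine ⟨W.starProjection f, W.starProjection_apply_mem f, fun v hv => ?_⟩
  exact W.sub_starProjection_mem_orthogonal f v hv

theorem gradAt_eq_smul_pderiv (a b : ℕ) :
    gradAt a b = (entryNorm s(a, b) : ℂ) • pderiv (R := ℂ) s(a, b) :=
  symPoly_derivation_ext fun d e => by
    rw [gradAt_apply, grad_entry_apply, Derivation.smul_apply, entry, entryNorm]
    simp only [Sym2.mk_isDiag_iff]
    by_cases h : s(d, e) = s(a, b)
    · rw [h, pderiv_X_self]
      rw [Sym2.eq_iff] at h
      by_cases hab : a = b
      · subst hab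
        have : a = d ∧ a = e := by grind
        simp [this.1.symm, this.2.symm, two_smul]
      · rcases h with ⟨rfl, rfl⟩ | ⟨rfl, rfl⟩ <;> simp [hab]
    · rw [pderiv_X_of_ne h, smul_zero, if_neg, if_neg, add_zero]
      · rintro ⟨rfl, rfl⟩; exact h Sym2.eq_swap
      · rintro ⟨rfl, rfl⟩; exact h rfl

/-- The norm 2 of diagonal entries is chosen to fit `grad`, which counts diagonal entries twice. -/
theorem fischer_entry_mul (a b : ℕ) (f g : SymPoly ℕ) :
    fischer (entry a b * f) g = fischer f (grad a g b) := by
  rw [← gradAt_apply, gradAt_eq_smul_pderiv, Derivation.smul_apply, entry, mul_comm, fischer,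
    support_mul_X, Finset.sum_map, fischer]
  refine Finset.sum_congr rfl fun m _ => ?_
  rw [addRightEmbedding_apply, coeff_mul_X, coeff_smul, coeff_pderiv, monomialNorm_add_single,
    smul_eq_mul]
  push_cast
  ring

/-- Raising and lowering operators are thus adjoint to each other, which is what the projection
argument needs. -/
theorem fischer_polar (a c : ℕ) (f g : SymPoly ℕ) :
    fischer (polar c a f) g = fischer f (polar a c g) := by
  classical
  rw [polar_eq_sum c a f (S := (grad a f).support ∪ (grad c g).support) Finset.subset_union_left,
    polar_eq_sum a c g (S := (grad a f).support ∪ (grad c g).support) Finset.subset_union_right,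
    fischer_sum_left, fischer_sum_right]
  refine Finset.sum_congr rfl fun e _ => ?_
  rw [fischer_entry_mul, ← fischer_conj f, fischer_entry_mul, fischer_conj]

/-! ### Finiteness of weight spaces -/

/-- The space of polynomials of weight `lam`. -/
def weightSpace (lam : ℕ →₀ ℕ) : Submodule ℂ (SymPoly ℕ) :=
  weightedHomogeneousSubmodule ℂ entryWeight lam

theorem le_weight_entryWeight (m : Sym2 ℕ →₀ ℕ) (a b : ℕ) :
    m s(a, b) ≤ Finsupp.weight entryWeight m a := by
  have h1 : m = (m - Finsupp.single s(a, b) (m s(a, b))) + Finsupp.single s(a, b) (m s(a, b)) := by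
    rw [tsub_add_cancel_of_le]
    rw [Finsupp.single_le_iff]
  conv_rhs => rw [h1]
  rw [map_add, Finsupp.weight_single, entryWeight_mk]
  simp only [Finsupp.add_apply, Finsupp.smul_apply, Finsupp.single_eq_same, smul_eq_mul]
  nlinarith [Nat.zero_le (Finsupp.single b 1 a)]

/-- Each exponent is bounded by the weight at both of its indices, so only variables with indices in
the support of `lam` occur. -/
theorem finite_weight_eq (lam : ℕ →₀ ℕ) :
    {m : Sym2 ℕ →₀ ℕ | Finsupp.weight entryWeight m = lam}.Finite := by
  classical
  refine (Set.finite_Iic (Finsupp.onFinset lam.support.sym2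
    (fun e => if e ∈ lam.support.sym2 then lam.degree else 0)
    (fun e he => by by_contra h; simp [h] at he))).subset ?_
  intro m hm e
  induction e with
  | _ a b =>
  rw [Finsupp.onFinset_apply]
  by_cases h0 : m s(a, b) = 0
  · rw [h0]; exact Nat.zero_le _
  have ha : m s(a, b) ≤ lam a := (hm ▸ le_weight_entryWeight m a b :)
  have hb : m s(a, b) ≤ lam b := by
    rw [Sym2.eq_swap]
    exact (hm ▸ le_weight_entryWeight m b a :)
  rw [if_pos]
  · exact ha.trans (Finsupp.le_degree a lam)
  · rw [Finset.mk_mem_sym2_iff, Finsupp.mem_support_iff, Finsupp.mem_support_iff]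
    omega

instance (lam : ℕ →₀ ℕ) : FiniteDimensional ℂ (weightSpace lam) := by
  have hfin := (finite_weight_eq lam).image (fun m => monomial m (1 : ℂ))
  have := FiniteDimensional.span_of_finite ℂ hfin
  refine Submodule.finiteDimensional_of_le (S₂ := Submodule.span ℂ
    ((fun m => monomial m (1 : ℂ)) '' {m | Finsupp.weight entryWeight m = lam})) (fun f hf => ?_)
  rw [f.as_sum]
  refine Submodule.sum_mem _ fun m hm => ?_
  have : monomial m (coeff m f) = coeff m f • monomial m (1 : ℂ) := by
    rw [smul_monomial, smul_eq_mul, mul_one]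
  rw [this]
  exact Submodule.smul_mem _ _ (Submodule.subset_span
    ⟨m, hf (MvPolynomial.mem_support_iff.mp hm), rfl⟩)

theorem HasWeight.polar_polar {f : SymPoly ℕ} {lam : ℕ →₀ ℕ} (h : HasWeight f lam) {s t : ℕ}
    (hst : s ≠ t) : HasWeight (NiiboriSagaki.polar t s (NiiboriSagaki.polar s t f)) lam := by
  by_cases h0 : lam t = 0
  · rw [h.polar_eq_zero hst h0, map_zero]
    exact (weightSpace lam).zero_mem
  · have h1 : (lam - Finsupp.single t 1 + Finsupp.single s 1) + Finsupp.single t 1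
        = lam + Finsupp.single s 1 := by
      rw [add_right_comm, tsub_add_cancel_of_le]
      rw [Finsupp.single_le_iff]
      omega
    exact (h.polar h1).polar h1.symm

/-- A weight vector that becomes highest modulo a submodule is a highest weight vector modulo it,
and this vector may be taken orthogonal to the submodule. -/
theorem exists_isHighest_add {W : Submodule ℂ (SymPoly ℕ)}
    (hW : ∀ a b, ∀ f ∈ W, polar a b f ∈ W) {f : SymPoly ℕ} {lam : ℕ →₀ ℕ} (hf : HasWeight f lam)
    (hfW : ∀ s t, s < t → polar s t f ∈ W) :
    ∃ g w, w ∈ W ∧ f = g + w ∧ IsHighest g ∧ HasWeight g lam ∧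
      ∀ v ∈ W, HasWeight v lam → fischer v g = 0 := by
  have : FiniteDimensional ℂ (W ⊓ weightSpace lam : Submodule ℂ (SymPoly ℕ)) :=
    Submodule.finiteDimensional_of_le inf_le_right
  obtain ⟨w, hw, h⟩ := exists_fischer_orthogonal (W ⊓ weightSpace lam) f
  have hg : HasWeight (f - w) lam := hf.sub hw.2
  refine ⟨f - w, w, hw.1, (sub_add_cancel f w).symm, fun s t hst => ?_, hg,
    fun v hv hvl => h v ⟨hv, hvl⟩⟩
  -- For a raising operator E with adjoint F, the squared norm of Eg is ⟨FEg, g⟩. Here FEg lies in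
  -- `W` and has weight `lam`, and `g` is orthogonal to such vectors.
  apply fischer_self_eq_zero
  rw [← fischer_polar]
  refine h _ ⟨hW _ _ _ ?_, hg.polar_polar hst.ne⟩
  rw [map_sub]
  exact W.sub_mem (hfW s t hst) (hW _ _ _ hw.1)

end Fischer

/-! ### Stable subspaces -/

section Stable

/-- A subspace stable under multiplication by the entries, under polarizations, and under the
second order operators. -/
structure IsStable (r : ℂ) (W : Submodule ℂ (SymPoly ℕ)) : Prop where
  entry_mul_mem : ∀ (a b : ℕ) {f : SymPoly ℕ}, f ∈ W → entry a b * f ∈ W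
  polar_mem : ∀ (a b : ℕ) {f : SymPoly ℕ}, f ∈ W → polar a b f ∈ W
  second_mem : ∀ (a b : ℕ) {f : SymPoly ℕ}, f ∈ W → second r a b f ∈ W

theorem IsStable.sup {r : ℂ} {V W : Submodule ℂ (SymPoly ℕ)} (hV : IsStable r V)
    (hW : IsStable r W) : IsStable r (V ⊔ W) where
  entry_mul_mem a b f hf := by
    obtain ⟨v, hv, w, hw, rfl⟩ := Submodule.mem_sup.mp hf
    rw [mul_add]
    exact Submodule.add_mem_sup (hV.entry_mul_mem a b hv) (hW.entry_mul_mem a b hw)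
  polar_mem a b f hf := by
    obtain ⟨v, hv, w, hw, rfl⟩ := Submodule.mem_sup.mp hf
    rw [map_add]
    exact Submodule.add_mem_sup (hV.polar_mem a b hv) (hW.polar_mem a b hw)
  second_mem a b f hf := by
    obtain ⟨v, hv, w, hw, rfl⟩ := Submodule.mem_sup.mp hf
    rw [map_add]
    exact Submodule.add_mem_sup (hV.second_mem a b hv) (hW.second_mem a b hw)

theorem IsStable.mul_mem {r : ℂ} {W : Submodule ℂ (SymPoly ℕ)} (hW : IsStable r W)
    (g : SymPoly ℕ) {f : SymPoly ℕ} (hf : f ∈ W) : g * f ∈ W := by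
  induction g using symPoly_induction with
  | h1 => rwa [one_mul]
  | hs t g hg => rw [smul_mul_assoc]; exact W.smul_mem t hg
  | ha g h hg hh => rw [add_mul]; exact W.add_mem hg hh
  | hx a b g hg => rw [mul_assoc]; exact hW.entry_mul_mem a b hg

/-! ### Descent from products of minors to the constant 1 -/

theorem exists_top_minor {s : Multiset ℕ} (h : ∃ p ∈ s, p ≠ 0) :
    ∃ (n k : ℕ) (s' : Multiset ℕ), s = Multiset.replicate (k + 1) (n + 1) + s' ∧
      ∀ p ∈ s', p ≤ n := by
  classical
  obtain ⟨p, hp, hp0⟩ := h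
  obtain ⟨M, hM, hmax⟩ := Finset.exists_max_image s.toFinset id ⟨p, Multiset.mem_toFinset.mpr hp⟩
  simp only [Multiset.mem_toFinset, id] at hM hmax
  have h1 := hmax p hp
  obtain ⟨n, rfl⟩ : ∃ n, M = n + 1 := ⟨M - 1, by omega⟩
  have h2 : 0 < s.count (n + 1) := Multiset.count_pos.mpr hM
  refine ⟨n, s.count (n + 1) - 1, s.filter (¬ · = n + 1), ?_, fun q hq => ?_⟩
  · rw [Nat.sub_add_cancel h2, ← Multiset.filter_eq', Multiset.filter_add_not]
  · rw [Multiset.mem_filter] at hq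
    have := hmax q hq.1
    omega

/-- Each step shortens one largest part by 1 with a scalar that `hr` makes nonzero. Shortening never
creates more parts of size at least p, so `hr` persists until the product is 1. -/
theorem one_mem_of_minors_mem {r : ℂ} {N : Submodule ℂ (SymPoly ℕ)}
    (hN : ∀ (a : ℕ) {f : SymPoly ℕ}, f ∈ N → second r a a f ∈ N) {s : Multiset ℕ}
    (hs : minors s ∈ N)
    (hr : ∀ p ν : ℕ, 1 ≤ p → 1 ≤ ν → ν ≤ (s.filter (p ≤ ·)).card → r ≠ 1 - 2 * ν + p) :
    (1 : SymPoly ℕ) ∈ N := by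
  induction hS : s.sum using Nat.strong_induction_on generalizing s with
  | _ S ih =>
  by_cases h0 : ∀ p ∈ s, p = 0
  · rwa [minors_eq_one h0] at hs
  push Not at h0
  obtain ⟨n, k, s', rfl, hs'⟩ := exists_top_minor h0
  have h1 := hN n hs
  rw [← pow_mul_minors, second_top_minors r hs'] at h1
  have h2 : ((r - n - 2 + 2 * ((k : ℂ) + 1)) * (2 * ((k : ℂ) + 1))) ≠ 0 := by
    refine mul_ne_zero (fun h => ?_) (mul_ne_zero two_ne_zero (Nat.cast_add_one_ne_zero k))
    refine hr (n + 1) (k + 1) (by omega) (by omega) ?_ ?_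
    · rw [Multiset.filter_add, Multiset.card_add, Multiset.filter_eq_self.mpr,
        Multiset.card_replicate]
      · omega
      · intro q hq
        rw [Multiset.eq_of_mem_replicate hq]
    · push_cast
      linear_combination h
  have h3 : minors (n ::ₘ (Multiset.replicate k (n + 1) + s')) ∈ N := by
    rw [minors_cons, ← pow_mul_minors, ← mul_assoc]
    exact (N.smul_mem_iff h2).mp h1
  refine ih _ ?_ h3 (fun p ν hp hν hc => hr p ν hp hν (hc.trans ?_)) rfl
  · rw [← hS, Multiset.replicate_succ, Multiset.cons_add, Multiset.sum_cons, Multiset.sum_cons]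
    omega
  · rw [Multiset.replicate_succ, Multiset.cons_add]
    by_cases hpn : p ≤ n
    · rw [Multiset.filter_cons_of_pos _ hpn, Multiset.filter_cons_of_pos _ (by omega),
        Multiset.card_cons, Multiset.card_cons]
    · rw [Multiset.filter_cons_of_neg _ hpn]
      exact Multiset.card_le_card (Multiset.filter_le_filter _ (Multiset.le_cons_self _ _))

/-! ### Setting the entries outside of two diagonal blocks to zero -/

open MvPolynomial in
/-- Set to zero the entries with exactly one of the two indices below `p`. -/
def blockRestrict (p : ℕ) : SymPoly ℕ →ₐ[ℂ] SymPoly ℕ :=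
  aeval (Sym2.lift ⟨fun a b => if a < p ↔ b < p then entry a b else 0, fun a b => by
    simp only [entry_comm a b, iff_comm (a := a < p)]⟩)

theorem blockRestrict_entry (p a b : ℕ) :
    blockRestrict p (entry a b) = if a < p ↔ b < p then entry a b else 0 := by
  rw [blockRestrict, entry, MvPolynomial.aeval_X]
  rfl

theorem coeff_blockRestrict (p : ℕ) (f : SymPoly ℕ) (m : Sym2 ℕ →₀ ℕ) :
    MvPolynomial.coeff m (blockRestrict p f) = 0 ∨
      MvPolynomial.coeff m (blockRestrict p f) = MvPolynomial.coeff m f := by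
  classical
  -- The statement is strengthened so that the alternative depends on `m` alone; otherwise it would
  -- not pass to sums.
  have key : ∀ f : SymPoly ℕ, (∃ e ∈ m.support, blockRestrict p (MvPolynomial.X e) = 0) ∧
        MvPolynomial.coeff m (blockRestrict p f) = 0 ∨
      (∀ e ∈ m.support, blockRestrict p (MvPolynomial.X e) ≠ 0) ∧
        MvPolynomial.coeff m (blockRestrict p f) = MvPolynomial.coeff m f := by
    intro f
    induction f using symPoly_induction generalizing m with
    | h1 =>
      rw [map_one, MvPolynomial.coeff_one]
      by_cases h : ∃ e ∈ m.support, blockRestrict p (MvPolynomial.X e) = 0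
      · refine Or.inl ⟨h, if_neg ?_⟩
        rintro rfl
        obtain ⟨e, he, -⟩ := h
        simp at he
      · push Not at h
        exact Or.inr ⟨h, rfl⟩
    | hs t f hf =>
      simp only [map_smul, MvPolynomial.coeff_smul]
      rcases hf m with ⟨h1, h2⟩ | ⟨h1, h2⟩
      · exact Or.inl ⟨h1, by rw [h2, smul_zero]⟩
      · exact Or.inr ⟨h1, by rw [h2]⟩
    | ha f g hf hg =>
      simp only [map_add, MvPolynomial.coeff_add]
      rcases hf m with ⟨h1, h2⟩ | ⟨h1, h2⟩ <;> rcases hg m with ⟨h3, h4⟩ | ⟨h3, h4⟩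
      · exact Or.inl ⟨h1, by rw [h2, h4, add_zero]⟩
      · obtain ⟨e, he, he'⟩ := h1
        exact absurd he' (h3 e he)
      · obtain ⟨e, he, he'⟩ := h3
        exact absurd he' (h1 e he)
      · exact Or.inr ⟨h1, by rw [h2, h4]⟩
    | hx a b f hf =>
      have hX : blockRestrict p (entry a b) = 0 ∨ blockRestrict p (entry a b) = entry a b := by
        rw [blockRestrict_entry]
        split_ifs
        · exact Or.inr rfl
        · exact Or.inl rfl
      by_cases h : ∃ e ∈ m.support, blockRestrict p (MvPolynomial.X e) = 0
      · refine Or.inl ⟨h, ?_⟩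
        rw [map_mul]
        rcases hX with hX | hX
        · rw [hX, zero_mul, MvPolynomial.coeff_zero]
        · rw [hX, entry, MvPolynomial.coeff_X_mul']
          split_ifs with hm
          · obtain ⟨e, he, he'⟩ := h
            rcases hf (m - Finsupp.single s(a, b) 1) with h3 | h3
            · exact h3.2
            · refine absurd he' (h3.1 e ?_)
              rw [Finsupp.mem_support_iff, Finsupp.tsub_apply, Finsupp.single_apply, if_neg,
                tsub_zero]
              · exact Finsupp.mem_support_iff.mp he
              · rintro rfl
                change blockRestrict p (entry a b) = 0 at he'
                rw [hX, entry] at he'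
                exact MvPolynomial.X_ne_zero _ he'
          · rfl
      · push Not at h
        refine Or.inr ⟨h, ?_⟩
        rw [map_mul]
        rcases hX with hX | hX
        · rw [hX, zero_mul, MvPolynomial.coeff_zero, entry, MvPolynomial.coeff_X_mul',
            if_neg fun hm => h _ hm hX]
        · rw [hX, entry, MvPolynomial.coeff_X_mul', MvPolynomial.coeff_X_mul']
          split_ifs with hm
          · rcases hf (m - Finsupp.single s(a, b) 1) with ⟨⟨e, he, he'⟩, -⟩ | h3
            · refine absurd he' (h e ?_)
              rw [Finsupp.mem_support_iff] at he ⊢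
              rw [Finsupp.tsub_apply] at he
              omega
            · exact h3.2
          · rfl
  rcases key f with h | h
  · exact Or.inl h.2
  · exact Or.inr h.2

theorem HasWeight.blockRestrict {f : SymPoly ℕ} {lam : ℕ →₀ ℕ} (h : HasWeight f lam) (p : ℕ) :
    HasWeight (blockRestrict p f) lam := by
  intro m hm
  rcases coeff_blockRestrict p f m with h1 | h1
  · exact absurd h1 hm
  · rw [h1] at hm
    exact h hm

/-- Monomials are orthogonal and the restriction merely deletes some of them, so it is an orthogonal
projection. -/
theorem fischer_blockRestrict (p : ℕ) (f : SymPoly ℕ) :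
    fischer (blockRestrict p f) f = fischer (blockRestrict p f) (blockRestrict p f) := by
  refine Finset.sum_congr rfl fun m _ => ?_
  rcases coeff_blockRestrict p f m with h | h
  · rw [h, map_zero, zero_mul, zero_mul]
  · rw [h]

/-- After the off-diagonal blocks are set to 0 the matrix is block diagonal, and its determinant
factors. -/
theorem minor_dvd_blockRestrict {p q : ℕ} (h : p ≤ q) : minor p ∣ blockRestrict p (minor q) := by
  obtain ⟨k, rfl⟩ := Nat.exists_eq_add_of_le h
  rw [minor, minor, AlgHom.map_det, ← Matrix.det_submatrix_equiv_self finSumFinEquiv,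
    ← Matrix.fromBlocks_toBlocks (Matrix.submatrix _ finSumFinEquiv finSumFinEquiv)]
  have h1 : (((blockRestrict p).mapMatrix (genericMatrix (p + k))).submatrix
      finSumFinEquiv finSumFinEquiv).toBlocks₁₂ = 0 := by
    ext1 i j
    change blockRestrict p (entry (i : ℕ) (p + (j : ℕ))) = 0
    rw [blockRestrict_entry, if_neg]
    have := i.2
    omega
  have h2 : (((blockRestrict p).mapMatrix (genericMatrix (p + k))).submatrix
      finSumFinEquiv finSumFinEquiv).toBlocks₁₁ = genericMatrix p := by
    ext1 i j
    change blockRestrict p (entry (i : ℕ) (j : ℕ)) = entry (i : ℕ) (j : ℕ)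
    rw [blockRestrict_entry, if_pos]
    have := i.2
    have := j.2
    omega
  rw [h1, h2, Matrix.det_fromBlocks_zero₁₂]
  exact dvd_mul_right _ _

theorem pow_minor_dvd_blockRestrict {p : ℕ} {s : Multiset ℕ} (h : ∀ q ∈ s, p ≤ q) :
    minor p ^ s.card ∣ blockRestrict p (minors s) := by
  induction s using Multiset.induction_on with
  | empty => simp
  | cons q s ih =>
    rw [minors_cons, map_mul, Multiset.card_cons, pow_succ']
    exact mul_dvd_mul (minor_dvd_blockRestrict (h q (Multiset.mem_cons_self q s)))
      (ih fun q hq => h q (Multiset.mem_cons_of_mem hq))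

theorem blockRestrict_minors_ne_zero (p : ℕ) (s : Multiset ℕ) :
    blockRestrict p (minors s) ≠ 0 := by
  intro h
  have h1 : evalOne.comp (blockRestrict p) = evalOne := by
    apply MvPolynomial.algHom_ext
    intro e
    induction e with
    | _ a b =>
      change evalOne (blockRestrict p (entry a b)) = evalOne (entry a b)
      rw [blockRestrict_entry, evalOne_entry]
      split_ifs <;> simp_all [evalOne_entry]
  have h2 := evalOne_minors s
  rw [← h1, AlgHom.comp_apply, h, map_zero] at h2
  exact zero_ne_one h2

/-! ### Products of minors contained in a stable subspace -/

theorem exists_le_card_eq {α : Type*} {s : Multiset α} {n : ℕ} (h : n ≤ s.card) :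
    ∃ t ≤ s, t.card = n := by
  induction s using Quotient.inductionOn with
  | _ l => exact ⟨(l.take n : List α), (List.take_sublist n l).subperm, by simpa using h⟩

/-- It suffices to treat ν factors of size at least p. Their block restriction is divisible by
Δ_p^ν, hence in `W`. Modulo `W`, the product is represented by a highest weight vector orthogonal to
`W`, which must be a multiple c of the product itself; pairing it with the block restriction forces
c = 0. -/
theorem IsStable.minors_mem {r : ℂ} {W : Submodule ℂ (SymPoly ℕ)} (hW : IsStable r W) {p ν : ℕ}
    (hp : minor p ^ ν ∈ W) {s : Multiset ℕ} (hν : ν ≤ (s.filter (p ≤ ·)).card) :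
    minors s ∈ W := by
  obtain ⟨s₁, hle, hcard⟩ := exists_le_card_eq hν
  have hs₁ : ∀ q ∈ s₁, p ≤ q := fun q hq =>
    (Multiset.mem_filter.mp (Multiset.mem_of_le hle hq)).2
  obtain ⟨s₂, rfl⟩ := Multiset.le_iff_exists_add.mp (hle.trans (Multiset.filter_le _ s))
  rw [minors_add, mul_comm]
  apply hW.mul_mem
  obtain ⟨G, hG⟩ := pow_minor_dvd_blockRestrict hs₁
  have hmem : blockRestrict p (minors s₁) ∈ W := by
    rw [hG, hcard, mul_comm]
    exact hW.mul_mem G hp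
  obtain ⟨g, w, hw, hfg, hg, hgl, horth⟩ := exists_isHighest_add
    (fun a b f hf => hW.polar_mem a b hf) (hasWeight_minors s₁) fun s t hst => by
      rw [isHighest_minors s₁ s t hst]; exact W.zero_mem
  obtain ⟨c, rfl⟩ := hg.exists_eq_smul (isHighest_minors s₁) hgl (hasWeight_minors s₁)
    (minors_ne_zero s₁)
  -- The pairing equals the conjugation-free scalar `c` times the squared norm of the block
  -- restriction, which is nonzero.
  have h1 := horth _ hmem ((hasWeight_minors s₁).blockRestrict p)
  rw [fischer_smul_right, fischer_blockRestrict] at h1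
  rcases mul_eq_zero.mp h1 with rfl | h1
  · rw [zero_smul, zero_add] at hfg
    rwa [hfg]
  · exact absurd (fischer_self_eq_zero h1) (blockRestrict_minors_ne_zero p s₁)

end Stable

/-! ### Highest weight vectors killed by the second order operators -/

section Singular

theorem exists_ne_zero_of_colSum {s : Multiset ℕ} (h : colSum s ≠ 0) : ∃ p ∈ s, p ≠ 0 := by
  by_contra h'
  push Not at h'
  apply h
  ext a
  rw [colSum_apply, Multiset.filter_eq_nil.mpr]
  · rfl
  · intro p hp
    rw [h' p hp]
    exact Nat.not_lt_zero a

theorem minor_mul_pow_mul_minors (n p k : ℕ) (s : Multiset ℕ) :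
    minor n * minor p ^ k * minors s = minors (n ::ₘ (Multiset.replicate k p + s)) := by
  rw [minors_cons, ← pow_mul_minors, mul_assoc]

/-- The second order operator kills the determinant power, so only its action on `g` and two equal
cross sums remain; each cross sum contributes 2ν by the eigenvalue of the diagonal polarization. -/
theorem second_pow_minor_mul (r : ℂ) {p ν m : ℕ} (h : r = 1 - 2 * ν + p) (hm : m < p)
    {g : SymPoly ℕ} (hg : ∀ c, p ≤ c → grad c g = 0) :
    second r m m (minor p ^ ν * g)
      = minor p ^ ν * (second r m m g + (4 * (ν : ℂ)) • grad m g m) := by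
  classical
  rw [second_mul r m m (minor p ^ ν) g (S := (grad m (minor p ^ ν)).support ∪ (grad m g).support)
    Finset.subset_union_left Finset.subset_union_right, second_pow_minor r h, mul_zero, add_zero,
    Finset.sum_add_distrib, sum_polar_mul_grad m m g (minor p ^ ν) Finset.subset_union_right
      Finset.subset_union_left]
  have h1 : ∑ c ∈ (grad m (minor p ^ ν)).support ∪ (grad m g).support,
      polar c m (minor p ^ ν) * grad m g c = (2 * (ν : ℂ)) • (minor p ^ ν * grad m g m) := by
    rw [Finset.sum_eq_single m, polar_pow_minor ν hm hm, if_pos rfl, smul_mul_assoc]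
    · intro c _ hcm
      rcases lt_or_ge c p with hc | hc
      · rw [polar_pow_minor ν hc hm, if_neg hcm, zero_mul]
      · rw [grad_comm, hg c hc, Finsupp.zero_apply, mul_zero]
    · intro h
      rw [Finsupp.notMem_support_iff.mp fun h' => h (Finset.mem_union_right _ h'), mul_zero]
  rw [h1, mul_add, mul_smul_comm]
  module

/-- The largest minor forces the value of `r`. With that value, the next smaller minor has a nonzero
coefficient, so there is none. Diagonal second order operators suffice. -/
theorem eq_pow_minor_of_second_eq_zero {r : ℂ} {f : SymPoly ℕ} {lam : ℕ →₀ ℕ} (hf : IsHighest f)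
    (hfl : HasWeight f lam) (h : f ≠ 0) (hlam : lam ≠ 0) (hE : ∀ a, second r a a f = 0) :
    ∃ (p ν : ℕ) (c : ℂ), 1 ≤ p ∧ 1 ≤ ν ∧ r = 1 - 2 * ν + p ∧ f = c • minor p ^ ν := by
  obtain ⟨s, c, hc, hs, rfl⟩ := hf.exists_minors hfl h
  have hE' : ∀ a, second r a a (minors s) = 0 := fun a => by
    have := hE a
    rw [map_smul, smul_eq_zero] at this
    exact this.resolve_left hc
  have hs0 : colSum s ≠ 0 := by
    rintro h0
    rw [h0, smul_zero] at hs
    exact hlam hs.symm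
  obtain ⟨n, k, s', rfl, hs'⟩ := exists_top_minor (exists_ne_zero_of_colSum hs0)
  have h1 := hE' n
  rw [← pow_mul_minors, second_top_minors r hs', minor_mul_pow_mul_minors] at h1
  have hr : r = 1 - 2 * ((k + 1 : ℕ) : ℂ) + ((n + 1 : ℕ) : ℂ) := by
    rcases smul_eq_zero.mp h1 with h2 | h2
    · rcases mul_eq_zero.mp h2 with h2 | h2
      · push_cast
        linear_combination h2
      · exact absurd h2 (mul_ne_zero two_ne_zero (Nat.cast_add_one_ne_zero k))
    · exact absurd h2 (minors_ne_zero _)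
  refine ⟨n + 1, k + 1, c, by omega, by omega, hr, ?_⟩
  by_cases h0 : ∀ p ∈ s', p = 0
  · rw [← pow_mul_minors, minors_eq_one h0, mul_one]
  exfalso
  push Not at h0
  obtain ⟨m, l, t, rfl, ht⟩ := exists_top_minor h0
  have hmn : m + 1 ≤ n := hs' _ (by simp)
  have h2 := hE' m
  rw [← pow_mul_minors, second_pow_minor_mul r hr (by omega) fun c hc =>
    grad_minors_eq_zero fun p hp => (hs' p hp).trans (by omega), ← pow_mul_minors,
    second_top_minors r ht, grad_top_minors ht, minor_mul_pow_mul_minors, smul_smul, ← add_smul,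
    mul_smul_comm, smul_eq_zero] at h2
  rcases h2 with h2 | h2
  · have h3 : (2 * ((l : ℂ) + 1)) ≠ 0 := mul_ne_zero two_ne_zero (Nat.cast_add_one_ne_zero l)
    rw [← add_mul] at h2
    have h4 := (mul_eq_zero.mp h2).resolve_right h3
    obtain ⟨j, rfl⟩ := Nat.exists_eq_add_of_le hmn
    -- With r = n - 2k and n = m + 1 + j, the coefficient r - m - 2 + 2(l + 1) + 4(k + 1) becomes
    -- this positive integer.
    have h5 : ((j + 2 * k + 2 * l + 5 : ℕ) : ℂ) = 0 := by
      rw [hr] at h4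
      push_cast at h4 ⊢
      linear_combination h4
    exact absurd (Nat.cast_eq_zero.mp h5) (by omega)
  · exact mul_ne_zero (pow_ne_zero _ (minor_ne_zero _)) (minors_ne_zero _) h2

end Singular

/-! ### The maximal stable subspace -/

section Maximal

/-- The second order operators transform under gl_∞ like a symmetric tensor; hence polarizations
preserve their common kernel. -/
theorem second_polar (r : ℂ) (a b c d : ℕ) (f : SymPoly ℕ) :
    second r a b (polar c d f) = polar c d (second r a b f)
      + ((if a = c then second r d b f else 0) + (if b = c then second r a d f else 0)) := by
  classical
  -- The indices `c` and `d` are included so that the two Kronecker terms in `h1` are both summed,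
  -- and cancel.
  set S := (grad a (polar c d f)).support ∪ (grad a f).support ∪ (grad d f).support ∪ {c, d}
  have hc : c ∈ S := by simp [S]
  have hd : d ∈ S := by simp [S]
  rw [second_eq_sum r a b (polar c d f) (S := S) (by grind),
    second_eq_sum r a b f (S := S) (by grind), second_eq_sum r d b f (S := S) (by grind),
    second_eq_sum r a d f (S := S) (by grind)]
  have h1 : ∀ e ∈ S, polar e b (grad a (polar c d f) e)
      = polar c d (polar e b (grad a f e)) + (if b = c then polar e d (grad a f e) else 0)
        + (if a = c then polar e b (grad d f e) else 0)
        - (if e = d then polar c b (grad a f d) else 0)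
        + (if e = c then polar c b (grad a f d) else 0) := by
    intro e _
    rw [grad_polar, map_add, map_add, polar_polar, grad_comm e d]
    have h2 : (if e = d then polar c b (grad a f e) else 0)
        = if e = d then polar c b (grad a f d) else 0 := by split_ifs with h <;> simp [h]
    have h3 : polar e b (if e = c then grad a f d else 0)
        = if e = c then polar c b (grad a f d) else 0 := by split_ifs with h <;> simp [h]
    rw [h2, h3, apply_ite (polar e b), map_zero]
    abel
  rw [Finset.sum_congr rfl h1]
  simp only [Finset.sum_add_distrib, Finset.sum_sub_distrib, Finset.sum_ite_eq', if_pos hc,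
    if_pos hd]
  rw [grad_polar, grad_comm b d]
  simp only [map_add, map_sum, Derivation.map_smul, smul_add]
  by_cases h2 : a = c <;> by_cases h3 : b = c <;> simp [h2, h3] <;> abel

/-- The polynomials without constant term that are killed by the second order operators. -/
def secondKernel (r : ℂ) : Submodule ℂ (SymPoly ℕ) where
  carrier := {t | MvPolynomial.constantCoeff t = 0 ∧ ∀ a b, second r a b t = 0}
  zero_mem' := ⟨map_zero _, fun _ _ => map_zero _⟩
  add_mem' hf hg := ⟨by rw [map_add, hf.1, hg.1, add_zero],
    fun a b => by rw [map_add, hf.2, hg.2, add_zero]⟩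
  smul_mem' t f hf := ⟨by rw [MvPolynomial.smul_eq_C_mul, map_mul, hf.1, mul_zero],
    fun a b => by rw [map_smul, hf.2, smul_zero]⟩

theorem constantCoeff_polar (a b : ℕ) (f : SymPoly ℕ) :
    MvPolynomial.constantCoeff (polar a b f) = 0 := by
  rw [polar_eq_sum a b f subset_rfl, map_sum]
  refine Finset.sum_eq_zero fun e _ => ?_
  rw [map_mul, entry, MvPolynomial.constantCoeff_X, zero_mul]

theorem polar_mem_secondKernel {r : ℂ} (a b : ℕ) {f : SymPoly ℕ} (hf : f ∈ secondKernel r) :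
    polar a b f ∈ secondKernel r :=
  ⟨constantCoeff_polar a b f, fun c d => by
    rw [second_polar, hf.2, hf.2, hf.2, map_zero, ite_self, ite_self, add_zero, add_zero]⟩

/-- The ideal generated by the polynomials without constant term that are killed by the second
order operators. -/
def secondIdeal (r : ℂ) : Submodule ℂ (SymPoly ℕ) :=
  (Ideal.span (secondKernel r : Set (SymPoly ℕ))).restrictScalars ℂ

theorem mem_secondIdeal_of_mem {r : ℂ} {f : SymPoly ℕ} (hf : f ∈ secondKernel r) :
    f ∈ secondIdeal r := Ideal.subset_span hf

theorem secondIdeal_induction {r : ℂ} {p : SymPoly ℕ → Prop} {f : SymPoly ℕ}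
    (hf : f ∈ secondIdeal r) (h0 : p 0) (ha : ∀ f g, p f → p g → p (f + g))
    (hm : ∀ g, ∀ t ∈ secondKernel r, p (g * t)) : p f := by
  have hf' : f ∈ Submodule.span (SymPoly ℕ) (secondKernel r : Set (SymPoly ℕ)) := hf
  clear hf
  induction hf' using Submodule.closure_induction with
  | zero => exact h0
  | add f g _ _ hf hg => exact ha f g hf hg
  | smul_mem g t ht => exact hm g t ht

/-- For `t` in the kernel, applying a second order operator to g · t leaves t times a polynomial and
cross terms. By `sum_polar_mul_grad` every cross term has a polarization of `t` as a factor, which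
is again in the kernel. -/
theorem isStable_secondIdeal (r : ℂ) : IsStable r (secondIdeal r) where
  entry_mul_mem a b f hf := Ideal.mul_mem_left _ _ hf
  polar_mem a b f hf := by
    refine secondIdeal_induction (p := fun x => polar a b x ∈ secondIdeal r) hf ?_
      (fun f g hf hg => ?_) fun g t ht => ?_
    · rw [map_zero]; exact Submodule.zero_mem _
    · rw [map_add]; exact Submodule.add_mem _ hf hg
    · rw [Derivation.leibniz]
      exact Submodule.add_mem _
        (Ideal.mul_mem_left _ _ (mem_secondIdeal_of_mem (polar_mem_secondKernel a b ht)))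
        (Ideal.mul_mem_right _ _ (mem_secondIdeal_of_mem ht))
  second_mem a b f hf := by
    classical
    refine secondIdeal_induction (p := fun x => second r a b x ∈ secondIdeal r) hf ?_
      (fun f g hf hg => ?_) fun g t ht => ?_
    · rw [map_zero]; exact Submodule.zero_mem _
    · rw [map_add]; exact Submodule.add_mem _ hf hg
    · have h1 : ∀ (c d : ℕ) (x : SymPoly ℕ), polar c d t * x ∈ secondIdeal r := fun c d x =>
        Ideal.mul_mem_right _ _ (mem_secondIdeal_of_mem (polar_mem_secondKernel c d ht))
      rw [second_mul r a b g t (S := (grad a g).support ∪ (grad a t).support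
        ∪ ((grad b g).support ∪ (grad b t).support)) (by grind) (by grind), ht.2, mul_zero,
        zero_add, Finset.sum_add_distrib, sum_polar_mul_grad a b g t (by grind) (by grind)]
      exact Submodule.add_mem _ (Ideal.mul_mem_right _ _ (mem_secondIdeal_of_mem ht))
        (Submodule.add_mem _ (Submodule.sum_mem _ fun c _ => h1 _ _ _)
          (Submodule.sum_mem _ fun c _ => h1 _ _ _))

theorem one_notMem_secondIdeal (r : ℂ) : (1 : SymPoly ℕ) ∉ secondIdeal r := by
  intro h
  have h1 : MvPolynomial.constantCoeff (1 : SymPoly ℕ) = 0 :=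
    secondIdeal_induction (p := fun f => MvPolynomial.constantCoeff f = 0) h (map_zero _)
      (fun f g hf hg => by rw [map_add, hf, hg, add_zero])
      fun g t ht => by rw [map_mul, ht.1, mul_zero]
  rw [map_one] at h1
  exact one_ne_zero h1

/-! ### Powers of minors in the kernel, and comparison of proper stable subspaces -/

theorem constantCoeff_minor {p : ℕ} (hp : 1 ≤ p) : MvPolynomial.constantCoeff (minor p) = 0 := by
  obtain ⟨p, rfl⟩ := Nat.exists_eq_add_of_le' hp
  rw [minor, RingHom.map_det]
  have : MvPolynomial.constantCoeff.mapMatrix (genericMatrix (p + 1)) = 0 := by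
    ext1 i j
    exact MvPolynomial.constantCoeff_X (R := ℂ) s((i : ℕ), (j : ℕ))
  rw [this, Matrix.det_zero]

theorem pow_minor_mem_secondKernel {r : ℂ} {p ν : ℕ} (hp : 1 ≤ p) (hν : 1 ≤ ν)
    (h : r = 1 - 2 * ν + p) : minor p ^ ν ∈ secondKernel r :=
  ⟨by rw [map_pow, constantCoeff_minor hp, zero_pow (by omega)], second_pow_minor r h⟩

/-- A stable subspace contains the weight components of its elements, and the component of weight 0
is the constant term. -/
theorem IsStable.constantCoeff_eq_zero {r : ℂ} {N : Submodule ℂ (SymPoly ℕ)} (hN : IsStable r N)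
    (h1 : (1 : SymPoly ℕ) ∉ N) {f : SymPoly ℕ} (hf : f ∈ N) :
    MvPolynomial.constantCoeff f = 0 := by
  by_contra h
  apply h1
  have h2 := weightComponent_mem (fun a f hf => hN.polar_mem a a hf) hf 0
  have h3 : weightComponent 0 f = MvPolynomial.constantCoeff f • 1 := by
    ext m
    rw [coeff_weightComponent, MvPolynomial.coeff_smul, MvPolynomial.coeff_one]
    have h4 : Finsupp.weight entryWeight m = 0 ↔ 0 = m := by
      refine ⟨fun hm => ?_, fun hm => by rw [← hm, map_zero]⟩
      ext e
      induction e with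
      | _ a b =>
        have h5 := le_weight_entryWeight m a b
        rw [hm] at h5
        exact (Nat.le_zero.mp h5).symm
    rw [if_congr h4 rfl rfl]
    split_ifs with hm
    · subst hm
      simp [MvPolynomial.constantCoeff_eq]
    · simp
  rw [h3] at h2
  exact (N.smul_mem_iff h).mp h2

/-- The energy of a weight. -/
def energy : (ℕ →₀ ℕ) →+ ℕ := Finsupp.weight id

/-- The sum N + W still misses 1. Modulo `W` its weight vectors are highest by induction on energy,
hence multiples of products of minors; such a product either descends to 1, which is excluded, or
contains a critical rectangle and lies in `W`. -/
theorem IsStable.le_of_pow_minor_mem {r : ℂ} {N W : Submodule ℂ (SymPoly ℕ)} (hN : IsStable r N)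
    (hW : IsStable r W) (hN1 : (1 : SymPoly ℕ) ∉ N) (hW1 : (1 : SymPoly ℕ) ∉ W)
    (hWp : ∀ p ν : ℕ, 1 ≤ p → 1 ≤ ν → r = 1 - 2 * ν + p → minor p ^ ν ∈ W) : N ≤ W := by
  have hV := hN.sup hW
  have hV1 : (1 : SymPoly ℕ) ∉ N ⊔ W := by
    intro h
    obtain ⟨f, hf, g, hg, hfg⟩ := Submodule.mem_sup.mp h
    have := congrArg MvPolynomial.constantCoeff hfg
    rw [map_add, hN.constantCoeff_eq_zero hN1 hf, hW.constantCoeff_eq_zero hW1 hg, map_one,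
      add_zero] at this
    exact zero_ne_one this
  have key : ∀ (n : ℕ) (lam : ℕ →₀ ℕ), energy lam = n → ∀ f ∈ N ⊔ W, HasWeight f lam → f ∈ W := by
    intro n
    induction n using Nat.strong_induction_on with
    | _ n ih =>
    intro lam hn f hf hfl
    obtain ⟨g, w, hw, rfl, hg, hgl, -⟩ := exists_isHighest_add
      (fun a b f hf => hW.polar_mem a b hf) hfl fun s t hst => by
        -- Subtraction of weights is truncated, so the case where the index `t` does not occur is
        -- treated apart.
        by_cases h0 : lam t = 0
        · rw [hfl.polar_eq_zero hst.ne h0]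
          exact W.zero_mem
        · have h1 : (lam - Finsupp.single t 1 + Finsupp.single s 1) + Finsupp.single t 1
              = lam + Finsupp.single s 1 := by
            rw [add_right_comm, tsub_add_cancel_of_le]
            rw [Finsupp.single_le_iff]
            omega
          -- Replacing an index `t` by `s` lowers the energy by t - s > 0.
          refine ih _ ?_ _ rfl _ (hV.polar_mem s t hf) (hfl.polar h1)
          have h2 := congrArg energy h1
          rw [map_add, map_add energy lam] at h2
          simp only [energy, Finsupp.weight_single, smul_eq_mul, one_mul, id] at h2 hn ⊢
          omega
    refine W.add_mem ?_ hw
    by_cases hg0 : g = 0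
    · rw [hg0]; exact W.zero_mem
    obtain ⟨s, c, hc, -, rfl⟩ := hg.exists_minors hgl hg0
    have hmem : minors s ∈ N ⊔ W := by
      have h1 := (N ⊔ W).sub_mem hf (Submodule.mem_sup_right hw)
      rw [add_sub_cancel_right] at h1
      exact ((N ⊔ W).smul_mem_iff hc).mp h1
    obtain ⟨p, ν, hp, hν, hc, hr⟩ : ∃ p ν : ℕ, 1 ≤ p ∧ 1 ≤ ν ∧ ν ≤ (s.filter (p ≤ ·)).card ∧
        r = 1 - 2 * ν + p := by
      by_contra h
      push Not at h
      exact hV1 (one_mem_of_minors_mem (fun a f hf => hV.second_mem a a hf) hmem h)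
    exact W.smul_mem c (hW.minors_mem (hWp p ν hp hν hr) hc)
  intro f hf
  refine mem_of_weightComponent_mem fun lam => key _ lam rfl _ ?_ (hasWeight_weightComponent lam f)
  exact weightComponent_mem (fun a f hf => hV.polar_mem a a hf) (Submodule.mem_sup_left hf) lam

end Maximal

/-! ### Submodules of `M_r^{(1)}` and stable subspaces -/

section Transfer

variable {d : ℕ} [NeZero d] {r : ℂ}

theorem nord_mem_LieL1 (m n : ℤ) : nord r ((0 : Fin d), m) ((0 : Fin d), n) ∈ LieL1 d r := by
  rcases le_total m n with h | h
  · rw [← lv_eq_nord_of r (Or.inr (Or.inr h))]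
    exact LieSubalgebra.subset_lieSpan ⟨m, n, h, rfl⟩
  · rw [nord_comm, ← lv_eq_nord_of r (Or.inr (Or.inr h))]
    exact LieSubalgebra.subset_lieSpan ⟨n, m, h, rfl⟩

theorem mode₁_cases (m : ℤ) : (∃ s, ((0 : Fin d), m) = creat₁ d s) ∨
    (∃ s, ((0 : Fin d), m) = annih₁ d s) ∨ m = 0 := by
  match m with
  | Int.negSucc s => exact Or.inl ⟨s, rfl⟩
  | Int.ofNat 0 => exact Or.inr (Or.inr rfl)
  | Int.ofNat (s + 1) => exact Or.inr (Or.inl ⟨s, rfl⟩)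

/-- Generators with m ≤ n are already normally ordered and act, up to scalars, by the operators that
preserve `V`; brackets act by commutators. -/
theorem iota_smul_mem_map {V : Submodule ℂ (SymPoly ℕ)} (hV : IsStable r V) {x : LieL d r}
    (hx : x ∈ LieL1 d r) {u : ModM d r} (hu : u ∈ V.map (polyToM d r)) :
    iota x • u ∈ V.map (polyToM d r) := by
  induction hx using LieSubalgebra.lieSpan_induction generalizing u with
  | mem x h =>
    obtain ⟨m, n, hmn, rfl⟩ := h
    rw [lv_eq_nord_of r (Or.inr (Or.inr hmn))]
    obtain ⟨f, hf, rfl⟩ := hu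
    have h0 : (0 : ModM d r) ∈ V.map (polyToM d r) := Submodule.zero_mem _
    rcases mode₁_cases (d := d) m with ⟨s, hs⟩ | ⟨s, hs⟩ | rfl
    · rw [hs]
      rcases mode₁_cases (d := d) n with ⟨t, ht⟩ | ⟨t, ht⟩ | rfl
      · rw [ht, ← polyToM_entry_mul]
        exact Submodule.mem_map_of_mem (hV.entry_mul_mem s t hf)
      · rw [ht, polar_polyToM]
        exact Submodule.smul_mem _ _ (Submodule.mem_map_of_mem (hV.polar_mem s t hf))
      · rwa [nord_comm, zero_polyToM]
    · rw [hs]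
      rcases mode₁_cases (d := d) n with ⟨t, ht⟩ | ⟨t, ht⟩ | rfl
      · rw [ht, nord_comm, polar_polyToM]
        exact Submodule.smul_mem _ _ (Submodule.mem_map_of_mem (hV.polar_mem t s hf))
      · rw [ht, second_polyToM]
        exact Submodule.smul_mem _ _ (Submodule.mem_map_of_mem (hV.second_mem s t hf))
      · rwa [nord_comm, zero_polyToM]
    · rwa [zero_polyToM]
  | zero =>
    rw [iota_zero, zero_smul]
    exact Submodule.zero_mem _
  | add x y _ _ hx hy =>
    rw [iota_add, add_smul]
    exact Submodule.add_mem _ (hx hu) (hy hu)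
  | smul t x _ hx =>
    rw [iota_smul, smul_assoc]
    exact Submodule.smul_mem _ _ (hx hu)
  | lie x y _ _ hx hy =>
    have h : iota ⁅x, y⁆ = iota x * iota y - iota y * iota x := by
      rw [iota_mul_eq r x y, add_sub_cancel_left]
    rw [h, sub_smul, mul_smul, mul_smul]
    exact Submodule.sub_mem _ (hx (hy hu)) (hy (hx hu))

/-- The submodule of `M_r` for the action of `L_r^{(1)}` that comes from a stable subspace. -/
def stableToLie (d : ℕ) [NeZero d] {r : ℂ} {V : Submodule ℂ (SymPoly ℕ)} (hV : IsStable r V) :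
    LieSubmodule ℂ (LieL1 d r) (ModM d r) where
  __ := V.map (polyToM d r)
  lie_mem {x _} hu := iota_smul_mem_map hV x.2 hu

theorem mem_stableToLie {V : Submodule ℂ (SymPoly ℕ)} {hV : IsStable r V} {f : SymPoly ℕ} :
    polyToM d r f ∈ stableToLie d hV ↔ f ∈ V := by
  refine ⟨fun ⟨g, hg, hgf⟩ => ?_, fun h => ⟨f, h, rfl⟩⟩
  rwa [← polyToM_injective r hgf]

theorem isStable_top : IsStable r ⊤ :=
  ⟨fun _ _ _ _ => trivial, fun _ _ _ _ => trivial, fun _ _ _ _ => trivial⟩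

theorem vac_mem_ModM1 : vac d r ∈ ModM1 d r := LieSubmodule.subset_lieSpan rfl

theorem polyToM_mem_ModM1 (f : SymPoly ℕ) : polyToM d r f ∈ ModM1 d r := by
  induction f using symPoly_induction with
  | h1 => rw [polyToM_one]; exact vac_mem_ModM1
  | hs t f hf => rw [map_smul]; exact (ModM1 d r).smul_mem t hf
  | ha f g hf hg => rw [map_add]; exact add_mem hf hg
  | hx s t f hf => rw [polyToM_entry_mul]; exact iota_smul_mem (nord_mem_LieL1 _ _) hf

/-- The parametrization of `M_r^{(1)}` by polynomials. -/
def polyToM₁ (d : ℕ) [NeZero d] (r : ℂ) : SymPoly ℕ →ₗ[ℂ] ModM1 d r where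
  toFun f := ⟨polyToM d r f, polyToM_mem_ModM1 f⟩
  map_add' f g := Subtype.ext (map_add _ f g)
  map_smul' t f := Subtype.ext (map_smul _ t f)

theorem coe_polyToM₁ (f : SymPoly ℕ) : (polyToM₁ d r f : ModM d r) = polyToM d r f := rfl

/-- The image of all polynomials is a submodule containing the vacuum. -/
theorem polyToM₁_surjective : Function.Surjective (polyToM₁ d r) := by
  rintro ⟨u, hu⟩
  have h : ModM1 d r ≤ stableToLie d (isStable_top (r := r)) := by
    rw [ModM1, LieSubmodule.lieSpan_le, Set.singleton_subset_iff]
    exact ⟨1, trivial, polyToM_one r⟩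
  obtain ⟨f, -, hf⟩ := h hu
  exact ⟨f, Subtype.ext hf⟩

/-- The polynomials in a submodule of `M_r^{(1)}`. -/
def lieToStable (N : LieSubmodule ℂ (LieL1 d r) (ModM1 d r)) : Submodule ℂ (SymPoly ℕ) :=
  N.toSubmodule.comap (polyToM₁ d r)

theorem mem_lieToStable {N : LieSubmodule ℂ (LieL1 d r) (ModM1 d r)} {f : SymPoly ℕ} :
    f ∈ lieToStable N ↔ polyToM₁ d r f ∈ N := Iff.rfl

theorem isStable_lieToStable (N : LieSubmodule ℂ (LieL1 d r) (ModM1 d r)) :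
    IsStable r (lieToStable N) where
  entry_mul_mem s t f hf := by
    have h1 : polyToM₁ d r (entry s t * f)
        = ⁅(⟨nord r (creat₁ d s) (creat₁ d t), nord_mem_LieL1 _ _⟩ : LieL1 d r),
          polyToM₁ d r f⁆ := Subtype.ext (polyToM_entry_mul r s t f)
    rw [mem_lieToStable, h1]
    exact N.lie_mem hf
  polar_mem s t f hf := by
    have h1 : ((t : ℂ) + 1) • polyToM₁ d r (polar s t f)
        = ⁅(⟨nord r (creat₁ d s) (annih₁ d t), nord_mem_LieL1 _ _⟩ : LieL1 d r),
          polyToM₁ d r f⁆ := Subtype.ext (polar_polyToM r s t f).symm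
    rw [mem_lieToStable]
    refine (N.toSubmodule.smul_mem_iff (Nat.cast_add_one_ne_zero (R := ℂ) t)).mp ?_
    rw [h1]
    exact N.lie_mem hf
  second_mem s t f hf := by
    have h1 : (((s : ℂ) + 1) * ((t : ℂ) + 1)) • polyToM₁ d r (second r s t f)
        = ⁅(⟨nord r (annih₁ d s) (annih₁ d t), nord_mem_LieL1 _ _⟩ : LieL1 d r),
          polyToM₁ d r f⁆ := Subtype.ext (second_polyToM r s t f).symm
    rw [mem_lieToStable]
    refine (N.toSubmodule.smul_mem_iff
      (mul_ne_zero (Nat.cast_add_one_ne_zero (R := ℂ) s) (Nat.cast_add_one_ne_zero t))).mp ?_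
    rw [h1]
    exact N.lie_mem hf

theorem eq_top_of_one_mem {N : LieSubmodule ℂ (LieL1 d r) (ModM1 d r)}
    (h : (1 : SymPoly ℕ) ∈ lieToStable N) : N = ⊤ := by
  rw [eq_top_iff]
  intro u _
  obtain ⟨f, rfl⟩ := polyToM₁_surjective u
  have := (isStable_lieToStable N).mul_mem f h
  rwa [mul_one] at this

/-! ### Determinants -/

theorem polyToUL_minor (p : ℕ) : polyToUL d r (minor p) = detV d r p := by
  have h1 : minor p = ∑ σ : Equiv.Perm (Fin p), (Equiv.Perm.sign σ : ℤ) •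
      (List.ofFn fun q : Fin p => entry (q : ℕ) (σ q : ℕ)).prod := by
    rw [minor, Matrix.det_apply]
    refine Finset.sum_congr rfl fun σ _ => ?_
    rw [List.prod_ofFn, Units.smul_def]
    congr 1
    -- `Matrix.det_apply` uses the entries (σ q, q), while `detV` uses (q, σ q); the matrix is
    -- symmetric.
    exact Finset.prod_congr rfl fun q _ => entry_comm _ _
  rw [h1, map_sum, detV]
  refine Finset.sum_congr rfl fun σ _ => ?_
  rw [map_zsmul, map_list_prod, List.map_ofFn]
  congr 3
  funext q
  rw [Function.comp_apply, polyToUL_entry, lv_eq_nord_of r (Or.inr (Or.inl (by omega)))]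
  exact congrArg iota (congrArg₂ (nord r) (Prod.ext rfl (Int.negSucc_eq _))
    (Prod.ext rfl (Int.negSucc_eq _)))

theorem polyToM₁_pow_minor (p ν : ℕ) : polyToM₁ d r (minor p ^ ν) = detVec d r p ν :=
  Subtype.ext (by
    rw [coe_polyToM₁, polyToM_apply, map_pow, polyToUL_minor]
    rfl)

/-! ### Singular vectors -/

theorem IsSingular.smul {u : ModM1 d r} (h : IsSingular u) {c : ℂ} (hc : c ≠ 0) :
    IsSingular (c • u) := by
  obtain ⟨h0, ⟨lam, h1, h2, h3⟩, h4⟩ := h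
  refine ⟨smul_ne_zero hc h0, ⟨lam, h1, h2, fun k l => ?_⟩, fun m n hmn => ?_⟩
  · change ⁅hElt r k l, c • (u : ModM d r)⁆ = _ • c • (u : ModM d r)
    rw [lie_smul, h3, smul_comm]
  · change ⁅lv r (0 : Fin d) 0 m n, c • (u : ModM d r)⁆ = 0
    rw [lie_smul, h4 m n hmn, smul_zero]

/-- For l = -(s + 1) the normalization -1/l cancels the mode number in `polar_polyToM`, so weights
for the h_{1,l} count occurrences of indices. -/
theorem hElt_polyToM (s : ℕ) (hs : Int.negSucc s < 0) (f : SymPoly ℕ) :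
    ⁅hElt r (0 : Fin d) ⟨Int.negSucc s, hs⟩, polyToM d r f⁆ = polyToM d r (polar s s f) := by
  have h : hElt r (0 : Fin d) ⟨Int.negSucc s, hs⟩
      = ((s : ℂ) + 1)⁻¹ • nord r (creat₁ d s) (annih₁ d s) := by
    rw [hElt, lv_eq_nord_of r (Or.inr (Or.inr (by change Int.negSucc s ≤ -Int.negSucc s; omega)))]
    congr 1
    rw [Int.cast_negSucc]
    push_cast
    rw [one_div, inv_neg, neg_neg]
  rw [h, smul_lie]
  change _ • iota (nord r (creat₁ d s) (annih₁ d s)) • polyToM d r f = _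
  rw [polar_polyToM, smul_smul, inv_mul_cancel₀ (Nat.cast_add_one_ne_zero s), one_smul]

theorem IsSingular.exists_weight {f : SymPoly ℕ} (h : IsSingular (polyToM₁ d r f)) :
    ∃ lam : ℕ →₀ ℕ, lam ≠ 0 ∧ HasWeight f lam := by
  obtain ⟨-, ⟨lam, h1, h2, h3⟩, -⟩ := h
  have hinj : Function.Injective fun s : ℕ =>
      ((0 : Fin d), (⟨Int.negSucc s, Int.negSucc_lt_zero s⟩ : {l : ℤ // l < 0})) := fun s t hst => by
    simpa using hst
  -- The weight is pulled back along s ↦ Λ_{1,-(s+1)}. It stays nonzero because `lam` vanishes on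
  -- all other blocks.
  refine ⟨lam.comapDomain _ hinj.injOn, fun h => h2 ?_, hasWeight_of_polar_self fun s => ?_⟩
  · ext ⟨k, l, hl⟩
    by_cases hk : k = 0
    · subst hk
      match l with
      | Int.negSucc s => exact DFunLike.congr_fun h s
      | Int.ofNat s => exact absurd hl (by simp)
    · exact h1 k _ hk
  · apply polyToM_injective (d := d) r
    rw [← hElt_polyToM s (Int.negSucc_lt_zero s), map_smul]
    exact h3 0 ⟨Int.negSucc s, _⟩

theorem IsSingular.isHighest {f : SymPoly ℕ} (h : IsSingular (polyToM₁ d r f)) : IsHighest f := by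
  intro s t hst
  -- The modes -(s + 1) and t + 1 have sum t - s > 0, so raising operators are among the elements
  -- killing a singular vector.
  have h1 := h.2.2 (Int.negSucc s) (Int.ofNat (t + 1)) (by simp only [Int.ofNat_eq_natCast]; omega)
  rw [lv_eq_nord_of r (Or.inr (Or.inl (by simp only [Int.ofNat_eq_natCast]; omega)))] at h1
  have h2 := (polar_polyToM (d := d) r s t f).symm.trans h1
  rw [smul_eq_zero] at h2
  exact (map_eq_zero_iff _ (polyToM_injective r)).mp
    (h2.resolve_left (Nat.cast_add_one_ne_zero t))

theorem IsSingular.second_eq_zero {f : SymPoly ℕ} (h : IsSingular (polyToM₁ d r f)) (s : ℕ) :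
    second r s s f = 0 := by
  have h1 := h.2.2 (Int.ofNat (s + 1)) (Int.ofNat (s + 1))
    (by simp only [Int.ofNat_eq_natCast]; omega)
  rw [lv_eq_nord_of r (Or.inr (Or.inr le_rfl))] at h1
  have h2 := (second_polyToM (d := d) r s s f).symm.trans h1
  rw [smul_eq_zero] at h2
  exact (map_eq_zero_iff _ (polyToM_injective r)).mp (h2.resolve_left
    (mul_ne_zero (Nat.cast_add_one_ne_zero s) (Nat.cast_add_one_ne_zero s)))

theorem IsSingular.exists_eq_smul_detVec {u : ModM1 d r} (hu : IsSingular u) :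
    ∃ p ν : ℕ, 1 ≤ p ∧ 1 ≤ ν ∧ r = 1 - 2 * ν + p ∧ IsSingular (detVec d r p ν) ∧
      ∃ c : ℂ, u = c • detVec d r p ν := by
  obtain ⟨f, rfl⟩ := polyToM₁_surjective u
  obtain ⟨lam, hlam, hfl⟩ := hu.exists_weight
  have hf0 : f ≠ 0 := by
    rintro rfl
    exact hu.1 (map_zero _)
  obtain ⟨p, ν, c, hp, hν, hr, rfl⟩ :=
    eq_pow_minor_of_second_eq_zero hu.isHighest hfl hf0 hlam hu.second_eq_zero
  have hc : c ≠ 0 := by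
    rintro rfl
    exact hf0 (zero_smul _ _)
  rw [map_smul, polyToM₁_pow_minor] at hu ⊢
  refine ⟨p, ν, hp, hν, hr, ?_, c, rfl⟩
  have := hu.smul (inv_ne_zero hc)
  rwa [smul_smul, inv_mul_cancel₀ hc, one_smul] at this

/-! ### The maximal submodule -/

/-- All generators lie in the submodule given by `secondIdeal`, which does not contain the vacuum.
-/
theorem one_notMem_lieToStable_SubW1 (d : ℕ) [NeZero d] (r : ℤ) :
    (1 : SymPoly ℕ) ∉ lieToStable (SubW1 d r) := by
  have h : SubW1 d r ≤ (stableToLie d (isStable_secondIdeal (r : ℂ))).comap (ModM1 d r).incl := by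
    rw [SubW1, LieSubmodule.lieSpan_le]
    rintro w ⟨p, ν, hp, hν, hr, rfl⟩
    rw [← polyToM₁_pow_minor]
    exact (mem_stableToLie (hV := isStable_secondIdeal (r : ℂ))).mpr (mem_secondIdeal_of_mem
      (pow_minor_mem_secondKernel hp hν (by rw [hr]; push_cast; rfl)))
  intro h1
  exact one_notMem_secondIdeal (r : ℂ) 
    ((mem_stableToLie (hV := isStable_secondIdeal (r : ℂ))).mp (h h1))

theorem SubW1_ne_top (d : ℕ) [NeZero d] (r : ℤ) : SubW1 d r ≠ ⊤ := fun h =>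
  one_notMem_lieToStable_SubW1 d r (by rw [h]; trivial)

theorem le_SubW1 {r : ℤ} {N : LieSubmodule ℂ (LieL1 d (r : ℂ)) (ModM1 d (r : ℂ))} (hN : N ≠ ⊤) :
    N ≤ SubW1 d r := by
  intro u hu
  obtain ⟨f, rfl⟩ := polyToM₁_surjective u
  refine (isStable_lieToStable N).le_of_pow_minor_mem (isStable_lieToStable (SubW1 d r))
    (fun h => hN (eq_top_of_one_mem h)) (one_notMem_lieToStable_SubW1 d r)
    (fun p ν hp hν hr => ?_) hu
  rw [mem_lieToStable, polyToM₁_pow_minor]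
  exact LieSubmodule.subset_lieSpan ⟨p, ν, hp, hν, by exact_mod_cast hr, rfl⟩

theorem isIrreducible_quotient_SubW1 (d : ℕ) [NeZero d] (r : ℤ) :
    LieModule.IsIrreducible ℂ (LieL1 d (r : ℂ)) (ModM1 d (r : ℂ) ⧸ SubW1 d r) := by
  have : Nontrivial (ModM1 d (r : ℂ) ⧸ SubW1 d r) :=
    Submodule.Quotient.nontrivial_iff.mpr fun h => SubW1_ne_top d r
      (LieSubmodule.toSubmodule_injective h)
  refine LieModule.IsIrreducible.mk fun N hN => ?_
  by_contra hN'
  apply hN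
  -- The preimage of a proper submodule of the quotient is proper, hence contained in `SubW1`, so
  -- its image is 0.
  have h : N.comap (LieSubmodule.Quotient.mk' (SubW1 d r)) ≤ SubW1 d r := le_SubW1 fun h => hN' <| by
    rw [eq_top_iff]
    intro x _
    obtain ⟨u, rfl⟩ := LieSubmodule.Quotient.surjective_mk' _ x
    have hu : u ∈ N.comap (LieSubmodule.Quotient.mk' (SubW1 d r)) := by rw [h]; trivial
    exact hu
  rw [eq_bot_iff]
  intro x hx
  obtain ⟨u, rfl⟩ := LieSubmodule.Quotient.surjective_mk' _ x
  exact (LieSubmodule.Quotient.mk_eq_zero _).mpr (h hx)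

end Transfer

end NiiboriSagaki

end

theorem proposition6p4 (d : ℕ) [NeZero d] (hd : 2 ≤ d) (r : ℤ) :
    (∀ u : NiiboriSagaki.ModM1 d (r : ℂ), NiiboriSagaki.IsSingular u →
      ∃ p ν : ℕ, 1 ≤ p ∧ 1 ≤ ν ∧ r = 1 - 2 * (ν : ℤ) + (p : ℤ) ∧
        NiiboriSagaki.IsSingular (NiiboriSagaki.detVec d (r : ℂ) p ν) ∧
        ∃ c : ℂ, u = c • NiiboriSagaki.detVec d (r : ℂ) p ν) ∧
    (NiiboriSagaki.SubW1 d r ≠ ⊤ ∧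
      ∀ N : LieSubmodule ℂ (NiiboriSagaki.LieL1 d (r : ℂ)) (NiiboriSagaki.ModM1 d (r : ℂ)),
        N ≠ ⊤ → N ≤ NiiboriSagaki.SubW1 d r) ∧
    LieModule.IsIrreducible ℂ (NiiboriSagaki.LieL1 d (r : ℂ))
      (NiiboriSagaki.ModM1 d (r : ℂ) ⧸ NiiboriSagaki.SubW1 d r) := by
  refine ⟨fun u hu => ?_, ⟨NiiboriSagaki.SubW1_ne_top d r, fun N => NiiboriSagaki.le_SubW1⟩,
    NiiboriSagaki.isIrreducible_quotient_SubW1 d r⟩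
  obtain ⟨p, ν, hp, hν, hr, h⟩ := hu.exists_eq_smul_detVec
  exact ⟨p, ν, hp, hν, by exact_mod_cast hr, h⟩
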